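/- **Network.** Let $\mathcal N$ and $\mathcal F$ be finite sets of nodes and flows, with a symmetric neighbourhood relation $m\in\mathcal A(n)$, and disjoint sets $\mathcal S_f,\mathcal D_f\subset\mathcal N$ of sources and destinations of each flow $f$. For $\mathbf s\in\{0,1\}^{\mathcal N}$ ($s_n=1$: node $n$ transmits) let $\mathcal P(\mathbf s)$ be the set of power allocations $\mathbf p=(p_{n,m})$ with $0\le p_{n,m}\le 1$, $p_{n,m}\le s_n(1-s_m)$, $p_{n,m}=0$ for $m\notin\mathcal A(n)$, and $\sum_{m\in\mathcal A(n)}p_{n,m}\le 1$. The rate of link $(n,m)$ in bits per frame is $$r_{n,m}(\mathbf p)=\alpha_1T_{\rm f}W\log_2\Big(1+\alpha_2\frac{p_{n,m}P_n|G_{n,m}|^2}{I_{n,m}(\mathbf p)+WN_o}\Big),\qquad I_{n,m}(\mathbf p)=\sum_{(i,j)\neq(n,m)}|\Gamma_{n,m}^{i,j}|^2P_i\,p_{i,j},$$ with positive $\alpha_1,\alpha_2,T_{\rm f},W,N_o,P_n$ and arbitrary complex gains $G,\Gamma$ ($\Gamma=0$: negligible interference). Let $\breve{\mathcal P}(\mathbf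 s)\subset\mathcal P(\mathbf s)$ be arbitrary subsets. **Policies, stability, capacity.** In frame $t$ a causal policy chooses $\mathbf s(t)$, $\mathbf p(t)\in\breve{\mathcal P}(\mathbf s(t))$ and flow rates $r^f_{n,m}(t)\ge 0$ with $\sum_fr^f_{n,m}(t)\le r_{n,m}(\mathbf p(t))$ and $\sum_{m\in\mathcal A(n)}r^f_{n,m}(t)\le q_n^f(t)$. The queues start from a deterministic nonnegative state, satisfy $q_n^f(t)=0$ for $n\in\mathcal D_f$, and otherwise $$q_n^f(t+1)=q_n^f(t)+\sum_{m\in\mathcal A(n)}r^f_{m,n}(t)-\sum_{m\in\mathcal A(n)}r^f_{n,m}(t)+a_n^f(t).$$ The arrivals $a_n^f(t)\ge0$ have conditional mean $\lambda_n^f(t)$ given the history up to the scheduling of frame $t$, and conditional fourth moments bounded by a constant $K$. The network is *stable* if almost surely $\limsup_{T\to\infty}\frac1T\sum_{t<T}\|\mathbf q(t)\|_1<\infty$. The constrained capacity region $\breve{\mathcal X}$ is the set of $\mathbf x\in\mathbb R_{\ge0}^{\mathcal N\times\mathcal F}$ for which there are arrivals (at any nodes) with $\frac1T\sum_{t<T}\boldsymbol\lambda(t)\to\mathbf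 x$ almost surely and a causal policy that makes the network stable; $\mathcal X$ is the same with $\mathcal P$ in place of $\breve{\mathcal P}$. $\operatorname{Int}\breve{\mathcal X}$ denotes the interior relative to the nonnegative orthant. **Constrained MU-MIMO MBP.** Given $\mathbf q$, choose $f^*_{n,m}\in\arg\max_f(q_n^f-q_m^f)$, set $\xi_{n,m}=r_{n,m}(\mathbf p)/\sum_{m':f^*_{n,m'}=f^*_{n,m}}r_{n,m'}(\mathbf p)$ (zero if the denominator vanishes), let $r^f_{n,m}(\mathbf p)=\min(r_{n,m}(\mathbf p),q_n^f\xi_{n,m})$ if $f=f^*_{n,m}$ and $q_n^f>q_m^f$, and $r_{n,m}^f(\mathbf p)=0$ otherwise, and choose $(\mathbf s,\mathbf p)$ that maximizes $\sum_{n,m}\max_fr^f_{n,m}(\mathbf p)(q_n^f-q_m^f)$ over $\mathbf s\in\{0,1\}^{\mathcal N}$, $\mathbf p\in\breve{\mathcal P}(\mathbf s)$. **ANCC with parameter $V>0$.** $\lambda_n^f(t)=\max(\min((\dot{\mathscr U}^{f})^{-1}(q_n^f(t)/V),\lambda_{\max}),0)$ for $n\in\mathcal S_f$ and $\lambda_n^f(t)=0$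 otherwise, where $(\dot{\mathscr U}^f)^{-1}(y)=\sup\{x>0:\dot{\mathscr U}^f(x)\ge y\}$ and $\lambda_{\max}=\max_n|\mathcal A(n)|\cdot\max_{n,m}r_{n,m}$, the link rates being taken at $p_{n,m}=1$ without interference. Each utility $\mathscr U^f$ is continuous, non-decreasing and strictly concave on its domain, and differentiable on $(0,\infty)$; its domain is $[0,\infty)$, or $(0,\infty)$ with $\mathscr U^f(0^+)=-\infty$. The constrained NUM problem is $$\max\ \Phi(\mathbf x),\qquad \Phi(\mathbf x)=\sum_f\sum_{n\in\mathcal S_f}\mathscr U^f(x_n^f),$$ over the $\mathbf x\in\breve{\mathcal X}$ with $x_n^f=0$ for $n\notin\mathcal S_f$ and source rates in the domains. If every flow has exactly one source, one may equivalently take $\Phi(\mathbf x)=\sum_f\mathscr U^f(\sum_nx_n^f)$. **Lemma.** 1. $\breve{\mathcal X}\subset\mathcal X$, and for every $\mathbf x\in\operatorname{Int}\breve{\mathcal X}$ constrained MBP makes the network stable under all arrivals as above with $\boldsymbol\lambda(t)=\mathbf x$ for all $t$. 2. Suppose $\operatorname{Int}\breve{\mathcal X}\ne\emptyset$. For every $K$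 there is a constant $C$ such that, for all $V>0$, the network under constrained MBP and ANCC is stable, and for every feasible $\mathbf x$ of the constrained NUM problem, almost surely $\Phi\big(\frac1T\sum_{t<T}\boldsymbol\lambda(t)\big)\ge\Phi(\mathbf x)-C/V$ for all large $T$. 3. Suppose $\operatorname{Int}\breve{\mathcal X}\ne\emptyset$ and let $\mathbf x^*$ solve the constrained NUM problem. For all $K$ and $\varepsilon>0$ there is $V_0>0$ such that, for all $V\ge V_0$, almost surely for all large $T$ both the average rate $\frac1T\sum_{t<T}\boldsymbol\lambda(t)$ and the solution $\mathbf x^V$ of $\max_{\mathbf x}V\Phi(\mathbf x)-\bar{\mathbf q}^T\mathbf x$, with $\Phi$ the sum over the sources, $\bar{\mathbf q}=\frac1T\sum_{t<T}\mathbf q(t)$ and $\mathbf x$ ranging over the source rates at most $\lambda_{\max}$, are within $\varepsilon$ of $\mathbf x^*$. 4. The fixed equal power allocation $p_{n,m}=s_n(1-s_m)/|\mathcal A(n)|$ for $m\in\mathcal A(n)$ (and $0$ otherwise) lies in $\mathcal P(\mathbf s)$. If $\breve{\mathcal P}(\mathbf s)$ consists of this allocation only and $\Gamma=0$, then for $\mathbf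 q\ge0$ the MBP choices are exactly the $\mathbf s$ that maximize $\sum_{(n,m)\in\mathcal L_{TR}(\mathbf s)}w_{n,m}$ (with $\mathbf p$ the equal power allocation), where $\mathcal L_{TR}(\mathbf s)=\{(n,m):m\in\mathcal A(n),s_n=1,s_m=0\}$, $w_{n,m}=\min(R_{n,m},q_n^{f^*_{n,m}}\xi_{n,m})\max(0,\max_f(q_n^f-q_m^f))$, $R_{n,m}$ is the link rate at $p_{n,m}=1/|\mathcal A(n)|$, and $\xi_{n,m}=R_{n,m}/\sum R_{n,m'}$, the sum running over the $m'$ with $(n,m')\in\mathcal L_{TR}(\mathbf s)$ and $f^*_{n,m'}=f^*_{n,m}$. -/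

import Mathlib

open MeasureTheory Filter Topology

noncomputable section

namespace MUMIMO

/-- A multi-hop MU-MIMO network with nodes `N` and traffic flows `F`. -/
structure Network (N F : Type*) [Fintype N] where
  /-- Pairs of nodes that can reach each other; `(n, m)` and `(m, n)` are then both links. -/
  graph : SimpleGraph N
  /-- Sources of each flow. -/
  src : F → Finset N
  /-- Destinations of each flow (anycast: a bit leaves the network at any of them). -/
  dst : F → Finset N
  src_disjoint_dst : ∀ f, Disjoint (src f) (dst f)
  /-- Spectral efficiency factor. -/
  α₁ : ℝ
  /-- Power efficiency factor. -/
  α₂ : ℝ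
  /-- Frame duration. -/
  frame : ℝ
  /-- Bandwidth. -/
  bandwidth : ℝ
  /-- Noise power spectral density. -/
  noise : ℝ
  /-- Power budget of each node. -/
  power : N → ℝ
  α₁_pos : 0 < α₁
  α₂_pos : 0 < α₂
  frame_pos : 0 < frame
  bandwidth_pos : 0 < bandwidth
  noise_pos : 0 < noise
  power_pos : ∀ n, 0 < power n
  /-- Equivalent complex gain of link `(n, m)`, beamforming included. -/
  gain : N → N → ℂ
  /-- `crossGain n m i j` is the complex gain with which the signal that `i` sends to `j` arrives
  at the port of `m` that receives from `n`; all zero when interference is neglected. -/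
  crossGain : N → N → N → N → ℂ

/-- Normalized power allocations `p n m`. -/
abbrev Alloc (N : Type*) := N → N → ℝ

/-- Vectors with one entry per queue, i.e. per node and flow. -/
abbrev QVec (N F : Type*) := N → F → ℝ

namespace Network

variable {N F : Type*} [Fintype N] [DecidableEq N] [Fintype F] [DecidableEq F]

open scoped Classical in
/-- The neighbours of node `n`. -/
def nbrs (net : Network N F) (n : N) : Finset N :=
  Finset.univ.filter fun m => net.graph.Adj n m

/-- The valid power allocations when the transmit/receive state of the nodes is `s`
(`s n = true` when `n` transmits): only links from a transmitting to a receiving neighbour carry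
power, and each node shares at most its unit budget. -/
def allocations (net : Network N F) (s : N → Bool) : Set (Alloc N) :=
  {p | (∀ n m, 0 ≤ p n m ∧ p n m ≤ 1) ∧
    (∀ n, ∑ m ∈ net.nbrs n, p n m ≤ 1) ∧
    (∀ n m, p n m ≠ 0 → m ∈ net.nbrs n ∧ s n = true ∧ s m = false)}

/-- Interference power received in link `(n, m)`. -/
def interference (net : Network N F) (p : Alloc N) (n m : N) : ℝ :=
  ∑ i, ∑ j, if i = n ∧ j = m then 0 else p i j * net.power i * ‖net.crossGain n m i j‖ ^ 2

/-- Rate of link `(n, m)`, in bits per frame, under the allocation `p`. -/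
def linkRate (net : Network N F) (p : Alloc N) (n m : N) : ℝ :=
  net.α₁ * net.frame * net.bandwidth * Real.logb 2 (1 + net.α₂ *
    (p n m * net.power n * ‖net.gain n m‖ ^ 2 /
      (net.interference p n m + net.bandwidth * net.noise)))

/-- Interference-free rate of link `(n, m)` when it gets the fraction `y` of the power. -/
def soloRate (net : Network N F) (n m : N) (y : ℝ) : ℝ :=
  net.α₁ * net.frame * net.bandwidth * Real.logb 2 (1 + net.α₂ *
    (y * net.power n * ‖net.gain n m‖ ^ 2 / (net.bandwidth * net.noise)))

/-! ### Maximum back pressure -/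

/-- The choice of a flow of highest queue pressure for every link. -/
def IsTopFlow (q : QVec N F) (fs : N → N → F) : Prop :=
  ∀ n m f, q n f - q m f ≤ q n (fs n m) - q m (fs n m)

/-- The share of the queue of flow `fs n m` at node `n` that is offered to link `(n, m)`. -/
def share (net : Network N F) (fs : N → N → F) (p : Alloc N) (n m : N) : ℝ :=
  net.linkRate p n m /
    ∑ m' ∈ Finset.univ.filter (fun m' => fs n m' = fs n m), net.linkRate p n m'

/-- Flow rates of the back-pressure algorithm: link `(n, m)` serves only its flow of highest
pressure, and only when that pressure is positive. -/
def mbpRate (net : Network N F) (q : QVec N F) (fs : N → N → F) (p : Alloc N)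
    (n m : N) (f : F) : ℝ :=
  if f = fs n m ∧ 0 < q n f - q m f then min (net.linkRate p n m) (q n f * net.share fs p n m)
  else 0

/-- The sum queue-pressure metric. -/
def mbpObjective (net : Network N F) (q : QVec N F) (fs : N → N → F) (p : Alloc N) : ℝ :=
  ∑ n, ∑ m, ⨆ f, net.mbpRate q fs p n m f * (q n f - q m f)

/-- `(s, p)` is a choice of the MU-MIMO maximum back pressure algorithm at queue state `q`, when
the allowed power allocations for node state `s` are `Pc s`. -/
def IsMBPChoice (net : Network N F) (Pc : (N → Bool) → Set (Alloc N)) (q : QVec N F)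
    (fs : N → N → F) (s : N → Bool) (p : Alloc N) : Prop :=
  IsTopFlow q fs ∧ p ∈ Pc s ∧
    ∀ s', ∀ p' ∈ Pc s', net.mbpObjective q fs p' ≤ net.mbpObjective q fs p

/-! ### Queueing processes -/

/-- A random evolution of the network under a causal scheduling policy that only uses the power
allocations in `Pc`. The history before the arrivals of frame `t` is the σ-algebra `ℱ t`. -/
structure Run (net : Network N F) (Pc : (N → Bool) → Set (Alloc N))
    {Ω : Type*} [MeasurableSpace Ω] (μ : Measure Ω) where
  ℱ : Filtration ℕ (inferInstance : MeasurableSpace Ω)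
  /-- Initial queue lengths. -/
  q₀ : QVec N F
  /-- Queue lengths, in bits. -/
  q : ℕ → Ω → QVec N F
  /-- Transmit/receive states. -/
  s : ℕ → Ω → N → Bool
  /-- Power allocations. -/
  p : ℕ → Ω → Alloc N
  /-- `rate t ω n m f` bits of flow `f` go from `n` to `m` in frame `t`. -/
  rate : ℕ → Ω → N → N → F → ℝ
  /-- Exogenous arrivals. -/
  a : ℕ → Ω → QVec N F
  /-- Mean arrival rates given the history. -/
  lam : ℕ → Ω → QVec N F
  q₀_nonneg : 0 ≤ q₀
  q₀_dst : ∀ f, ∀ n ∈ net.dst f, q₀ n f = 0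
  measurable_s : ∀ t, Measurable[ℱ t] (s t)
  measurable_p : ∀ t, Measurable[ℱ t] (p t)
  measurable_rate : ∀ t, Measurable[ℱ t] (rate t)
  measurable_lam : ∀ t, Measurable[ℱ t] (lam t)
  measurable_a : ∀ t, Measurable[ℱ (t + 1)] (a t)
  p_mem : ∀ t ω, p t ω ∈ Pc (s t ω)
  rate_nonneg : ∀ t ω n m f, 0 ≤ rate t ω n m f
  rate_le_link : ∀ t ω n m, ∑ f, rate t ω n m f ≤ net.linkRate (p t ω) n m
  rate_le_queue : ∀ t ω n f, ∑ m ∈ net.nbrs n, rate t ω n m f ≤ q t ω n f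
  a_nonneg : ∀ t ω, 0 ≤ a t ω
  integrable_a : ∀ t n f, Integrable (fun ω => a t ω n f) μ
  condExp_a : ∀ t n f, μ[fun ω => a t ω n f | ℱ t] =ᵐ[μ] fun ω => lam t ω n f
  q_zero : ∀ ω, q 0 ω = q₀
  q_succ : ∀ t ω n f, q (t + 1) ω n f =
    if n ∈ net.dst f then 0
    else q t ω n f + ∑ m ∈ net.nbrs n, rate t ω m n f - ∑ m ∈ net.nbrs n, rate t ω n m f
      + a t ω n f

namespace Run

variable {net : Network N F} {Pc : (N → Bool) → Set (Alloc N)}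
  {Ω : Type*} [MeasurableSpace Ω] {μ : Measure Ω}

/-- The conditional fourth moments of the arrivals are at most `K`. -/
def MomentBound (R : Run net Pc μ) (K : ℝ) : Prop :=
  ∀ t n f, Integrable (fun ω => R.a t ω n f ^ 4) μ ∧
    μ[fun ω => R.a t ω n f ^ 4 | R.ℱ t] ≤ᵐ[μ] fun _ => K

/-- Average of the arrival rates over the first `T` frames. -/
def avgRate (R : Run net Pc μ) (T : ℕ) (ω : Ω) : QVec N F :=
  fun n f => (∑ t ∈ Finset.range T, R.lam t ω n f) / T

/-- Average of the queue lengths over the first `T` frames. -/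
def avgQueue (R : Run net Pc μ) (T : ℕ) (ω : Ω) : QVec N F :=
  fun n f => (∑ t ∈ Finset.range T, R.q t ω n f) / T

/-- Stability: almost surely the time average of the total queue length stays bounded. -/
def Stable (R : Run net Pc μ) : Prop :=
  ∀ᵐ ω ∂μ, ∃ B : ℝ, ∀ᶠ T : ℕ in atTop, ∑ n, ∑ f, R.avgQueue T ω n f ≤ B

/-- The run is scheduled by MU-MIMO maximum back pressure over the allocations `Pc`. -/
def IsMBP (R : Run net Pc μ) : Prop :=
  ∃ fs : ℕ → Ω → N → N → F, ∀ t ω,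
    net.IsMBPChoice Pc (R.q t ω) (fs t ω) (R.s t ω) (R.p t ω) ∧
    R.rate t ω = net.mbpRate (R.q t ω) (fs t ω) (R.p t ω)

end Run

/-- Throughput capacity region under the allocations `Pc`: the long-term average arrival rates for
which some causal scheduling policy keeps the network stable. -/
def capacityRegion (net : Network N F) (Pc : (N → Bool) → Set (Alloc N)) : Set (QVec N F) :=
  {x | ∃ (Ω : Type) (_ : MeasurableSpace Ω) (μ : Measure Ω) (_ : IsProbabilityMeasure μ)
    (R : Run net Pc μ) (K : ℝ), R.MomentBound K ∧
      (∀ᵐ ω ∂μ, Tendsto (fun T => R.avgRate T ω) atTop (𝓝 x)) ∧ R.Stable}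

/-- Interior of the capacity region relative to the set of nonnegative rate vectors. -/
def capacityInterior (net : Network N F) (Pc : (N → Bool) → Set (Alloc N)) : Set (QVec N F) :=
  {x | 0 ≤ x ∧ net.capacityRegion Pc ∈ 𝓝[Set.Ici 0] x}

/-! ### Utilities and congestion control -/

/-- `U` is a strictly concave differentiable utility function with domain `D`. The domain is
`[0, ∞)`, or `(0, ∞)` for a utility such as the logarithm that is `-∞` at zero. -/
structure IsUtility (D : Set ℝ) (U : ℝ → ℝ) : Prop where
  domain : D = Set.Ici 0 ∨ (D = Set.Ioi 0 ∧ Tendsto U (𝓝[>] 0) atBot)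
  continuousOn : ContinuousOn U D
  monotoneOn : MonotoneOn U D
  strictConcaveOn : StrictConcaveOn ℝ D U
  differentiableOn : DifferentiableOn ℝ U (Set.Ioi 0)

/-- Largest link rate at full power. -/
def rateMax (net : Network N F) : ℝ := ⨆ n, ⨆ m : net.nbrs n, net.soloRate n m 1

/-- Cap of the source rates: the maximum degree times the largest link rate. -/
def lamMax (net : Network N F) : ℝ :=
  (Finset.univ.sup fun n => (net.nbrs n).card : ℕ) * net.rateMax

/-- `max (min (U'⁻¹ y) b) 0`, where `U'⁻¹ y` is the generalized inverse
`sup {x > 0 | y ≤ U' x}` of the decreasing function `U'`. -/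
def clippedInvDeriv (U : ℝ → ℝ) (b y : ℝ) : ℝ :=
  sSup (insert 0 {x | 0 < x ∧ x < b ∧ y ≤ deriv U x})

/-- The source rates are set by adaptive NUM congestion control with parameter `V`. -/
def Run.IsANCC {net : Network N F} {Pc : (N → Bool) → Set (Alloc N)}
    {Ω : Type*} [MeasurableSpace Ω] {μ : Measure Ω}
    (R : Run net Pc μ) (U : F → ℝ → ℝ) (V : ℝ) : Prop :=
  ∀ t ω n f, R.lam t ω n f =
    if n ∈ net.src f then clippedInvDeriv (U f) net.lamMax (R.q t ω n f / V) else 0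

/-- Network utility `∑_f U^f (∑_n x_n^f)`. -/
def flowUtility (U : F → ℝ → ℝ) (x : QVec N F) : ℝ := ∑ f, U f (∑ n, x n f)

/-- Network utility `∑_f ∑_{n ∈ S_f} U^f (x_n^f)`, in which every source is counted
separately. -/
def sourceUtility (net : Network N F) (U : F → ℝ → ℝ) (x : QVec N F) : ℝ :=
  ∑ f, ∑ n ∈ net.src f, U f (x n f)

/-- The rate vectors with no arrivals outside the sources, and source rates in the domains of the
utilities. -/
def sourceVectors (net : Network N F) (D : F → Set ℝ) : Set (QVec N F) :=
  {x | ∀ f n, (n ∈ net.src f → x n f ∈ D f) ∧ (n ∉ net.src f → x n f = 0)}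

/-- The feasible set of the NUM problem: the rate vectors in the capacity region with arrivals at
the sources only. -/
def numFeasible (net : Network N F) (Pc : (N → Bool) → Set (Alloc N)) (D : F → Set ℝ) :
    Set (QVec N F) :=
  net.capacityRegion Pc ∩ net.sourceVectors D

/-- `x` maximizes `V ∑_{n,f} U^f (x_n^f) - qᵀ x` over the source rates in `[0, lamMax]`. -/
def IsPenalizedOptimum (net : Network N F) (D : F → Set ℝ) (U : F → ℝ → ℝ) (V : ℝ)
    (q x : QVec N F) : Prop :=
  x ∈ net.sourceVectors D ∩ {y | ∀ n f, y n f ≤ net.lamMax} ∧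
    IsMaxOn (fun y => V * net.sourceUtility U y - ∑ n, ∑ f, q n f * y n f)
      (net.sourceVectors D ∩ {y | ∀ n f, y n f ≤ net.lamMax}) x

/-! ### Fixed equal power and directed bipartite subgraphs -/

/-- Links of the directed bipartite subgraph induced by `s`: from a transmitter to a receiver. -/
def dbsgLinks (net : Network N F) (s : N → Bool) : Finset (N × N) :=
  Finset.univ.filter fun l => l.2 ∈ net.nbrs l.1 ∧ s l.1 = true ∧ s l.2 = false

/-- Fixed equal power: every link of the subgraph gets the same share of its transmitter's
power. -/
def equalPower (net : Network N F) (s : N → Bool) : Alloc N :=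
  fun n m => if (n, m) ∈ net.dbsgLinks s then 1 / ((net.nbrs n).card : ℝ) else 0

/-- Constant link rate under fixed equal power without interference. -/
def fixedRate (net : Network N F) (n m : N) : ℝ :=
  net.soloRate n m (1 / ((net.nbrs n).card : ℝ))

/-- Queue-pressure weight of link `(n, m)` under fixed equal power; the queue is shared among the
links of the subgraph that serve the same flow. -/
def dbsgWeight (net : Network N F) (q : QVec N F) (fs : N → N → F) (s : N → Bool)
    (n m : N) : ℝ :=
  min (net.fixedRate n m) (q n (fs n m) * (net.fixedRate n m /
      ∑ m' ∈ Finset.univ.filter (fun m' => (n, m') ∈ net.dbsgLinks s ∧ fs n m' = fs n m),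
        net.fixedRate n m'))
    * max 0 (⨆ f, (q n f - q m f))

/-- `s` induces a maximum weighted directed bipartite subgraph. -/
def IsMaxWeightDBSG (net : Network N F) (q : QVec N F) (fs : N → N → F) (s : N → Bool) : Prop :=
  ∀ s', ∑ l ∈ net.dbsgLinks s', net.dbsgWeight q fs s' l.1 l.2 ≤
    ∑ l ∈ net.dbsgLinks s, net.dbsgWeight q fs s l.1 l.2

end Network

end MUMIMO

end

/-! Everything turns on the functional `maxWeight Pc w`, the supremum over allowed allocations of
link rate times positive pressure. It is sublinear in `w` and describes the capacity region up to
its boundary. A rate vector `x` in the region satisfies `dot w x ≤ maxWeight Pc w` for all `w ≥ 0`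
that vanish at destinations (`dot_le_maxWeight`), since otherwise the weighted backlog would grow
linearly. Conversely, an inequality with margin `δ * total w` suffices
(`HasMargin.mem_capacityRegion`), and interior points have such a margin.

Back pressure attains `maxWeight` at the current queues up to a constant, because the queue shares
bind only on short queues (`IsMBPChoice.maxWeight_le`). Hence the squared queue length drifts by at
most `-2 (maxWeight q - q·λ)` plus a constant, the squared arrivals and the noise `2 q·(a - λ)`. For
almost sure conclusions this noise must average out although `q` is not known to be bounded. The
strong law for martingale differences needs the second moments of `q t` to be summable against `1 /
(t + 1)²`, and this follows from the drift of the fourth-order function `lyap ^ 2`, which uses the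
fourth moments of the arrivals. The resulting pathwise bound
`ae_eventually_sum_maxWeight_sub_dot_le` has a constant that depends only on the network, the
scheduling loss and `K`, not on `V` or on the margin.

The congestion controller maximizes `V Φ(x) - q·x` over a box in every frame. Comparison with a
strictly feasible point gives negative drift, hence stability; comparison with a feasible point and
Jensen's inequality give the loss `C / V`.

For convergence, strict concavity yields a uniform midpoint gap `κ` outside the `ε`-ball around the
optimum. The average rates are almost feasible, so mixing with a strictly feasible point shows that
their utility can hardly exceed the optimum. For large `V` both an average rate and a penalized
optimum outside the ball contradict this. Under fixed equal power without interference, the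
back-pressure metric equals the subgraph weight link by link. -/

noncomputable section

namespace MUMIMO

/-! ### Martingale tools -/

section Martingale

/-- Kronecker's lemma with weights `t + 1`. -/
theorem tendsto_average_of_tendsto_weighted_sum {d : ℕ → ℝ} {c : ℝ}
    (h : Tendsto (fun T => ∑ t ∈ Finset.range T, d t / ((t : ℝ) + 1)) atTop (𝓝 c)) :
    Tendsto (fun T : ℕ => (∑ t ∈ Finset.range T, d t) / T) atTop (𝓝 0) := by
  set s : ℕ → ℝ := fun T => ∑ t ∈ Finset.range T, d t / ((t : ℝ) + 1) with hs
  -- Summation by parts. After division by `T` this is `s T` minus a Cesàro mean of `s`, and both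
  -- tend to `c`.
  have key : ∀ T : ℕ, ∑ t ∈ Finset.range T, d t = T * s T - ∑ t ∈ Finset.range T, s t := by
    intro T
    induction T with
    | zero => simp
    | succ T ih =>
      have h1 : s (T + 1) = s T + d T / ((T : ℝ) + 1) := Finset.sum_range_succ _ _
      rw [Finset.sum_range_succ, Finset.sum_range_succ, ih, h1]
      push_cast
      field_simp
      ring
  have h2 : Tendsto (fun T : ℕ => s T - (T : ℝ)⁻¹ * ∑ t ∈ Finset.range T, s t) atTop
      (𝓝 (c - c)) := h.sub h.cesaro
  rw [sub_self] at h2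
  refine h2.congr' ?_
  filter_upwards [eventually_gt_atTop 0] with T hT
  have : (T : ℝ) ≠ 0 := by positivity
  rw [key]
  field_simp

variable {Ω : Type*} {m0 : MeasurableSpace Ω} {μ : Measure Ω} [IsProbabilityMeasure μ]

/-- Pulling a factor known at time `m` out of an expectation. -/
theorem integral_mul_condExp {m : MeasurableSpace Ω} (hm : m ≤ m0) {Z Y : Ω → ℝ}
    (hZ : StronglyMeasurable[m] Z) (hZY : Integrable (Z * Y) μ) (hY : Integrable Y μ) :
    ∫ ω, Z ω * Y ω ∂μ = ∫ ω, Z ω * (μ[Y | m]) ω ∂μ := by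
  have h := condExp_mul_of_stronglyMeasurable_left hZ hZY hY
  calc ∫ ω, Z ω * Y ω ∂μ = ∫ ω, (μ[Z * Y | m]) ω ∂μ := (integral_condExp hm).symm
    _ = _ := integral_congr_ae h

theorem integral_mul_le_of_condExp_le {m : MeasurableSpace Ω} (hm : m ≤ m0) {Z Y : Ω → ℝ}
    {k : ℝ} (hZ : StronglyMeasurable[m] Z) (hZY : Integrable (Z * Y) μ) (hY : Integrable Y μ)
    (hZi : Integrable Z μ) (hZ0 : ∀ ω, 0 ≤ Z ω) (hk : μ[Y | m] ≤ᵐ[μ] fun _ => k) :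
    ∫ ω, Z ω * Y ω ∂μ ≤ k * ∫ ω, Z ω ∂μ := by
  rw [integral_mul_condExp hm hZ hZY hY, ← integral_const_mul]
  refine integral_mono_ae ?_ (hZi.const_mul k) ?_
  · exact (integrable_condExp (m := m) (f := Z * Y)).congr
      (condExp_mul_of_stronglyMeasurable_left hZ hZY hY)
  · filter_upwards [hk] with ω h
    rw [mul_comm k]
    exact mul_le_mul_of_nonneg_left h (hZ0 ω)

theorem integral_mul_eq_zero_of_condExp_eq_zero {m : MeasurableSpace Ω} (hm : m ≤ m0)
    {Z Y : Ω → ℝ} (hZ : StronglyMeasurable[m] Z) (hZY : Integrable (Z * Y) μ)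
    (hY : Integrable Y μ) (h0 : μ[Y | m] =ᵐ[μ] 0) : ∫ ω, Z ω * Y ω ∂μ = 0 := by
  rw [integral_mul_condExp hm hZ hZY hY]
  refine integral_eq_zero_of_ae ?_
  filter_upwards [h0] with ω h
  simp [h]

/-- Strong law of large numbers for martingale differences. -/
theorem ae_tendsto_average_of_martingale_difference {ℱ : Filtration ℕ m0} {d : ℕ → Ω → ℝ}
    (hm : ∀ t, StronglyMeasurable[ℱ (t + 1)] (d t)) (h2 : ∀ t, MemLp (d t) 2 μ)
    (h0 : ∀ t, μ[d t | ℱ t] =ᵐ[μ] 0) {B : ℝ}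
    (hB : ∀ T, ∑ t ∈ Finset.range T, (∫ ω, d t ω ^ 2 ∂μ) / ((t : ℝ) + 1) ^ 2 ≤ B) :
    ∀ᵐ ω ∂μ, Tendsto (fun T : ℕ => (∑ t ∈ Finset.range T, d t ω) / T) atTop (𝓝 0) := by
  -- The weighted sums form a martingale bounded in `L²`, hence convergent almost surely, and
  -- Kronecker's lemma applies on each path.
  set M : ℕ → Ω → ℝ := fun T => ∑ t ∈ Finset.range T, fun ω => ((t : ℝ) + 1)⁻¹ * d t ω with hM
  have hMsucc : ∀ T, M (T + 1) = M T + fun ω => ((T : ℝ) + 1)⁻¹ * d T ω := fun T =>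
    Finset.sum_range_succ _ _
  have hMm : StronglyAdapted ℱ M := by
    intro T
    refine Finset.stronglyMeasurable_sum _ fun t ht => ?_
    exact ((hm t).mono (ℱ.mono (Finset.mem_range.1 ht))).const_mul _
  have hM2 : ∀ T, MemLp (M T) 2 μ := fun T =>
    memLp_finsetSum' _ fun t _ => (h2 t).const_mul _
  have hmart : Martingale M ℱ μ := by
    refine martingale_of_condExp_sub_eq_zero_nat hMm
      (fun T => (hM2 T).integrable (by norm_num)) fun T => ?_
    have e : M (T + 1) - M T = ((T : ℝ) + 1)⁻¹ • d T := by
      rw [hMsucc]; ext ω; simp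
    rw [e]
    refine (condExp_smul _ _ _).trans ?_
    filter_upwards [h0 T] with ω h
    simp [h]
  have hsq : ∀ T, ∫ ω, M T ω ^ 2 ∂μ ≤ B := by
    intro T
    refine le_trans (le_of_eq ?_) (hB T)
    clear hB
    induction T with
    | zero => simp [hM]
    | succ T ih =>
      rw [Finset.sum_range_succ, ← ih]
      -- Orthogonality of the increments: second moments add up.
      have hz : ∫ ω, M T ω * d T ω ∂μ = 0 :=
        integral_mul_eq_zero_of_condExp_eq_zero (ℱ.le T) (hMm T)
          ((hM2 T).integrable_mul (h2 T)) ((h2 T).integrable (by norm_num)) (h0 T)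
      have e : ∀ ω, M (T + 1) ω ^ 2 = M T ω ^ 2 + (2 * ((T : ℝ) + 1)⁻¹) * (M T ω * d T ω)
          + (((T : ℝ) + 1) ^ 2)⁻¹ * d T ω ^ 2 := by
        intro ω; rw [hMsucc]; simp only [Pi.add_apply]; field_simp; ring
      have i1 : Integrable (fun ω => M T ω ^ 2) μ := (hM2 T).integrable_sq
      have i2 : Integrable (fun ω => (2 * ((T : ℝ) + 1)⁻¹) * (M T ω * d T ω)) μ :=
        ((hM2 T).integrable_mul (h2 T)).const_mul _
      have i3 : Integrable (fun ω => (((T : ℝ) + 1) ^ 2)⁻¹ * d T ω ^ 2) μ :=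
        (h2 T).integrable_sq.const_mul _
      have i12 : Integrable (fun ω => M T ω ^ 2 + (2 * ((T : ℝ) + 1)⁻¹) * (M T ω * d T ω)) μ :=
        i1.add i2
      simp_rw [e]
      rw [integral_add i12 i3, integral_add i1 i2, integral_const_mul,
        integral_const_mul, hz]
      ring
  have hL1 : ∀ T, eLpNorm (M T) 1 μ ≤ ((1 + B).toNNReal : NNReal) := by
    intro T
    have hi : Integrable (M T) μ := (hM2 T).integrable (by norm_num)
    rw [eLpNorm_one_eq_lintegral_enorm, ← ofReal_integral_norm_eq_lintegral_enorm hi]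
    refine ENNReal.ofReal_le_ofReal ?_
    -- The bound `|x| ≤ 1 + x²` converts the `L²` bound `B` into the `L¹` bound `1 + B`.
    have h1 : ∫ ω, ‖M T ω‖ ∂μ ≤ ∫ ω, (1 + M T ω ^ 2) ∂μ := by
      refine integral_mono hi.norm ((integrable_const _).add (hM2 T).integrable_sq) fun ω => ?_
      simp only [Real.norm_eq_abs]
      nlinarith [sq_abs (M T ω), sq_nonneg (|M T ω| - 1)]
    rw [integral_add (integrable_const _) (hM2 T).integrable_sq] at h1
    simp only [integral_const, probReal_univ, smul_eq_mul, one_mul] at h1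
    linarith [hsq T]
  filter_upwards [hmart.submartingale.exists_ae_tendsto_of_bdd hL1] with ω hω
  obtain ⟨c, hc⟩ := hω
  refine tendsto_average_of_tendsto_weighted_sum (c := c) (hc.congr fun T => ?_)
  simp only [hM, Finset.sum_apply]
  exact Finset.sum_congr rfl fun t _ => by rw [div_eq_inv_mul]

theorem sum_div_sq_le {u : ℕ → ℝ} {k : ℝ} (hk : 0 ≤ k) (hu : ∀ t, u t ≤ k) (T : ℕ) :
    ∑ t ∈ Finset.range T, u t / ((t : ℝ) + 1) ^ 2 ≤ k * ∑' t : ℕ, 1 / ((t : ℝ) + 1) ^ 2 := by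
  have hs : Summable fun t : ℕ => 1 / ((t : ℝ) + 1) ^ 2 := by
    have := (summable_nat_add_iff 1).2 (Real.summable_one_div_nat_pow.2 (one_lt_two))
    simpa using this
  calc ∑ t ∈ Finset.range T, u t / ((t : ℝ) + 1) ^ 2
      ≤ ∑ t ∈ Finset.range T, k * (1 / ((t : ℝ) + 1) ^ 2) := by
        refine Finset.sum_le_sum fun t _ => ?_
        rw [mul_one_div]
        exact div_le_div_of_nonneg_right (hu t) (by positivity)
    _ = k * ∑ t ∈ Finset.range T, 1 / ((t : ℝ) + 1) ^ 2 := by rw [Finset.mul_sum]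
    _ ≤ _ := mul_le_mul_of_nonneg_left (hs.sum_le_tsum _ fun t _ => by positivity) hk

/-- If `u t` is compensated by the decrease of a nonnegative `Y` up to a constant, then `u` is
summable against `1 / (t + 1)²`. -/
theorem sum_div_sq_le_of_drift {u Y : ℕ → ℝ} {k : ℝ} (hk : 0 ≤ k) (hY : ∀ t, 0 ≤ Y t)
    (h : ∀ t, Y (t + 1) + u t ≤ Y t + k) (T : ℕ) :
    ∑ t ∈ Finset.range T, u t / ((t : ℝ) + 1) ^ 2
      ≤ Y 0 + k * ∑' t : ℕ, 1 / ((t : ℝ) + 1) ^ 2 := by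
  -- The weights decrease in `t`, so the boundary term `Y (T + 1)` may be kept with the smaller next
  -- weight and the sum telescopes.
  have h1 : ∀ T : ℕ, ∑ t ∈ Finset.range T, u t / ((t : ℝ) + 1) ^ 2 + Y T / ((T : ℝ) + 1) ^ 2
      ≤ Y 0 + ∑ t ∈ Finset.range T, k / ((t : ℝ) + 1) ^ 2 := by
    intro T
    induction T with
    | zero => simp
    | succ T ih =>
      rw [Finset.sum_range_succ, Finset.sum_range_succ]
      have h2 : Y (T + 1) / (((T + 1 : ℕ) : ℝ) + 1) ^ 2 ≤ Y (T + 1) / ((T : ℝ) + 1) ^ 2 := by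
        refine div_le_div_of_nonneg_left (hY _) (by positivity) ?_
        push_cast
        gcongr
        linarith
      have h3 : (Y (T + 1) + u T) / ((T : ℝ) + 1) ^ 2 ≤ (Y T + k) / ((T : ℝ) + 1) ^ 2 :=
        div_le_div_of_nonneg_right (h T) (by positivity)
      rw [add_div, add_div] at h3
      linarith
  have h4 := h1 T
  have h5 := sum_div_sq_le (u := fun _ => k) hk (fun _ => le_rfl) T
  have h6 : 0 ≤ Y T / ((T : ℝ) + 1) ^ 2 := div_nonneg (hY T) (by positivity)
  linarith

end Martingale


namespace Network

/-! ### Linear algebra of queue vectors and the pressure functional -/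

section Vectors

variable {N F : Type*} [Fintype N] [Fintype F]

/-- The pairing of queue vectors. -/
def dot (w x : QVec N F) : ℝ := ∑ n, ∑ f, w n f * x n f

/-- The sum of all entries. -/
def total (w : QVec N F) : ℝ := ∑ n, ∑ f, w n f

/-- The quadratic Lyapunov function. -/
def lyap (w : QVec N F) : ℝ := ∑ n, ∑ f, w n f ^ 2

theorem dot_mono_right {w x y : QVec N F} (hw : 0 ≤ w) (h : x ≤ y) : dot w x ≤ dot w y :=
  Finset.sum_le_sum fun n _ => Finset.sum_le_sum fun f _ =>
    mul_le_mul_of_nonneg_left (h n f) (hw n f)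

theorem dot_add_right (w x y : QVec N F) : dot w (x + y) = dot w x + dot w y := by
  simp [dot, mul_add, Finset.sum_add_distrib]

theorem dot_sub_right (w x y : QVec N F) : dot w (x - y) = dot w x - dot w y := by
  simp [dot, mul_sub, Finset.sum_sub_distrib]

theorem dot_add_left (w x y : QVec N F) : dot (w + x) y = dot w y + dot x y := by
  simp [dot, add_mul, Finset.sum_add_distrib]

theorem dot_smul_right (c : ℝ) (w x : QVec N F) : dot w (c • x) = c * dot w x := by
  simp only [dot, Pi.smul_apply, smul_eq_mul, Finset.mul_sum]
  exact Finset.sum_congr rfl fun n _ => Finset.sum_congr rfl fun f _ => by ring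

theorem dot_smul_left (c : ℝ) (w x : QVec N F) : dot (c • w) x = c * dot w x := by
  simp only [dot, Pi.smul_apply, smul_eq_mul, Finset.mul_sum]
  exact Finset.sum_congr rfl fun n _ => Finset.sum_congr rfl fun f _ => by ring

theorem dot_const (w : QVec N F) (c : ℝ) : dot w (fun _ _ => c) = c * total w := by
  simp only [dot, total, Finset.mul_sum]
  exact Finset.sum_congr rfl fun n _ => Finset.sum_congr rfl fun f _ => by ring

theorem dot_sum_right {ι : Type*} (s : Finset ι) (w : QVec N F) (x : ι → QVec N F) :
    dot w (∑ i ∈ s, x i) = ∑ i ∈ s, dot w (x i) := by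
  classical
  induction s using Finset.induction_on with
  | empty => simp [dot]
  | insert i s hi ih => rw [Finset.sum_insert hi, Finset.sum_insert hi, dot_add_right, ih]

theorem dot_sum_left {ι : Type*} (s : Finset ι) (w : ι → QVec N F) (x : QVec N F) :
    dot (∑ i ∈ s, w i) x = ∑ i ∈ s, dot (w i) x := by
  classical
  induction s using Finset.induction_on with
  | empty => simp [dot]
  | insert i s hi ih => rw [Finset.sum_insert hi, Finset.sum_insert hi, dot_add_left, ih]

theorem total_nonneg {w : QVec N F} (hw : 0 ≤ w) : 0 ≤ total w :=
  Finset.sum_nonneg fun n _ => Finset.sum_nonneg fun f _ => hw n f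

theorem entry_le_total {w : QVec N F} (hw : 0 ≤ w) (n : N) (f : F) : w n f ≤ total w :=
  (Finset.single_le_sum (f := fun f => w n f) (fun f _ => hw n f) (Finset.mem_univ f)).trans
    (Finset.single_le_sum (f := fun n => ∑ f, w n f)
      (fun n _ => Finset.sum_nonneg fun f _ => hw n f) (Finset.mem_univ n))

theorem lyap_nonneg (w : QVec N F) : 0 ≤ lyap w :=
  Finset.sum_nonneg fun _ _ => Finset.sum_nonneg fun _ _ => sq_nonneg _

theorem sq_entry_le_lyap (w : QVec N F) (n : N) (f : F) : w n f ^ 2 ≤ lyap w :=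
  entry_le_total (w := fun n f => w n f ^ 2) (fun _ _ => sq_nonneg _) n f

theorem lyap_le_total_sq {w : QVec N F} (hw : 0 ≤ w) : lyap w ≤ total w ^ 2 := by
  rw [sq, total, Finset.sum_mul]
  refine Finset.sum_le_sum fun n _ => ?_
  rw [Finset.sum_mul]
  refine Finset.sum_le_sum fun f _ => ?_
  rw [sq]
  exact mul_le_mul_of_nonneg_left (entry_le_total hw n f) (hw n f)

/-- The largest positive pressure over link `(n, m)`. -/
def pressure (w : QVec N F) (n m : N) : ℝ := ⨆ f, max 0 (w n f - w m f)

omit [Fintype N] in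
theorem le_pressure (w : QVec N F) (n m : N) (f : F) : w n f - w m f ≤ pressure w n m :=
  (le_max_right _ _).trans
    (le_ciSup (f := fun f => max 0 (w n f - w m f)) (Set.finite_range _).bddAbove f)

omit [Fintype N] [Fintype F] in
theorem pressure_nonneg (w : QVec N F) (n m : N) : 0 ≤ pressure w n m :=
  Real.iSup_nonneg fun _ => le_max_left _ _

omit [Fintype N] [Fintype F] in
theorem pressure_le {w : QVec N F} {n m : N} {c : ℝ} (hc : 0 ≤ c)
    (h : ∀ f, w n f - w m f ≤ c) : pressure w n m ≤ c :=
  Real.iSup_le (fun f => max_le hc (h f)) hc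

omit [Fintype N] in
theorem pressure_add_le (w x : QVec N F) (n m : N) :
    pressure (w + x) n m ≤ pressure w n m + pressure x n m := by
  refine pressure_le (add_nonneg (pressure_nonneg _ _ _) (pressure_nonneg _ _ _)) fun f => ?_
  have h1 := le_pressure w n m f
  have h2 := le_pressure x n m f
  simp only [Pi.add_apply]
  linarith

omit [Fintype N] in
theorem pressure_smul_le {c : ℝ} (hc : 0 ≤ c) (w : QVec N F) (n m : N) :
    pressure (c • w) n m ≤ c * pressure w n m := by
  refine pressure_le (mul_nonneg hc (pressure_nonneg _ _ _)) fun f => ?_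
  have h1 := mul_le_mul_of_nonneg_left (le_pressure w n m f) hc
  simp only [Pi.smul_apply, smul_eq_mul]
  linarith

end Vectors

/-! ### Bounds on link rates -/

section Rates

variable {N F : Type*} [Fintype N]

theorem mem_nbrs {net : Network N F} {n m : N} : m ∈ net.nbrs n ↔ net.graph.Adj n m := by
  simp [nbrs]

theorem mem_nbrs_comm {net : Network N F} {n m : N} : m ∈ net.nbrs n ↔ n ∈ net.nbrs m := by
  rw [mem_nbrs, mem_nbrs, net.graph.adj_comm]

theorem soloRate_nonneg (net : Network N F) (n m : N) {y : ℝ} (hy : 0 ≤ y) :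
    0 ≤ net.soloRate n m y := by
  have := net.α₁_pos; have := net.α₂_pos; have := net.frame_pos; have := net.bandwidth_pos
  have := net.noise_pos; have := net.power_pos n
  refine mul_nonneg (by positivity) (Real.logb_nonneg one_lt_two ?_)
  have : 0 ≤ net.α₂ * (y * net.power n * ‖net.gain n m‖ ^ 2 / (net.bandwidth * net.noise)) := by
    positivity
  linarith

theorem rateMax_nonneg (net : Network N F) : 0 ≤ net.rateMax :=
  Real.iSup_nonneg fun _ => Real.iSup_nonneg fun _ => net.soloRate_nonneg _ _ zero_le_one

theorem soloRate_one_le_rateMax (net : Network N F) {n m : N} (h : m ∈ net.nbrs n) :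
    net.soloRate n m 1 ≤ net.rateMax :=
  (le_ciSup (f := fun m : net.nbrs n => net.soloRate n m 1) (Set.finite_range _).bddAbove
    ⟨m, h⟩).trans
    (le_ciSup (f := fun n => ⨆ m : net.nbrs n, net.soloRate n m 1)
      (Set.finite_range _).bddAbove n)

theorem lamMax_nonneg (net : Network N F) : 0 ≤ net.lamMax :=
  mul_nonneg (Nat.cast_nonneg _) net.rateMax_nonneg

theorem card_mul_rateMax_le_lamMax (net : Network N F) (n : N) :
    ((net.nbrs n).card : ℝ) * net.rateMax ≤ net.lamMax := by
  refine mul_le_mul_of_nonneg_right ?_ net.rateMax_nonneg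
  exact_mod_cast Finset.le_sup (f := fun n => (net.nbrs n).card) (Finset.mem_univ n)

variable [DecidableEq N]

theorem interference_nonneg (net : Network N F) {s : N → Bool} {p : Alloc N}
    (hp : p ∈ net.allocations s) (n m : N) : 0 ≤ net.interference p n m := by
  refine Finset.sum_nonneg fun i _ => Finset.sum_nonneg fun j _ => ?_
  split_ifs
  · exact le_rfl
  · have := (hp.1 i j).1
    have := net.power_pos i
    positivity

theorem linkRate_nonneg (net : Network N F) {s : N → Bool} {p : Alloc N}
    (hp : p ∈ net.allocations s) (n m : N) : 0 ≤ net.linkRate p n m := by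
  have := net.α₁_pos; have := net.α₂_pos; have := net.frame_pos; have := net.bandwidth_pos
  have := net.noise_pos; have := net.power_pos n
  have := net.interference_nonneg hp n m
  have := (hp.1 n m).1
  refine mul_nonneg (by positivity) (Real.logb_nonneg one_lt_two ?_)
  have : 0 ≤ net.α₂ * (p n m * net.power n * ‖net.gain n m‖ ^ 2 /
      (net.interference p n m + net.bandwidth * net.noise)) := by
    positivity
  linarith

theorem linkRate_of_power_eq_zero (net : Network N F) {p : Alloc N} {n m : N}
    (h : p n m = 0) : net.linkRate p n m = 0 := by
  simp [linkRate, h]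

theorem linkRate_of_not_mem (net : Network N F) {s : N → Bool} {p : Alloc N}
    (hp : p ∈ net.allocations s) {n m : N} (h : m ∉ net.nbrs n) : net.linkRate p n m = 0 := by
  refine net.linkRate_of_power_eq_zero ?_
  by_contra h0
  exact h (hp.2.2 n m h0).1

/-- Interference only lowers the rate and the power fraction is at most one, so the
interference-free rate at full power dominates. -/
theorem linkRate_le_rateMax (net : Network N F) {s : N → Bool} {p : Alloc N}
    (hp : p ∈ net.allocations s) (n m : N) : net.linkRate p n m ≤ net.rateMax := by
  by_cases h : m ∈ net.nbrs n
  · refine le_trans ?_ (net.soloRate_one_le_rateMax h)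
    have := net.α₁_pos; have := net.α₂_pos; have := net.frame_pos; have := net.bandwidth_pos
    have := net.noise_pos; have := net.power_pos n
    have hI := net.interference_nonneg hp n m
    obtain ⟨h0, h1⟩ := hp.1 n m
    refine mul_le_mul_of_nonneg_left ?_ (by positivity)
    refine Real.logb_le_logb_of_le one_lt_two (by positivity) ?_
    gcongr
    linarith
  · rw [net.linkRate_of_not_mem hp h]
    exact net.rateMax_nonneg

end Rates

/-! ### The maximum weight as a sublinear functional -/

section MaxWeight

variable {N F : Type*} [Fintype N] [DecidableEq N]

/-- The maximum-weight objective of an allocation. -/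
def weight (net : Network N F) (w : QVec N F) (p : Alloc N) : ℝ :=
  ∑ n, ∑ m, net.linkRate p n m * pressure w n m

/-- The supremum of the maximum-weight objective over all allowed allocations. -/
def maxWeight (net : Network N F) (Pc : (N → Bool) → Set (Alloc N)) (w : QVec N F) : ℝ :=
  ⨆ p : (⋃ s, Pc s : Set (Alloc N)), net.weight w p

variable {net : Network N F} {Pc : (N → Bool) → Set (Alloc N)}

theorem weight_nonneg {s : N → Bool} {p : Alloc N} (hp : p ∈ net.allocations s)
    (w : QVec N F) : 0 ≤ net.weight w p :=
  Finset.sum_nonneg fun n _ => Finset.sum_nonneg fun m _ =>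
    mul_nonneg (net.linkRate_nonneg hp n m) (pressure_nonneg w n m)

/-- The hypothesis `0 ≤ c` covers the case without allowed allocations, in which the real supremum
takes the default value `0`. -/
theorem maxWeight_le {w : QVec N F} {c : ℝ} (hc : 0 ≤ c)
    (h : ∀ s, ∀ p ∈ Pc s, net.weight w p ≤ c) : net.maxWeight Pc w ≤ c := by
  refine Real.iSup_le (fun p => ?_) hc
  obtain ⟨s, hs⟩ := Set.mem_iUnion.1 p.2
  exact h s _ hs

variable (hPc : ∀ s, Pc s ⊆ net.allocations s)
include hPc

theorem weight_le_maxWeight {s : N → Bool} {p : Alloc N} (hp : p ∈ Pc s) (w : QVec N F) :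
    net.weight w p ≤ net.maxWeight Pc w := by
  refine le_ciSup (f := fun p : (⋃ s, Pc s : Set (Alloc N)) => net.weight w p) ?_
    ⟨p, Set.mem_iUnion.2 ⟨s, hp⟩⟩
  refine ⟨∑ n, ∑ m, net.rateMax * pressure w n m, ?_⟩
  rintro _ ⟨p', rfl⟩
  obtain ⟨s', hs'⟩ := Set.mem_iUnion.1 p'.2
  exact Finset.sum_le_sum fun n _ => Finset.sum_le_sum fun m _ =>
    mul_le_mul_of_nonneg_right (net.linkRate_le_rateMax (hPc s' hs') n m) (pressure_nonneg w n m)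

theorem maxWeight_nonneg (w : QVec N F) : 0 ≤ net.maxWeight Pc w := by
  refine Real.iSup_nonneg fun p => ?_
  obtain ⟨s, hs⟩ := Set.mem_iUnion.1 p.2
  exact weight_nonneg (hPc s hs) w

variable [Fintype F]

/-- Subadditivity passes from the pressures to the supremum. Together with positive homogeneity it
compares `maxWeight` at the average queue with the average of `maxWeight` over the frames. -/
theorem maxWeight_add_le (w x : QVec N F) :
    net.maxWeight Pc (w + x) ≤ net.maxWeight Pc w + net.maxWeight Pc x := by
  refine maxWeight_le (add_nonneg (maxWeight_nonneg hPc w) (maxWeight_nonneg hPc x))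
    fun s p hp => ?_
  refine le_trans ?_ (add_le_add (weight_le_maxWeight hPc hp w) (weight_le_maxWeight hPc hp x))
  simp only [weight, ← Finset.sum_add_distrib, ← mul_add]
  exact Finset.sum_le_sum fun n _ => Finset.sum_le_sum fun m _ =>
    mul_le_mul_of_nonneg_left (pressure_add_le w x n m) (net.linkRate_nonneg (hPc s hp) n m)

theorem maxWeight_smul_le {c : ℝ} (hc : 0 ≤ c) (w : QVec N F) :
    net.maxWeight Pc (c • w) ≤ c * net.maxWeight Pc w := by
  refine maxWeight_le (mul_nonneg hc (maxWeight_nonneg hPc w)) fun s p hp => ?_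
  refine le_trans ?_ (mul_le_mul_of_nonneg_left (weight_le_maxWeight hPc hp w) hc)
  simp only [weight, Finset.mul_sum]
  refine Finset.sum_le_sum fun n _ => Finset.sum_le_sum fun m _ => ?_
  have := mul_le_mul_of_nonneg_left (pressure_smul_le hc w n m)
    (net.linkRate_nonneg (hPc s hp) n m)
  linarith

theorem maxWeight_sum_le {ι : Type*} (t : Finset ι) (w : ι → QVec N F) :
    net.maxWeight Pc (∑ i ∈ t, w i) ≤ ∑ i ∈ t, net.maxWeight Pc (w i) := by
  classical
  induction t using Finset.induction_on with
  | empty =>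
    have := maxWeight_smul_le hPc le_rfl (0 : QVec N F)
    simpa using this
  | insert i t hi ih =>
    rw [Finset.sum_insert hi, Finset.sum_insert hi]
    exact (maxWeight_add_le hPc _ _).trans (by linarith)

end MaxWeight

/-! ### Admissible flows and the one-frame quadratic drift -/

section Flows

variable {N F : Type*} [Fintype N] [DecidableEq N] [Fintype F]

/-- Flow rates that respect the link rates of an allocation and the queue lengths. -/
structure Admissible (net : Network N F) (p : Alloc N) (q : QVec N F) (r : N → N → F → ℝ) :
    Prop where
  nonneg : ∀ n m f, 0 ≤ r n m f
  le_link : ∀ n m, ∑ f, r n m f ≤ net.linkRate p n m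
  le_queue : ∀ n f, ∑ m ∈ net.nbrs n, r n m f ≤ q n f

/-- Weighted backpressure of flow rates. -/
def flowGain (w : QVec N F) (r : N → N → F → ℝ) : ℝ :=
  ∑ n, ∑ m, ∑ f, r n m f * (w n f - w m f)

variable {net : Network N F} {s : N → Bool} {p : Alloc N} {q : QVec N F} {r : N → N → F → ℝ}

theorem Admissible.queue_nonneg (h : net.Admissible p q r) : 0 ≤ q := fun n f =>
  (Finset.sum_nonneg fun m _ => h.nonneg n m f).trans (h.le_queue n f)

theorem Admissible.rate_le (h : net.Admissible p q r) (n m : N) (f : F) :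
    r n m f ≤ net.linkRate p n m :=
  (Finset.single_le_sum (f := fun f => r n m f) (fun f _ => h.nonneg n m f)
    (Finset.mem_univ f)).trans (h.le_link n m)

theorem Admissible.rate_eq_zero (h : net.Admissible p q r) (hp : p ∈ net.allocations s)
    {n m : N} (hm : m ∉ net.nbrs n) (f : F) : r n m f = 0 :=
  le_antisymm ((h.rate_le n m f).trans_eq (net.linkRate_of_not_mem hp hm)) (h.nonneg n m f)

theorem Admissible.sum_out (h : net.Admissible p q r) (hp : p ∈ net.allocations s) (n : N)
    (f : F) : ∑ m ∈ net.nbrs n, r n m f = ∑ m, r n m f :=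
  Finset.sum_subset (Finset.subset_univ _) fun _ _ hm => h.rate_eq_zero hp hm f

theorem Admissible.sum_in (h : net.Admissible p q r) (hp : p ∈ net.allocations s) (n : N)
    (f : F) : ∑ m ∈ net.nbrs n, r m n f = ∑ m, r m n f :=
  Finset.sum_subset (Finset.subset_univ _) fun _ _ hm =>
    h.rate_eq_zero hp (fun h' => hm (mem_nbrs_comm.1 h')) f

/-- Net inflow of a queue. -/
def netInflow (net : Network N F) (r : N → N → F → ℝ) : QVec N F := fun n f =>
  ∑ m ∈ net.nbrs n, r m n f - ∑ m ∈ net.nbrs n, r n m f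

/-- Summation by parts on the graph: a bit moved from `n` to `m` is counted with `w m` at its
arrival and with `-w n` at its departure. -/
theorem Admissible.dot_netInflow (h : net.Admissible p q r) (hp : p ∈ net.allocations s)
    (w : QVec N F) : dot w (net.netInflow r) = -flowGain w r := by
  have e : ∀ n f, w n f * net.netInflow r n f = ∑ m, r m n f * w n f - ∑ m, r n m f * w n f := by
    intro n f
    rw [netInflow, h.sum_out hp, h.sum_in hp, ← Finset.sum_mul, ← Finset.sum_mul]
    ring
  have e1 : ∑ n, ∑ f, ∑ m, r n m f * w n f = ∑ n, ∑ m, ∑ f, r n m f * w n f :=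
    Finset.sum_congr rfl fun n _ => Finset.sum_comm
  have e2 : ∑ n, ∑ f, ∑ m, r m n f * w n f = ∑ n, ∑ m, ∑ f, r n m f * w m f := by
    rw [Finset.sum_comm (f := fun n m => ∑ f, r n m f * w m f)]
    exact Finset.sum_congr rfl fun n _ => Finset.sum_comm
  simp only [dot, e, Finset.sum_sub_distrib, flowGain, mul_sub, e1, e2]
  ring

theorem Admissible.abs_netInflow_le (h : net.Admissible p q r) (hp : p ∈ net.allocations s)
    (n : N) (f : F) : |net.netInflow r n f| ≤ Fintype.card N * net.rateMax := by
  have b : ∀ g : N → ℝ, (∀ m, g m ≤ net.rateMax) → ∑ m, g m ≤ Fintype.card N * net.rateMax := by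
    intro g hg
    simpa using Finset.sum_le_card_nsmul Finset.univ g net.rateMax fun m _ => hg m
  have h1 := b (fun m => r m n f) fun m => (h.rate_le m n f).trans (net.linkRate_le_rateMax hp _ _)
  have h2 := b (fun m => r n m f) fun m => (h.rate_le n m f).trans (net.linkRate_le_rateMax hp _ _)
  have h3 : 0 ≤ ∑ m, r m n f := Finset.sum_nonneg fun m _ => h.nonneg _ _ _
  have h4 : 0 ≤ ∑ m, r n m f := Finset.sum_nonneg fun m _ => h.nonneg _ _ _
  rw [netInflow, h.sum_out hp, h.sum_in hp, abs_le]
  constructor <;> linarith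

theorem Admissible.flowGain_le_weight (h : net.Admissible p q r) (w : QVec N F) :
    flowGain w r ≤ net.weight w p := by
  refine Finset.sum_le_sum fun n _ => Finset.sum_le_sum fun m _ => ?_
  calc ∑ f, r n m f * (w n f - w m f) ≤ ∑ f, r n m f * pressure w n m :=
        Finset.sum_le_sum fun f _ => mul_le_mul_of_nonneg_left (le_pressure w n m f)
          (h.nonneg n m f)
    _ = (∑ f, r n m f) * pressure w n m := by rw [Finset.sum_mul]
    _ ≤ _ := mul_le_mul_of_nonneg_right (h.le_link n m) (pressure_nonneg w n m)

/-- The constant in the quadratic drift that bounds the transport in one frame. -/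
def driftConst (net : Network N F) : ℝ :=
  2 * (Fintype.card N * (Fintype.card F * (Fintype.card N * net.rateMax) ^ 2))

omit [DecidableEq N] in
theorem driftConst_nonneg (net : Network N F) : 0 ≤ net.driftConst := by
  unfold driftConst; positivity

/-- Off the destinations the new entry is `q + b + a` with net inflow `b`. The square is expanded
with `2ab ≤ a² + b²`, the term `2qb` sums to `-2 * flowGain q r`, and `2b²` sums to at most
`driftConst`. At destinations the old and the new entry both vanish. -/
theorem Admissible.lyap_le (h : net.Admissible p q r) (hp : p ∈ net.allocations s)
    {q' a : QVec N F}
    (hq : ∀ n f, q' n f = if n ∈ net.dst f then 0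
      else q n f + ∑ m ∈ net.nbrs n, r m n f - ∑ m ∈ net.nbrs n, r n m f + a n f)
    (hd : ∀ f, ∀ n ∈ net.dst f, q n f = 0) :
    lyap q' ≤ lyap q + 2 * dot q a - 2 * flowGain q r + net.driftConst + 2 * lyap a := by
  have e : net.driftConst = ∑ _n : N, ∑ _f : F, 2 * (Fintype.card N * net.rateMax) ^ 2 := by
    simp [driftConst]; ring
  have e2 : -(2 * flowGain q r) = 2 * dot q (net.netInflow r) := by
    rw [h.dot_netInflow hp]; ring
  have : lyap q + 2 * dot q a - 2 * flowGain q r + net.driftConst + 2 * lyap a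
      = ∑ n, ∑ f, (q n f ^ 2 + 2 * (q n f * a n f) + 2 * (q n f * net.netInflow r n f)
        + 2 * (Fintype.card N * net.rateMax) ^ 2 + 2 * a n f ^ 2) := by
    rw [sub_eq_add_neg, e2, e]
    simp only [lyap, dot, Finset.mul_sum, Finset.sum_add_distrib]
  rw [this]
  refine Finset.sum_le_sum fun n _ => Finset.sum_le_sum fun f _ => ?_
  have hb := sq_le_sq' (abs_le.1 (h.abs_netInflow_le hp n f)).1
    (abs_le.1 (h.abs_netInflow_le hp n f)).2
  rw [hq]
  split_ifs with hn
  · rw [hd f n hn]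
    nlinarith [sq_nonneg (net.netInflow r n f), sq_nonneg (a n f)]
  · have : q n f + ∑ m ∈ net.nbrs n, r m n f - ∑ m ∈ net.nbrs n, r n m f + a n f
        = q n f + net.netInflow r n f + a n f := by rw [netInflow]; ring
    rw [this]
    nlinarith [sq_nonneg (net.netInflow r n f - a n f)]

end Flows

/-! ### Back pressure attains the maximum weight up to a constant -/

section MBP

variable {N F : Type*} [Fintype N] [DecidableEq N] [Fintype F] [DecidableEq F]
  {net : Network N F} {s : N → Bool} {p : Alloc N} {q : QVec N F} {fs : N → N → F}

omit [Fintype F] in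
theorem mbpRate_of_ne {n m : N} {f : F} (h : f ≠ fs n m) : net.mbpRate q fs p n m f = 0 :=
  if_neg fun h' => h h'.1

omit [Fintype F] in
theorem share_nonneg (hp : p ∈ net.allocations s) (n m : N) : 0 ≤ net.share fs p n m :=
  div_nonneg (net.linkRate_nonneg hp n m)
    (Finset.sum_nonneg fun m' _ => net.linkRate_nonneg hp n m')

omit [Fintype F] in
theorem mbpRate_nonneg (hp : p ∈ net.allocations s) (hq : 0 ≤ q) (n m : N) (f : F) :
    0 ≤ net.mbpRate q fs p n m f := by
  unfold mbpRate
  split_ifs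
  · exact le_min (net.linkRate_nonneg hp n m) (mul_nonneg (hq n f) (share_nonneg hp n m))
  · exact le_rfl

omit [Fintype F] in
theorem sum_share_le_one (n : N) (f : F) :
    ∑ m ∈ Finset.univ.filter (fun m => fs n m = f), net.share fs p n m ≤ 1 := by
  have : ∀ m ∈ Finset.univ.filter (fun m => fs n m = f), net.share fs p n m
      = net.linkRate p n m / ∑ m' ∈ Finset.univ.filter (fun m' => fs n m' = f),
        net.linkRate p n m' := by
    intro m hm
    rw [share, (Finset.mem_filter.1 hm).2]
  rw [Finset.sum_congr rfl this, ← Finset.sum_div]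
  exact div_self_le_one _

/-- The queue constraint holds because the shares of the links that leave `n` with the same flow add
up to at most one. -/
theorem admissible_mbpRate (hp : p ∈ net.allocations s) (hq : 0 ≤ q) :
    net.Admissible p q (net.mbpRate q fs p) where
  nonneg := mbpRate_nonneg hp hq
  le_link n m := by
    rw [Finset.sum_eq_single (fs n m) (fun f _ hf => mbpRate_of_ne hf) (by simp)]
    unfold mbpRate
    split_ifs
    · exact min_le_left _ _
    · exact net.linkRate_nonneg hp n m
  le_queue n f := by
    calc ∑ m ∈ net.nbrs n, net.mbpRate q fs p n m f ≤ ∑ m, net.mbpRate q fs p n m f :=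
          Finset.sum_le_sum_of_subset_of_nonneg (Finset.subset_univ _)
            fun m _ _ => mbpRate_nonneg hp hq n m f
      _ = ∑ m ∈ Finset.univ.filter (fun m => fs n m = f), net.mbpRate q fs p n m f := by
          refine (Finset.sum_filter_of_ne fun m _ hm => ?_).symm
          by_contra h
          exact hm (mbpRate_of_ne fun h' => h h'.symm)
      _ ≤ ∑ m ∈ Finset.univ.filter (fun m => fs n m = f), q n f * net.share fs p n m := by
          refine Finset.sum_le_sum fun m _ => ?_
          unfold mbpRate
          split_ifs
          · exact min_le_right _ _
          · exact mul_nonneg (hq n f) (share_nonneg hp n m)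
      _ ≤ q n f := by
          rw [← Finset.mul_sum]
          exact mul_le_of_le_one_right (hq n f) (sum_share_le_one n f)

omit [Fintype F] in
theorem mbpRate_mul_nonneg (hp : p ∈ net.allocations s) (hq : 0 ≤ q) (n m : N) (f : F) :
    0 ≤ net.mbpRate q fs p n m f * (q n f - q m f) := by
  by_cases h : 0 < q n f - q m f
  · exact mul_nonneg (mbpRate_nonneg hp hq n m f) h.le
  · rw [mbpRate, if_neg fun h' => h h'.2, zero_mul]

theorem mbpObjective_le_flowGain (hp : p ∈ net.allocations s) (hq : 0 ≤ q) :
    net.mbpObjective q fs p ≤ flowGain q (net.mbpRate q fs p) :=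
  Finset.sum_le_sum fun n _ => Finset.sum_le_sum fun m _ =>
    Real.iSup_le (fun f => Finset.single_le_sum
      (f := fun f => net.mbpRate q fs p n m f * (q n f - q m f))
      (fun f _ => mbpRate_mul_nonneg hp hq n m f) (Finset.mem_univ f))
      (Finset.sum_nonneg fun f _ => mbpRate_mul_nonneg hp hq n m f)

/-- The loss of back pressure that is due to short queues. -/
def mbpLoss (net : Network N F) : ℝ :=
  Fintype.card N * (Fintype.card N * (net.rateMax * (Fintype.card N * net.rateMax)))

-- The queue cap `q * share` binds only if the queue is at most the total rate `S` of the links that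
-- share it. Then the pressure is at most `q ≤ S ≤ |N| * rateMax`, so rate times pressure is bounded
-- by a constant and losing it is harmless. A link without positive pressure contributes nothing.
omit [Fintype F] in
theorem linkRate_mul_pressure_le (hp : p ∈ net.allocations s) (hq : 0 ≤ q)
    (hfs : IsTopFlow q fs) (n m : N) :
    net.linkRate p n m * pressure q n m ≤
      net.mbpRate q fs p n m (fs n m) * (q n (fs n m) - q m (fs n m))
        + net.rateMax * (Fintype.card N * net.rateMax) := by
  have hR := net.rateMax_nonneg
  have hC : 0 ≤ net.rateMax * (Fintype.card N * net.rateMax) := by positivity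
  by_cases h : 0 < q n (fs n m) - q m (fs n m)
  · have hpr : pressure q n m ≤ q n (fs n m) - q m (fs n m) := pressure_le h.le (hfs n m)
    have hr := net.linkRate_nonneg hp n m
    have h1 := mul_le_mul_of_nonneg_left hpr hr
    rw [mbpRate, if_pos ⟨rfl, h⟩]
    rcases le_total (net.linkRate p n m) (q n (fs n m) * net.share fs p n m) with h2 | h2
    · rw [min_eq_left h2]; linarith
    · rw [min_eq_right h2]
      have h0 : 0 ≤ q n (fs n m) * net.share fs p n m * (q n (fs n m) - q m (fs n m)) :=
        mul_nonneg (mul_nonneg (hq _ _) (share_nonneg hp n m)) h.le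
      set S := ∑ m' ∈ Finset.univ.filter (fun m' => fs n m' = fs n m), net.linkRate p n m' with hS
      have hSle : S ≤ Fintype.card N * net.rateMax := by
        calc S ≤ ∑ m', net.linkRate p n m' := Finset.sum_le_sum_of_subset_of_nonneg
              (Finset.subset_univ _) fun m' _ _ => net.linkRate_nonneg hp n m'
          _ ≤ _ := by
            simpa using Finset.sum_le_card_nsmul Finset.univ (fun m' => net.linkRate p n m')
              net.rateMax fun m' _ => net.linkRate_le_rateMax hp n m'
      have hrS : net.linkRate p n m ≤ S :=
        Finset.single_le_sum (f := fun m' => net.linkRate p n m')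
          (fun m' _ => net.linkRate_nonneg hp n m') (by simp)
      -- The binding cap `h2` reads `q * r / S ≤ r`. It is cleared of `S`, which is positive when
      -- `r` is; for `r = 0` both sides vanish.
      have h3 : net.linkRate p n m * q n (fs n m) ≤ net.linkRate p n m * S := by
        rcases hr.eq_or_lt with h4 | h4
        · rw [← h4]; simp
        · have hSpos : 0 < S := h4.trans_le hrS
          rw [share, ← hS, ← mul_div_assoc, div_le_iff₀ hSpos] at h2
          linarith
      have h4 : net.linkRate p n m * S ≤ net.rateMax * (Fintype.card N * net.rateMax) :=
        mul_le_mul (net.linkRate_le_rateMax hp n m) hSle (hr.trans hrS) hR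
      have h5 : net.linkRate p n m * (q n (fs n m) - q m (fs n m))
          ≤ net.linkRate p n m * q n (fs n m) :=
        mul_le_mul_of_nonneg_left (by linarith [show 0 ≤ q m (fs n m) from hq _ _]) hr
      linarith
  · have hpr : pressure q n m = 0 :=
      le_antisymm (pressure_le le_rfl fun f => (hfs n m f).trans (not_lt.1 h))
        (pressure_nonneg q n m)
    rw [hpr, mbpRate, if_neg fun h' => h h'.2]
    linarith

theorem weight_le_mbpObjective (hp : p ∈ net.allocations s) (hq : 0 ≤ q)
    (hfs : IsTopFlow q fs) : net.weight q p ≤ net.mbpObjective q fs p + net.mbpLoss := by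
  have e : net.mbpLoss = ∑ _n : N, ∑ _m : N, net.rateMax * (Fintype.card N * net.rateMax) := by
    simp [mbpLoss]
  rw [e, mbpObjective, ← Finset.sum_add_distrib]
  refine Finset.sum_le_sum fun n _ => ?_
  rw [← Finset.sum_add_distrib]
  refine Finset.sum_le_sum fun m _ => (linkRate_mul_pressure_le hp hq hfs n m).trans ?_
  gcongr
  exact le_ciSup (f := fun f => net.mbpRate q fs p n m f * (q n f - q m f))
    (Set.finite_range _).bddAbove (fs n m)

variable {Pc : (N → Bool) → Set (Alloc N)} (hPc : ∀ s, Pc s ⊆ net.allocations s)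
include hPc

/-- The chosen allocation maximizes the metric with queue caps, while `maxWeight` is defined without
them; the two differ by at most `mbpLoss` for every competitor. -/
theorem IsMBPChoice.maxWeight_le (h : net.IsMBPChoice Pc q fs s p) (hq : 0 ≤ q) :
    net.maxWeight Pc q ≤ flowGain q (net.mbpRate q fs p) + net.mbpLoss := by
  have hR := net.rateMax_nonneg
  have hg := mbpObjective_le_flowGain (fs := fs) (hPc s h.2.1) hq
  have h0 : 0 ≤ flowGain q (net.mbpRate q fs p) :=
    Finset.sum_nonneg fun n _ => Finset.sum_nonneg fun m _ => Finset.sum_nonneg fun f _ =>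
      mbpRate_mul_nonneg (hPc s h.2.1) hq n m f
  refine Network.maxWeight_le (add_nonneg h0 (by unfold mbpLoss; positivity)) fun s' p' hp' => ?_
  have h1 := weight_le_mbpObjective (hPc s' hp') hq h.1
  have h2 := h.2.2 s' p' hp'
  linarith

/-- Approximate back pressure: allowed rates whose gain is within a constant of the maximum
weight. -/
theorem exists_admissible_maxWeight_le (hne : ∃ s, (Pc s).Nonempty) (hq : 0 ≤ q) :
    ∃ s, ∃ p ∈ Pc s, ∃ r, net.Admissible p q r ∧
      net.maxWeight Pc q ≤ flowGain q r + (net.mbpLoss + 1) := by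
  -- The supremum over arbitrary `Pc` need not be attained. A maximizer up to `1` suffices and
  -- accounts for the `+ 1` in the constant.
  have hp : ∃ s, ∃ p ∈ Pc s, net.maxWeight Pc q - 1 < net.weight q p := by
    obtain ⟨s, p, hp⟩ := hne
    have : Nonempty (⋃ s, Pc s : Set (Alloc N)) := ⟨⟨p, Set.mem_iUnion.2 ⟨s, hp⟩⟩⟩
    obtain ⟨⟨p', hp'⟩, h⟩ := exists_lt_of_lt_ciSup
      (show net.maxWeight Pc q - 1 < ⨆ p : (⋃ s, Pc s : Set (Alloc N)), net.weight q p from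
        sub_one_lt _)
    obtain ⟨s', hs'⟩ := Set.mem_iUnion.1 hp'
    exact ⟨s', p', hs', h⟩
  obtain ⟨s, p, hp, h⟩ := hp
  refine ⟨s, p, hp, ?_⟩
  rcases isEmpty_or_nonempty F with hF | hF
  -- Without flows there is no top flow to choose, but all pressures are then `0`.
  · refine ⟨fun _ _ _ => 0, ⟨fun _ _ f => isEmptyElim f, fun n m => ?_, fun _ f => isEmptyElim f⟩,
      ?_⟩
    · simpa using net.linkRate_nonneg (hPc s hp) n m
    · have hR := net.rateMax_nonneg
      have h0 : net.weight q p = 0 := by simp [weight, pressure]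
      have : 0 ≤ net.mbpLoss := by unfold mbpLoss; positivity
      simp only [flowGain, zero_mul, Finset.sum_const_zero]
      linarith
  · have htop : ∀ n m, ∃ f, ∀ f', q n f' - q m f' ≤ q n f - q m f := fun n m =>
      Finite.exists_max fun f => q n f - q m f
    choose fs hfs using htop
    refine ⟨net.mbpRate q fs p, admissible_mbpRate (hPc s hp) hq, ?_⟩
    have h1 := weight_le_mbpObjective (fs := fs) (hPc s hp) hq hfs
    have h2 := mbpObjective_le_flowGain (fs := fs) (hPc s hp) hq
    linarith

end MBP

end Network


/-! ### Integrability from fourth moments -/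

section FourthMoments

variable {Ω : Type*} {m0 : MeasurableSpace Ω} {μ : Measure Ω}

theorem memLp_four_of_integrable_pow {f : Ω → ℝ} (hf : AEStronglyMeasurable f μ)
    (h : Integrable (fun ω => f ω ^ 4) μ) : MemLp f 4 μ := by
  rw [← integrable_norm_rpow_iff hf (by norm_num) (by norm_num)]
  refine h.congr (Eventually.of_forall fun ω => ?_)
  have : (4 : ENNReal).toReal = ((4 : ℕ) : ℝ) := by norm_num
  simp only [this, Real.rpow_natCast, Real.norm_eq_abs]
  exact ((by decide : Even 4).pow_abs _).symm

theorem MemLp.mul_of_four {f g : Ω → ℝ} (hf : MemLp f 4 μ) (hg : MemLp g 4 μ) :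
    MemLp (fun ω => f ω * g ω) 2 μ := by
  have : ENNReal.HolderTriple 4 4 2 := ⟨by
    rw [← two_mul, show (4 : ENNReal) = 2 * 2 by norm_num,
      ENNReal.mul_inv (by norm_num) (by norm_num), ← mul_assoc,
      ENNReal.mul_inv_cancel (by norm_num) (by norm_num), one_mul]⟩
  exact hg.mul hf

theorem MemLp.sq_of_four {f : Ω → ℝ} (hf : MemLp f 4 μ) : MemLp (fun ω => f ω ^ 2) 2 μ := by
  simpa only [sq] using MemLp.mul_of_four hf hf

end FourthMoments

namespace Network.Run
open Network

variable {N F : Type*} [Fintype N] [DecidableEq N] [Fintype F] {net : Network N F}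
  {Pc : (N → Bool) → Set (Alloc N)} {Ω : Type*} [MeasurableSpace Ω] {μ : Measure Ω}

/-! ### Pathwise flow conservation and drift -/

section Paths

variable (R : net.Run Pc μ)

theorem admissible (t : ℕ) (ω : Ω) : net.Admissible (R.p t ω) (R.q t ω) (R.rate t ω) :=
  ⟨R.rate_nonneg t ω, R.rate_le_link t ω, R.rate_le_queue t ω⟩

theorem q_nonneg (t : ℕ) (ω : Ω) : 0 ≤ R.q t ω := (R.admissible t ω).queue_nonneg

theorem q_dst (t : ℕ) (ω : Ω) (f : F) (n : N) (hn : n ∈ net.dst f) : R.q t ω n f = 0 := by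
  cases t with
  | zero => rw [R.q_zero]; exact R.q₀_dst f n hn
  | succ t => rw [R.q_succ, if_pos hn]

include R in
theorem allowed_nonempty [Nonempty Ω] : ∃ s, (Pc s).Nonempty :=
  ⟨R.s 0 (Classical.arbitrary Ω), _, R.p_mem 0 (Classical.arbitrary Ω)⟩

theorem avgRate_eq (T : ℕ) (ω : Ω) :
    R.avgRate T ω = (T : ℝ)⁻¹ • ∑ t ∈ Finset.range T, R.lam t ω := by
  ext n f
  simp [avgRate, div_eq_inv_mul, Finset.sum_apply]

theorem avgQueue_eq (T : ℕ) (ω : Ω) :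
    R.avgQueue T ω = (T : ℝ)⁻¹ • ∑ t ∈ Finset.range T, R.q t ω := by
  ext n f
  simp [avgQueue, div_eq_inv_mul, Finset.sum_apply]

theorem total_avgQueue (T : ℕ) (ω : Ω) :
    ∑ n, ∑ f, R.avgQueue T ω n f = (∑ t ∈ Finset.range T, total (R.q t ω)) / T := by
  have h1 : ∀ q : QVec N F, total q = dot q (fun _ _ => 1) := fun q => by simp [dot, total]
  change total (R.avgQueue T ω) = _
  simp_rw [h1]
  rw [avgQueue_eq, dot_smul_left, dot_sum_left, div_eq_inv_mul]

variable (hPc : ∀ s, Pc s ⊆ net.allocations s)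
include hPc

/-- The flow conservation law, tested against a weight vector. -/
theorem dot_sum_lam_le {w : QVec N F} (hw : 0 ≤ w) (hd : ∀ f, ∀ n ∈ net.dst f, w n f = 0)
    (T : ℕ) (ω : Ω) :
    dot w (∑ t ∈ Finset.range T, R.lam t ω) ≤ T * net.maxWeight Pc w + dot w (R.q T ω)
      + dot w (∑ t ∈ Finset.range T, (R.lam t ω - R.a t ω)) := by
  -- Transport lowers the weighted backlog by at most `maxWeight Pc w` per frame. Emptying the
  -- destinations goes unnoticed because `w` vanishes there.
  have step : ∀ t, dot w (R.q t ω) + dot w (R.a t ω) - net.maxWeight Pc w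
      ≤ dot w (R.q (t + 1) ω) := by
    intro t
    have h1 : dot w (R.q (t + 1) ω)
        = dot w (R.q t ω + net.netInflow (R.rate t ω) + R.a t ω) := by
      refine Finset.sum_congr rfl fun n _ => Finset.sum_congr rfl fun f _ => ?_
      by_cases hn : n ∈ net.dst f
      · simp [hd f n hn]
      · rw [R.q_succ, if_neg hn]
        simp only [Pi.add_apply, netInflow]
        ring
    rw [h1, dot_add_right, dot_add_right,
      (R.admissible t ω).dot_netInflow (hPc _ (R.p_mem t ω))]
    have h2 := ((R.admissible t ω).flowGain_le_weight w).trans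
      (weight_le_maxWeight hPc (R.p_mem t ω) w)
    linarith
  have h : ∀ T : ℕ, ∑ t ∈ Finset.range T, dot w (R.a t ω) ≤
      T * net.maxWeight Pc w + dot w (R.q T ω) := by
    intro T
    induction T with
    | zero =>
      have : 0 ≤ dot w (R.q 0 ω) := Finset.sum_nonneg fun n _ => Finset.sum_nonneg fun f _ =>
        mul_nonneg (hw n f) (R.q_nonneg 0 ω n f)
      simpa using this
    | succ T ih =>
      rw [Finset.sum_range_succ]
      push_cast
      linarith [step T]
  rw [Finset.sum_sub_distrib, dot_sub_right]
  have := h T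
  rw [← dot_sum_right] at this
  linarith

/-- The drift of the quadratic Lyapunov function, when the flow rates are within a constant of the
maximum weight. -/
theorem lyap_succ_le {c₀ : ℝ} {t : ℕ} {ω : Ω}
    (h : net.maxWeight Pc (R.q t ω) ≤ flowGain (R.q t ω) (R.rate t ω) + c₀) :
    lyap (R.q (t + 1) ω) ≤ lyap (R.q t ω)
      - 2 * (net.maxWeight Pc (R.q t ω) - dot (R.q t ω) (R.lam t ω))
      + 2 * dot (R.q t ω) (R.a t ω - R.lam t ω) + (2 * c₀ + net.driftConst)
      + 2 * lyap (R.a t ω) := by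
  have h1 := (R.admissible t ω).lyap_le (hPc _ (R.p_mem t ω)) (R.q_succ t ω)
    (fun f n hn => R.q_dst t ω f n hn)
  rw [dot_sub_right]
  linarith

end Paths

/-! ### Moments and laws of large numbers for the arrivals -/

section Moments

variable (R : net.Run Pc μ)

theorem measurable_a_entry (t : ℕ) (n : N) (f : F) :
    StronglyMeasurable[R.ℱ (t + 1)] fun ω => R.a t ω n f :=
  ((measurable_pi_apply f).comp ((measurable_pi_apply n).comp (R.measurable_a t))).stronglyMeasurable

theorem measurable_lam_entry (t : ℕ) (n : N) (f : F) :
    StronglyMeasurable[R.ℱ t] fun ω => R.lam t ω n f :=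
  ((measurable_pi_apply f).comp ((measurable_pi_apply n).comp (R.measurable_lam t))).stronglyMeasurable

theorem measurable_rate_entry (t : ℕ) (n m : N) (f : F) :
    StronglyMeasurable[R.ℱ t] fun ω => R.rate t ω n m f :=
  ((measurable_pi_apply f).comp ((measurable_pi_apply m).comp
    ((measurable_pi_apply n).comp (R.measurable_rate t)))).stronglyMeasurable

theorem measurable_q_entry (t : ℕ) (n : N) (f : F) :
    StronglyMeasurable[R.ℱ t] fun ω => R.q t ω n f := by
  induction t generalizing n f with
  | zero => simp only [R.q_zero]; exact stronglyMeasurable_const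
  | succ t ih =>
    have hle := R.ℱ.mono t.le_succ
    simp only [R.q_succ]
    by_cases hn : n ∈ net.dst f
    · simp only [hn, if_true]; exact stronglyMeasurable_const
    · simp only [hn, if_false]
      refine ((((ih n f).mono hle).add ?_).sub ?_).add (R.measurable_a_entry t n f)
      · exact Finset.stronglyMeasurable_fun_sum _ fun m _ =>
          (R.measurable_rate_entry t m n f).mono hle
      · exact Finset.stronglyMeasurable_fun_sum _ fun m _ =>
          (R.measurable_rate_entry t n m f).mono hle

theorem measurable_lyap_q (t : ℕ) : StronglyMeasurable[R.ℱ t] fun ω => lyap (R.q t ω) :=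
  Finset.stronglyMeasurable_fun_sum _ fun n _ => Finset.stronglyMeasurable_fun_sum _ fun f _ =>
    (R.measurable_q_entry t n f).pow 2

variable [IsProbabilityMeasure μ] {K : ℝ} (hK : R.MomentBound K)
include hK

omit [IsProbabilityMeasure μ] in
theorem memLp_a (t : ℕ) (n : N) (f : F) : MemLp (fun ω => R.a t ω n f) 4 μ :=
  memLp_four_of_integrable_pow
    ((R.measurable_a_entry t n f).mono (R.ℱ.le _)).aestronglyMeasurable (hK t n f).1

theorem integrable_a_sq (t : ℕ) (n : N) (f : F) : Integrable (fun ω => R.a t ω n f ^ 2) μ :=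
  (MemLp.sq_of_four (R.memLp_a hK t n f)).integrable (by norm_num)

/-- From `a² ≤ 1 + a⁴` under the conditional expectation. -/
theorem condExp_a_sq_le (t : ℕ) (n : N) (f : F) :
    μ[fun ω => R.a t ω n f ^ 2 | R.ℱ t] ≤ᵐ[μ] fun _ => 1 + K := by
  have h1 : μ[fun ω => R.a t ω n f ^ 2 | R.ℱ t]
      ≤ᵐ[μ] μ[(fun _ => (1 : ℝ)) + fun ω => R.a t ω n f ^ 4 | R.ℱ t] := by
    refine condExp_mono (R.integrable_a_sq hK t n f)
      ((integrable_const _).add (hK t n f).1) (Eventually.of_forall fun ω => ?_)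
    simp only [Pi.add_apply]
    nlinarith [sq_nonneg (R.a t ω n f ^ 2 - 1), sq_nonneg (R.a t ω n f ^ 2)]
  have h2 := condExp_add (integrable_const (1 : ℝ)) (hK t n f).1 (R.ℱ t) (μ := μ)
  filter_upwards [h1, h2, (hK t n f).2] with ω h1 h2 h3
  rw [h2, Pi.add_apply, condExp_const (R.ℱ.le t)] at h1
  linarith

/-- Since `lam` is the conditional mean of `a`, the bounds follow from `0 ≤ a ≤ 1 + a⁴`. -/
theorem condExp_a_le (t : ℕ) (n : N) (f : F) :
    ∀ᵐ ω ∂μ, 0 ≤ R.lam t ω n f ∧ R.lam t ω n f ≤ 1 + K := by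
  have h0 : (0 : Ω → ℝ) ≤ᵐ[μ] μ[fun ω => R.a t ω n f | R.ℱ t] :=
    condExp_nonneg (Eventually.of_forall fun ω => R.a_nonneg t ω n f)
  have h1 : μ[fun ω => R.a t ω n f | R.ℱ t]
      ≤ᵐ[μ] μ[(fun _ => (1 : ℝ)) + fun ω => R.a t ω n f ^ 4 | R.ℱ t] := by
    refine condExp_mono (R.integrable_a t n f)
      ((integrable_const _).add (hK t n f).1) (Eventually.of_forall fun ω => ?_)
    simp only [Pi.add_apply]
    nlinarith [sq_nonneg (R.a t ω n f ^ 2 - 1), sq_nonneg (R.a t ω n f - 1),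
      sq_nonneg (R.a t ω n f ^ 2)]
  have h2 := condExp_add (integrable_const (1 : ℝ)) (hK t n f).1 (R.ℱ t) (μ := μ)
  filter_upwards [h0, h1, h2, (hK t n f).2, R.condExp_a t n f] with ω h0 h1 h2 h3 h4
  rw [h2, Pi.add_apply, condExp_const (R.ℱ.le t)] at h1
  rw [h4] at h0 h1
  exact ⟨h0, by linarith⟩

theorem memLp_lam (t : ℕ) (n : N) (f : F) : MemLp (fun ω => R.lam t ω n f) 4 μ := by
  refine MemLp.of_bound
    ((R.measurable_lam_entry t n f).mono (R.ℱ.le _)).aestronglyMeasurable (1 + K) ?_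
  filter_upwards [R.condExp_a_le hK t n f] with ω h
  rw [Real.norm_of_nonneg h.1]
  exact h.2

theorem memLp_noise (t : ℕ) (n : N) (f : F) :
    MemLp (fun ω => R.a t ω n f - R.lam t ω n f) 4 μ :=
  (R.memLp_a hK t n f).sub (R.memLp_lam hK t n f)

theorem condExp_noise (t : ℕ) (n : N) (f : F) :
    μ[fun ω => R.a t ω n f - R.lam t ω n f | R.ℱ t] =ᵐ[μ] 0 := by
  have hl : Integrable (fun ω => R.lam t ω n f) μ := (R.memLp_lam hK t n f).integrable (by norm_num)
  have h1 := condExp_sub (R.integrable_a t n f) hl (R.ℱ t)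
  have h2 := condExp_of_stronglyMeasurable (R.ℱ.le t) (R.measurable_lam_entry t n f) hl
  filter_upwards [h1, R.condExp_a t n f] with ω h1 h3
  rw [h2] at h1
  have : μ[fun ω => R.a t ω n f - R.lam t ω n f | R.ℱ t] ω = _ := h1
  rw [this, Pi.sub_apply, h3, sub_self]
  rfl

/-- The noise, multiplied by a factor with a controlled second moment, averages out. -/
theorem integral_mul_noise_sq_le {t : ℕ} {Z : Ω → ℝ} (n : N) (f : F)
    (hZ : StronglyMeasurable[R.ℱ t] Z) (hZ4 : MemLp Z 4 μ) :
    ∫ ω, (Z ω * (R.a t ω n f - R.lam t ω n f)) ^ 2 ∂μ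
      ≤ ((1 + K) + (1 + K) ^ 2) * ∫ ω, Z ω ^ 2 ∂μ := by
  have hZ2 := MemLp.sq_of_four hZ4
  have ha2 := MemLp.sq_of_four (R.memLp_a hK t n f)
  have hZi : Integrable (fun ω => Z ω ^ 2) μ := hZ2.integrable (by norm_num)
  have hZa : Integrable (fun ω => Z ω ^ 2 * R.a t ω n f ^ 2) μ := hZ2.integrable_mul ha2
  have h1 : ∫ ω, Z ω ^ 2 * R.a t ω n f ^ 2 ∂μ ≤ (1 + K) * ∫ ω, Z ω ^ 2 ∂μ :=
    integral_mul_le_of_condExp_le (R.ℱ.le t) (hZ.pow 2) hZa (R.integrable_a_sq hK t n f) hZi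
      (fun ω => sq_nonneg _) (R.condExp_a_sq_le hK t n f)
  have h2 : ∫ ω, (Z ω * (R.a t ω n f - R.lam t ω n f)) ^ 2 ∂μ
      ≤ ∫ ω, (Z ω ^ 2 * R.a t ω n f ^ 2 + (1 + K) ^ 2 * Z ω ^ 2) ∂μ := by
    refine integral_mono_ae (MemLp.mul_of_four hZ4 (R.memLp_noise hK t n f)).integrable_sq
      (hZa.add (hZi.const_mul _)) ?_
    filter_upwards [R.condExp_a_le hK t n f] with ω h
    have ha := R.a_nonneg t ω n f
    simp only [Pi.zero_apply] at ha
    -- The cross term `-2 * a * lam` is nonpositive, so it can be dropped.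
    have h3 : (R.a t ω n f - R.lam t ω n f) ^ 2 ≤ R.a t ω n f ^ 2 + (1 + K) ^ 2 := by
      nlinarith [mul_nonneg ha h.1, h.1, h.2]
    nlinarith [mul_le_mul_of_nonneg_left h3 (sq_nonneg (Z ω))]
  rw [integral_add hZa (hZi.const_mul _), integral_const_mul] at h2
  linarith

/-- A factor known before the arrivals keeps the noise a martingale difference, whose second moment
is at most a constant times that of `Z t`. Used with `Z = 1` and with `Z` a queue length. -/
theorem ae_tendsto_average_mul_noise {Z : ℕ → Ω → ℝ} (n : N) (f : F)
    (hZ : ∀ t, StronglyMeasurable[R.ℱ t] (Z t)) (hZ4 : ∀ t, MemLp (Z t) 4 μ) {B : ℝ}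
    (hB : ∀ T, ∑ t ∈ Finset.range T, (∫ ω, Z t ω ^ 2 ∂μ) / ((t : ℝ) + 1) ^ 2 ≤ B) (hK0 : 0 ≤ K) :
    ∀ᵐ ω ∂μ, Tendsto (fun T : ℕ =>
      (∑ t ∈ Finset.range T, Z t ω * (R.a t ω n f - R.lam t ω n f)) / T) atTop (𝓝 0) := by
  refine ae_tendsto_average_of_martingale_difference (ℱ := R.ℱ)
    (d := fun t ω => Z t ω * (R.a t ω n f - R.lam t ω n f))
    (B := ((1 + K) + (1 + K) ^ 2) * B) (fun t => ?_)
    (fun t => MemLp.mul_of_four (hZ4 t) (R.memLp_noise hK t n f)) (fun t => ?_) fun T => ?_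
  · have hle := R.ℱ.mono t.le_succ
    exact ((hZ t).mono hle).mul ((R.measurable_a_entry t n f).sub
      ((R.measurable_lam_entry t n f).mono hle))
  · have hi : Integrable (Z t * fun ω => R.a t ω n f - R.lam t ω n f) μ :=
      (MemLp.mul_of_four (hZ4 t) (R.memLp_noise hK t n f)).integrable (by norm_num)
    refine (condExp_mul_of_stronglyMeasurable_left (hZ t) hi
      ((R.memLp_noise hK t n f).integrable (by norm_num))).trans ?_
    filter_upwards [R.condExp_noise hK t n f] with ω h
    simp [h]
  · refine le_trans ?_ (mul_le_mul_of_nonneg_left (hB T) (by positivity))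
    rw [Finset.mul_sum]
    refine Finset.sum_le_sum fun t _ => ?_
    rw [← mul_div_assoc]
    exact div_le_div_of_nonneg_right (R.integral_mul_noise_sq_le hK n f (hZ t) (hZ4 t))
      (by positivity)

theorem ae_tendsto_average_noise (hK0 : 0 ≤ K) :
    ∀ᵐ ω ∂μ, ∀ n f, Tendsto (fun T : ℕ =>
      (∑ t ∈ Finset.range T, (R.a t ω n f - R.lam t ω n f)) / T) atTop (𝓝 0) := by
  rw [ae_all_iff]; intro n
  rw [ae_all_iff]; intro f
  have h := R.ae_tendsto_average_mul_noise hK (Z := fun _ _ => 1) n f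
    (fun _ => stronglyMeasurable_const) (fun _ => memLp_const 1)
    (fun T => sum_div_sq_le (k := 1) zero_le_one (fun _ => by simp) T) hK0
  simpa using h

/-- The squares are centred at their conditional means `v t ≤ 1 + K`. The strong law for the
differences needs their second moments, hence the fourth moments of the arrivals. -/
theorem ae_eventually_sum_a_sq_le (hK0 : 0 ≤ K) :
    ∀ᵐ ω ∂μ, ∀ n f, ∀ ε > 0, ∀ᶠ T : ℕ in atTop,
      ∑ t ∈ Finset.range T, R.a t ω n f ^ 2 ≤ T * (1 + K + ε) := by
  rw [ae_all_iff]; intro n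
  rw [ae_all_iff]; intro f
  set v : ℕ → Ω → ℝ := fun t => μ[fun ω => R.a t ω n f ^ 2 | R.ℱ t] with hv
  have hvle : ∀ t, ∀ᵐ ω ∂μ, 0 ≤ v t ω ∧ v t ω ≤ 1 + K := by
    intro t
    have h0 : (0 : Ω → ℝ) ≤ᵐ[μ] v t := condExp_nonneg (Eventually.of_forall fun ω => sq_nonneg _)
    filter_upwards [h0, R.condExp_a_sq_le hK t n f] with ω h0 h1
    exact ⟨h0, h1⟩
  have hvm : ∀ t, StronglyMeasurable[R.ℱ t] (v t) := fun t => stronglyMeasurable_condExp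
  have hv2 : ∀ t, MemLp (v t) 2 μ := by
    intro t
    refine MemLp.of_bound ((hvm t).mono (R.ℱ.le _)).aestronglyMeasurable (1 + K) ?_
    filter_upwards [hvle t] with ω h
    rw [Real.norm_of_nonneg h.1]
    exact h.2
  have ha2 := fun t => MemLp.sq_of_four (R.memLp_a hK t n f)
  have key := ae_tendsto_average_of_martingale_difference (ℱ := R.ℱ)
    (d := fun t ω => R.a t ω n f ^ 2 - v t ω) (μ := μ)
    (fun t => ((R.measurable_a_entry t n f).pow 2).sub ((hvm t).mono (R.ℱ.mono t.le_succ)))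
    (fun t => (ha2 t).sub (hv2 t)) (fun t => ?_)
    -- The constant bounds `E (a² - v)² ≤ E a⁴ + (1 + K)²`; the mixed term has the favourable sign.
    (fun T => sum_div_sq_le (k := K + (1 + K) ^ 2) (by positivity) (fun t => ?_) T)
  · filter_upwards [key, ae_all_iff.2 hvle] with ω hω hvω ε hε
    have := hω.eventually (gt_mem_nhds hε)
    filter_upwards [this, eventually_gt_atTop 0] with T hT hT0
    have hT0' : (0 : ℝ) < T := by exact_mod_cast hT0
    rw [div_lt_iff₀ hT0', Finset.sum_sub_distrib] at hT
    have h3 : ∑ t ∈ Finset.range T, v t ω ≤ T * (1 + K) := by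
      simpa [mul_add] using Finset.sum_le_card_nsmul (Finset.range T) (fun t => v t ω) (1 + K)
        fun t _ => (hvω t).2
    linarith
  · have hi := (hv2 t).integrable (by norm_num)
    have h1 := condExp_sub (R.integrable_a_sq hK t n f) hi (R.ℱ t)
    have h2 := condExp_of_stronglyMeasurable (R.ℱ.le t) (hvm t) hi
    refine EventuallyEq.trans h1 ?_
    rw [h2, hv, sub_self]
  · have i4 : Integrable (fun ω => (R.a t ω n f ^ 2) ^ 2) μ := (ha2 t).integrable_sq
    have h4 : ∫ ω, (R.a t ω n f ^ 2) ^ 2 ∂μ ≤ K := by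
      have h5 := integral_mono_ae integrable_condExp (integrable_const K) (hK t n f).2
      rw [integral_condExp (R.ℱ.le t)] at h5
      simp only [integral_const, probReal_univ, smul_eq_mul, one_mul] at h5
      simpa only [← pow_mul] using h5
    have h6 : ∫ ω, (R.a t ω n f ^ 2 - v t ω) ^ 2 ∂μ
        ≤ ∫ ω, ((R.a t ω n f ^ 2) ^ 2 + (1 + K) ^ 2) ∂μ := by
      refine integral_mono_ae ((ha2 t).sub (hv2 t)).integrable_sq
        (i4.add (integrable_const _)) ?_
      filter_upwards [hvle t] with ω h
      nlinarith [mul_nonneg (sq_nonneg (R.a t ω n f)) h.1, h.1, h.2]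
    rw [integral_add i4 (integrable_const _)] at h6
    simp only [integral_const, probReal_univ, smul_eq_mul, one_mul] at h6
    linarith

end Moments

end Network.Run


namespace Network

/-! ### Cauchy–Schwarz bounds for queue vectors -/

section Vectors

variable {N F : Type*} [Fintype N] [Fintype F]

theorem continuous_dot (w : QVec N F) : Continuous fun x => dot w x := by
  unfold dot; fun_prop

theorem dot_le_mul_total {w x : QVec N F} (hw : 0 ≤ w) {c : ℝ} (h : ∀ n f, x n f ≤ c) :
    dot w x ≤ c * total w := by
  rw [← dot_const]
  exact dot_mono_right hw h

theorem sq_dot_le (w x : QVec N F) : dot w x ^ 2 ≤ lyap w * lyap x := by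
  have h := Finset.sum_mul_sq_le_sq_mul_sq (Finset.univ : Finset (N × F))
    (fun i => w i.1 i.2) (fun i => x i.1 i.2)
  simp only [Fintype.sum_prod_type] at h
  exact h

theorem sq_total_le (w : QVec N F) :
    total w ^ 2 ≤ Fintype.card N * Fintype.card F * lyap w := by
  have h := sq_dot_le w (fun _ _ => 1)
  have h1 : dot w (fun _ _ => (1 : ℝ)) = total w := by simp [dot, total]
  have h2 : lyap (fun (_ : N) (_ : F) => (1 : ℝ)) = Fintype.card N * Fintype.card F := by
    simp [lyap]
  rw [h1, h2] at h
  linarith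

theorem lyap_sub_le {w x : QVec N F} (hw : 0 ≤ w) (hx : 0 ≤ x) :
    lyap (w - x) ≤ lyap w + lyap x := by
  simp only [lyap, ← Finset.sum_add_distrib]
  refine Finset.sum_le_sum fun n _ => Finset.sum_le_sum fun f _ => ?_
  have := mul_nonneg (show 0 ≤ w n f from hw n f) (show 0 ≤ x n f from hx n f)
  simp only [Pi.sub_apply]
  nlinarith

theorem lyap_le_mul {w : QVec N F} {c : ℝ} (h : ∀ n f, w n f ^ 2 ≤ c) :
    lyap w ≤ Fintype.card N * Fintype.card F * c := by
  calc lyap w ≤ ∑ _n : N, ∑ _f : F, c :=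
        Finset.sum_le_sum fun n _ => Finset.sum_le_sum fun f _ => h n f
    _ = _ := by simp; ring

end Vectors

/-- A nonnegative sequence with bounded averages does not grow linearly. -/
theorem not_eventually_linear_le {u : ℕ → ℝ} (hu : ∀ t, 0 ≤ u t) {c B : ℝ} (hc : 0 < c)
    (h1 : ∀ᶠ T : ℕ in atTop, c * T ≤ u T)
    (h2 : ∀ᶠ T : ℕ in atTop, ∑ t ∈ Finset.range T, u t ≤ B * T) : False := by
  obtain ⟨T₁, hT₁⟩ := eventually_atTop.1 h1
  obtain ⟨T₂, hT₂⟩ := eventually_atTop.1 h2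
  obtain ⟨T₃, hT₃⟩ := exists_nat_gt (2 * B / c)
  set n := T₁ + T₂ + T₃ + 1 with hn
  -- On the window from `n` to `2n` the sum is at least `c * n²`, whereas bounded averages allow
  -- only `2 * B * n`. This fails once `n > 2 * B / c`.
  have ha : (n : ℝ) * (c * n) ≤ ∑ t ∈ Finset.Ico n (2 * n), u t := by
    have := Finset.card_nsmul_le_sum (Finset.Ico n (2 * n)) u (c * n) fun t ht => by
      rw [Finset.mem_Ico] at ht
      refine le_trans ?_ (hT₁ t (by omega))
      have : (n : ℝ) ≤ t := by exact_mod_cast ht.1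
      exact mul_le_mul_of_nonneg_left this hc.le
    rw [Nat.card_Ico, show 2 * n - n = n by omega, nsmul_eq_mul] at this
    exact this
  have hb : ∑ t ∈ Finset.Ico n (2 * n), u t ≤ ∑ t ∈ Finset.range (2 * n), u t :=
    Finset.sum_le_sum_of_subset_of_nonneg
      (fun t ht => Finset.mem_range.2 (Finset.mem_Ico.1 ht).2) fun t _ _ => hu t
  have hd := hT₂ (2 * n) (by omega)
  push_cast at hd
  have hn0 : (0 : ℝ) < n := by rw [hn]; positivity
  have h3 : c * n ≤ 2 * B := by
    refine le_of_mul_le_mul_left ?_ hn0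
    linarith
  have h4 : (T₃ : ℝ) ≤ n := by exact_mod_cast (by omega : T₃ ≤ n)
  rw [div_lt_iff₀ hc] at hT₃
  nlinarith

namespace Run

variable {N F : Type*} [Fintype N] [DecidableEq N] [Fintype F] {net : Network N F}
  {Pc : (N → Bool) → Set (Alloc N)} {Ω : Type*} [MeasurableSpace Ω] {μ : Measure Ω}
  {R : net.Run Pc μ} {K : ℝ}

theorem MomentBound.mono {K' : ℝ} (h : R.MomentBound K) (hK : K ≤ K') : R.MomentBound K' :=
  fun t n f => ⟨(h t n f).1, (h t n f).2.trans (Eventually.of_forall fun _ => hK)⟩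

theorem dot_sum_noise_le {w : QVec N F} (hw : 0 ≤ w) {T : ℕ} {ω : Ω} {c : ℝ}
    (h : ∀ n f, |∑ t ∈ Finset.range T, (R.a t ω n f - R.lam t ω n f)| ≤ c) :
    dot w (∑ t ∈ Finset.range T, (R.lam t ω - R.a t ω)) ≤ c * total w := by
  refine dot_le_mul_total hw fun n f => ?_
  refine le_trans (le_of_eq ?_) ((neg_le_abs _).trans (h n f))
  rw [Finset.sum_apply, Finset.sum_apply, ← Finset.sum_neg_distrib]
  exact Finset.sum_congr rfl fun t _ => by simp

variable [IsProbabilityMeasure μ]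

theorem ae_eventually_abs_sum_noise_le (hK : R.MomentBound K) :
    ∀ᵐ ω ∂μ, ∀ ε > 0, ∀ᶠ T : ℕ in atTop, ∀ n f,
      |∑ t ∈ Finset.range T, (R.a t ω n f - R.lam t ω n f)| ≤ ε * T := by
  filter_upwards [R.ae_tendsto_average_noise (hK.mono (le_max_left K 0)) (le_max_right K 0)]
    with ω hω ε hε
  rw [eventually_all]; intro n
  rw [eventually_all]; intro f
  have h := (hω n f).abs
  rw [abs_zero] at h
  filter_upwards [h.eventually (gt_mem_nhds hε), eventually_gt_atTop 0] with T hT hT0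
  have hT0' : (0 : ℝ) < T := by exact_mod_cast hT0
  rw [abs_div, Nat.abs_cast, div_lt_iff₀ hT0'] at hT
  exact hT.le

end Run

/-! ### The maximum-weight inequalities are necessary -/

section Converse

variable {N F : Type*} [Fintype N] [DecidableEq N] [Fintype F] {net : Network N F}
  {Pc : (N → Bool) → Set (Alloc N)}

/-- Every point of the capacity region satisfies the maximum-weight inequalities. -/
theorem dot_le_maxWeight (hPc : ∀ s, Pc s ⊆ net.allocations s) {x : QVec N F}
    (hx : x ∈ net.capacityRegion Pc) {w : QVec N F} (hw : 0 ≤ w)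
    (hd : ∀ f, ∀ n ∈ net.dst f, w n f = 0) : dot w x ≤ net.maxWeight Pc w := by
  obtain ⟨Ω, _, μ, _, R, K, hK, hlim, hst⟩ := hx
  obtain ⟨ω, hω1, hω2, B, hB⟩ :=
    (hlim.and ((Run.ae_eventually_abs_sum_noise_le hK).and hst)).exists
  by_contra hlt
  rw [not_le] at hlt
  -- A positive violation `g` forces `dot w (q T) ≥ g / 2 * T` eventually: one quarter of `g` is
  -- spent on the convergence of the average rate and one quarter on the noise. Stability excludes
  -- linear growth.
  set g := dot w x - net.maxWeight Pc w with hg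
  have hg0 : 0 < g := sub_pos.2 hlt
  have htw := total_nonneg hw
  have h1 : ∀ᶠ T : ℕ in atTop, dot w x - g / 4 < dot w (R.avgRate T ω) :=
    (((continuous_dot w).tendsto x).comp hω1).eventually (lt_mem_nhds (by linarith))
  -- The `+ 1` keeps the tolerance well defined for `w = 0`.
  have h2 := hω2 (g / (4 * (total w + 1))) (by positivity)
  have hε : g / (4 * (total w + 1)) * total w ≤ g / 4 := by
    rw [div_mul_eq_mul_div, div_le_div_iff₀ (by positivity) (by norm_num)]
    nlinarith
  refine not_eventually_linear_le (u := fun t => (total w + 1) * total (R.q t ω)) (c := g / 2)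
    (B := (total w + 1) * B)
    (fun t => mul_nonneg (by positivity) (total_nonneg (R.q_nonneg t ω))) (by positivity) ?_ ?_
  · filter_upwards [h1, h2, eventually_gt_atTop 0] with T hT1 hT2 hT0
    have hT0' : (0 : ℝ) < T := by exact_mod_cast hT0
    have h3 := R.dot_sum_lam_le hPc hw hd T ω
    have h4 := Run.dot_sum_noise_le hw hT2
    rw [R.avgRate_eq, dot_smul_right, lt_inv_mul_iff₀ hT0'] at hT1
    have h5 : dot w (R.q T ω) ≤ total (R.q T ω) * total w :=
      dot_le_mul_total hw fun n f => entry_le_total (R.q_nonneg T ω) n f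
    have h6 := mul_le_mul_of_nonneg_right hε hT0'.le
    have h7 := total_nonneg (R.q_nonneg T ω)
    have h8 : (T : ℝ) * dot w x = T * g + T * net.maxWeight Pc w := by rw [hg]; ring
    nlinarith
  · filter_upwards [hB, eventually_gt_atTop 0] with T hT hT0
    have hT0' : (0 : ℝ) < T := by exact_mod_cast hT0
    rw [R.total_avgQueue, div_le_iff₀ hT0'] at hT
    rw [← Finset.mul_sum, mul_assoc]
    exact mul_le_mul_of_nonneg_left hT (by positivity)

end Converse

/-! ### Drift of the fourth-order Lyapunov function -/

section Lyapunov

/-- Drift of the square of a Lyapunov function. -/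
theorem sq_drift_le {L L' tot g z ν δ c M Mν m : ℝ} (hL : 0 ≤ L) (hL' : 0 ≤ L') (htot : 0 ≤ tot)
    (hLt : L ≤ tot ^ 2) (htL : tot ^ 2 ≤ M * L) (hν : ν ≤ Mν)
    (hg : g ^ 2 ≤ L * (z + ν)) (hδ : 0 < δ)
    (h : L' ≤ L + (c - 2 * δ * tot + 2 * g + 2 * z))
    (hk : 0 ≤ 20 * m + 16 * Mν + 2 * c + 16 * δ ^ 2 * M + 1) :
    L' ^ 2 + (20 * m + 1) * L ≤ L ^ 2 + 4 * (L * g) + 20 * (L * z) + 16 * z ^ 2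
      + (4 * c ^ 2 + (20 * m + 16 * Mν + 2 * c + 16 * δ ^ 2 * M + 1)
        * ((20 * m + 16 * Mν + 2 * c + 16 * δ ^ 2 * M + 1) / (4 * δ)) ^ 2) := by
  -- `k` collects all multiples of `L`: the desired `20 * m + 1`, the term `2 * c * L` of the
  -- expansion, and `16 * Mν` and `16 * δ² * M` from `X²`. The `20 * (L * z)` in the conclusion is
  -- `4` from the cross term plus `16` from `16 * g²`; in expectation it is offset by `20 * m * L`.
  set k := 20 * m + 16 * Mν + 2 * c + 16 * δ ^ 2 * M + 1 with hkdef
  set X := c - 2 * δ * tot + 2 * g + 2 * z with hX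
  have h1 : L' ^ 2 ≤ (L + X) ^ 2 := by gcongr
  have h2 : X ^ 2 ≤ 4 * (c ^ 2 + 4 * δ ^ 2 * tot ^ 2 + 4 * g ^ 2 + 4 * z ^ 2) := by
    rw [hX]
    nlinarith [sq_nonneg (c + 2 * δ * tot), sq_nonneg (c - 2 * g), sq_nonneg (c - 2 * z),
      sq_nonneg (2 * δ * tot + 2 * g), sq_nonneg (2 * δ * tot + 2 * z), sq_nonneg (2 * g - 2 * z)]
  have h3 : δ ^ 2 * tot ^ 2 ≤ δ ^ 2 * (M * L) := mul_le_mul_of_nonneg_left htL (sq_nonneg δ)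
  have h4 : L * ν ≤ L * Mν := mul_le_mul_of_nonneg_left hν hL
  -- For a large total the negative drift `4 * δ * L * tot` absorbs `k * L`; for a small total `L ≤
  -- tot²` is bounded by a constant.
  have h5 : k * L ≤ 4 * δ * (L * tot) + k * (k / (4 * δ)) ^ 2 := by
    rcases le_total (k / (4 * δ)) tot with h6 | h6
    · rw [div_le_iff₀ (by positivity)] at h6
      have := mul_le_mul_of_nonneg_right h6 hL
      have : 0 ≤ k * (k / (4 * δ)) ^ 2 := by positivity
      linarith
    · have h7 : tot ^ 2 ≤ (k / (4 * δ)) ^ 2 := by gcongr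
      have h8 := mul_le_mul_of_nonneg_left (hLt.trans h7) hk
      have : 0 ≤ 4 * δ * (L * tot) := by positivity
      linarith
  have h9 : (L + X) ^ 2 = L ^ 2 + (2 * c * L - 4 * δ * (L * tot) + 4 * (L * g) + 4 * (L * z))
      + X ^ 2 := by rw [hX]; ring
  have h10 : k * L = (20 * m + 1) * L + 16 * (L * Mν) + 2 * c * L + 16 * (δ ^ 2 * (M * L)) := by
    rw [hkdef]; ring
  nlinarith

end Lyapunov

end Network

/-! ### Second moments of the queues and the pathwise drift bound -/

namespace Network.Run

variable {N F : Type*} [Fintype N] [DecidableEq N] [Fintype F] {net : Network N F}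
  {Pc : (N → Bool) → Set (Alloc N)} {Ω : Type*} [MeasurableSpace Ω] {μ : Measure Ω}
  [IsProbabilityMeasure μ] {R : net.Run Pc μ} {K : ℝ}

/-- Induction over the frames: transport is bounded, and the arrivals are in `L⁴`. -/
theorem memLp_q (hPc : ∀ s, Pc s ⊆ net.allocations s) (hK : R.MomentBound K) (t : ℕ) (n : N)
    (f : F) : MemLp (fun ω => R.q t ω n f) 4 μ := by
  induction t generalizing n f with
  | zero => simp only [R.q_zero]; exact memLp_const _
  | succ t ih =>
    have hm : StronglyMeasurable[R.ℱ t] fun ω => net.netInflow (R.rate t ω) n f :=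
      (Finset.stronglyMeasurable_fun_sum _ fun m _ => R.measurable_rate_entry t m n f).sub
        (Finset.stronglyMeasurable_fun_sum _ fun m _ => R.measurable_rate_entry t n m f)
    have hb : MemLp (fun ω => net.netInflow (R.rate t ω) n f) 4 μ :=
      MemLp.of_bound (hm.mono (R.ℱ.le t)).aestronglyMeasurable _ (Eventually.of_forall fun ω =>
        (R.admissible t ω).abs_netInflow_le (hPc _ (R.p_mem t ω)) n f)
    by_cases hn : n ∈ net.dst f
    · simp only [R.q_succ, if_pos hn]; exact memLp_const _
    · refine (((ih n f).add hb).add (R.memLp_a hK t n f)).ae_eq (Eventually.of_forall fun ω => ?_)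
      simp only [R.q_succ, if_neg hn, Pi.add_apply, netInflow]
      ring

theorem memLp_lyap_q (hPc : ∀ s, Pc s ⊆ net.allocations s) (hK : R.MomentBound K) (t : ℕ) :
    MemLp (fun ω => lyap (R.q t ω)) 2 μ :=
  memLp_finsetSum _ fun n _ => memLp_finsetSum _ fun f _ =>
    MemLp.sq_of_four (memLp_q hPc hK t n f)

omit [IsProbabilityMeasure μ] in
theorem memLp_lyap_a (hK : R.MomentBound K) (t : ℕ) : MemLp (fun ω => lyap (R.a t ω)) 2 μ :=
  memLp_finsetSum _ fun n _ => memLp_finsetSum _ fun f _ =>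
    MemLp.sq_of_four (R.memLp_a hK t n f)

theorem memLp_dot_noise (hPc : ∀ s, Pc s ⊆ net.allocations s) (hK : R.MomentBound K) (t : ℕ) :
    MemLp (fun ω => dot (R.q t ω) (R.a t ω - R.lam t ω)) 2 μ :=
  memLp_finsetSum _ fun n _ => memLp_finsetSum _ fun f _ =>
    MemLp.mul_of_four (memLp_q hPc hK t n f) (R.memLp_noise hK t n f)

/-- The queues of frame `t` are known before its arrivals, so conditioning on `ℱ t` annihilates
every summand. -/
theorem integral_lyap_mul_dot_noise (hPc : ∀ s, Pc s ⊆ net.allocations s)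
    (hK : R.MomentBound K) (t : ℕ) :
    ∫ ω, lyap (R.q t ω) * dot (R.q t ω) (R.a t ω - R.lam t ω) ∂μ = 0 := by
  have hi : ∀ n f, Integrable (fun ω => lyap (R.q t ω) *
      (R.q t ω n f * (R.a t ω n f - R.lam t ω n f))) μ := fun n f =>
    (memLp_lyap_q hPc hK t).integrable_mul
      (MemLp.mul_of_four (memLp_q hPc hK t n f) (R.memLp_noise hK t n f))
  simp only [dot, Finset.mul_sum, Pi.sub_apply]
  rw [integral_finsetSum _ fun n _ => integrable_finsetSum _ fun f _ => hi n f]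
  refine Finset.sum_eq_zero fun n _ => ?_
  rw [integral_finsetSum _ fun f _ => hi n f]
  refine Finset.sum_eq_zero fun f _ => ?_
  have h := integral_mul_eq_zero_of_condExp_eq_zero (μ := μ) (R.ℱ.le t)
    (Z := fun ω => lyap (R.q t ω) * R.q t ω n f)
    (Y := fun ω => R.a t ω n f - R.lam t ω n f)
    ((R.measurable_lyap_q t).mul (R.measurable_q_entry t n f))
    ((hi n f).congr (Eventually.of_forall fun ω => (mul_assoc _ _ _).symm))
    ((R.memLp_noise hK t n f).integrable (by norm_num)) (R.condExp_noise hK t n f)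
  simpa only [mul_assoc] using h

theorem integral_lyap_mul_lyap_a_le (hPc : ∀ s, Pc s ⊆ net.allocations s)
    (hK : R.MomentBound K) (t : ℕ) :
    ∫ ω, lyap (R.q t ω) * lyap (R.a t ω) ∂μ
      ≤ Fintype.card N * Fintype.card F * (1 + K) * ∫ ω, lyap (R.q t ω) ∂μ := by
  have hi : ∀ n f, Integrable (fun ω => lyap (R.q t ω) * R.a t ω n f ^ 2) μ := fun n f =>
    (memLp_lyap_q hPc hK t).integrable_mul (MemLp.sq_of_four (R.memLp_a hK t n f))
  have hs : ∀ ω, lyap (R.q t ω) * lyap (R.a t ω)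
      = ∑ n, ∑ f, lyap (R.q t ω) * R.a t ω n f ^ 2 := fun ω => by
    conv_lhs => rw [lyap.eq_def (R.a t ω)]
    simp only [Finset.mul_sum]
  simp only [hs]
  rw [integral_finsetSum _ fun n _ => integrable_finsetSum _ fun f _ => hi n f]
  calc ∑ n, ∫ ω, ∑ f, lyap (R.q t ω) * R.a t ω n f ^ 2 ∂μ
      = ∑ n, ∑ f, ∫ ω, lyap (R.q t ω) * R.a t ω n f ^ 2 ∂μ :=
        Finset.sum_congr rfl fun n _ => integral_finsetSum _ fun f _ => hi n f
    _ ≤ ∑ _n : N, ∑ _f : F, (1 + K) * ∫ ω, lyap (R.q t ω) ∂μ :=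
        Finset.sum_le_sum fun n _ => Finset.sum_le_sum fun f _ =>
          integral_mul_le_of_condExp_le (R.ℱ.le t) (R.measurable_lyap_q t) (hi n f)
            (R.integrable_a_sq hK t n f) ((memLp_lyap_q hPc hK t).integrable (by norm_num))
            (fun ω => lyap_nonneg _) (R.condExp_a_sq_le hK t n f)
    _ = _ := by simp; ring

theorem integral_lyap_a_sq_le (hK : R.MomentBound K) (t : ℕ) :
    ∫ ω, lyap (R.a t ω) ^ 2 ∂μ
      ≤ Fintype.card N * Fintype.card F * (Fintype.card N * Fintype.card F * K) := by
  have hi : ∀ n f, Integrable (fun ω => (R.a t ω n f ^ 2) ^ 2) μ := fun n f =>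
    (MemLp.sq_of_four (R.memLp_a hK t n f)).integrable_sq
  have hi2 : Integrable (fun ω => ∑ n, ∑ f, (R.a t ω n f ^ 2) ^ 2) μ :=
    integrable_finsetSum _ fun n _ => integrable_finsetSum _ fun f _ => hi n f
  have h1 : ∀ n f, ∫ ω, (R.a t ω n f ^ 2) ^ 2 ∂μ ≤ K := by
    intro n f
    have h5 := integral_mono_ae integrable_condExp (integrable_const K) (hK t n f).2
    rw [integral_condExp (R.ℱ.le t)] at h5
    simp only [integral_const, probReal_univ, smul_eq_mul, one_mul] at h5
    simpa only [← pow_mul] using h5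
  calc ∫ ω, lyap (R.a t ω) ^ 2 ∂μ
      ≤ ∫ ω, Fintype.card N * Fintype.card F * ∑ n, ∑ f, (R.a t ω n f ^ 2) ^ 2 ∂μ :=
        integral_mono (memLp_lyap_a hK t).integrable_sq (hi2.const_mul _) fun ω =>
          sq_total_le fun n f => R.a t ω n f ^ 2
    _ = Fintype.card N * Fintype.card F * ∑ n, ∑ f, ∫ ω, (R.a t ω n f ^ 2) ^ 2 ∂μ := by
        rw [integral_const_mul,
          integral_finsetSum _ fun n _ => integrable_finsetSum _ fun f _ => hi n f]
        congr 1
        exact Finset.sum_congr rfl fun n _ => integral_finsetSum _ fun f _ => hi n f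
    _ ≤ Fintype.card N * Fintype.card F * ∑ _n : N, ∑ _f : F, K := by
        gcongr with n _ f _
        exact h1 n f
    _ = _ := by
        simp only [Finset.sum_const, Finset.card_univ, nsmul_eq_mul]
        ring

/-- Second moments of the queues are summable against `1 / (t + 1)²`, under a negative drift. -/
theorem exists_sum_integral_lyap_le (hPc : ∀ s, Pc s ⊆ net.allocations s)
    (hK : R.MomentBound K) (hK0 : 0 ≤ K) {c₀ c δ : ℝ} (hδ : 0 < δ)
    (hgain : ∀ t ω, net.maxWeight Pc (R.q t ω) ≤ flowGain (R.q t ω) (R.rate t ω) + c₀)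
    (hdrift : ∀ t ω, dot (R.q t ω) (R.lam t ω) + δ * total (R.q t ω)
      ≤ net.maxWeight Pc (R.q t ω) + c) :
    ∃ B, ∀ T, ∑ t ∈ Finset.range T, (∫ ω, lyap (R.q t ω) ∂μ) / ((t : ℝ) + 1) ^ 2 ≤ B := by
  set M : ℝ := Fintype.card N * Fintype.card F with hM
  have hM0 : 0 ≤ M := by positivity
  set m : ℝ := M * (1 + K) with hm
  set Mν : ℝ := M * (1 + K) ^ 2 with hMν
  -- The truncation at zero makes the constants below nonnegative.
  set c₁ : ℝ := max 0 (2 * c + (2 * c₀ + net.driftConst)) with hc₁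
  have hc₁0 : 0 ≤ c₁ := le_max_left _ _
  set k : ℝ := 4 * c₁ ^ 2 + (20 * m + 16 * Mν + 2 * c₁ + 16 * δ ^ 2 * M + 1)
        * ((20 * m + 16 * Mν + 2 * c₁ + 16 * δ ^ 2 * M + 1) / (4 * δ)) ^ 2 with hk
  have hk0 : 0 ≤ k := by positivity
  refine ⟨_, fun T => sum_div_sq_le_of_drift (u := fun t => ∫ ω, lyap (R.q t ω) ∂μ)
    (Y := fun t => ∫ ω, lyap (R.q t ω) ^ 2 ∂μ) (k := 16 * (M * (M * K)) + k)
    (by positivity) (fun t => integral_nonneg fun ω => sq_nonneg _) (fun t => ?_) T⟩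
  have hL := memLp_lyap_q hPc hK t
  have iL : Integrable (fun ω => lyap (R.q t ω)) μ := hL.integrable (by norm_num)
  have iL2 : Integrable (fun ω => lyap (R.q t ω) ^ 2) μ := hL.integrable_sq
  have iLg : Integrable (fun ω => lyap (R.q t ω) * dot (R.q t ω) (R.a t ω - R.lam t ω)) μ :=
    hL.integrable_mul (memLp_dot_noise hPc hK t)
  have iLz : Integrable (fun ω => lyap (R.q t ω) * lyap (R.a t ω)) μ :=
    hL.integrable_mul (memLp_lyap_a hK t)
  have iz2 : Integrable (fun ω => lyap (R.a t ω) ^ 2) μ := (memLp_lyap_a hK t).integrable_sq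
  have iL2' : Integrable (fun ω => lyap (R.q (t + 1) ω) ^ 2) μ :=
    (memLp_lyap_q hPc hK (t + 1)).integrable_sq
  have i1 := iL2.add (iLg.const_mul 4)
  have i2 := i1.add (iLz.const_mul 20)
  have i3 := i2.add (iz2.const_mul 16)
  have hlam : ∀ᵐ ω ∂μ, ∀ n f, 0 ≤ R.lam t ω n f ∧ R.lam t ω n f ≤ 1 + K := by
    rw [ae_all_iff]; intro n
    rw [ae_all_iff]; intro f
    exact R.condExp_a_le hK t n f
  -- The pathwise fourth-order drift is integrated. The noise term has mean zero and `20 * E[L z] ≤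
  -- 20 * m * E[L]`, which leaves the decrease of `E[L²]` by `E[L]` up to a constant.
  have hint := integral_mono_ae (iL2'.add (iL.const_mul (20 * m + 1)))
    (i3.add (integrable_const k)) (by
      filter_upwards [hlam] with ω hω
      refine sq_drift_le (tot := total (R.q t ω)) (ν := lyap (R.lam t ω)) (lyap_nonneg _)
        (lyap_nonneg _) (total_nonneg (R.q_nonneg t ω)) (lyap_le_total_sq (R.q_nonneg t ω))
        (sq_total_le _) (lyap_le_mul fun n f => ?_) ?_ hδ ?_ (by positivity)
      · have := (hω n f).1; have := (hω n f).2
        gcongr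
      · refine (sq_dot_le _ _).trans (mul_le_mul_of_nonneg_left ?_ (lyap_nonneg _))
        exact lyap_sub_le (R.a_nonneg t ω) fun n f => (hω n f).1
      · have h1 := R.lyap_succ_le hPc (hgain t ω)
        have h2 := hdrift t ω
        have h3 := le_max_right 0 (2 * c + (2 * c₀ + net.driftConst))
        rw [← hc₁] at h3
        linarith)
  rw [integral_add' iL2' (iL.const_mul _), integral_add' i3 (integrable_const k),
    integral_add' i2 (iz2.const_mul _), integral_add' i1 (iLz.const_mul _),
    integral_add' iL2 (iLg.const_mul _)] at hint
  simp only [integral_const_mul, integral_const, probReal_univ, smul_eq_mul, one_mul] at hint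
  rw [integral_lyap_mul_dot_noise hPc hK t] at hint
  have h1 := integral_lyap_mul_lyap_a_le hPc hK t
  have h2 := integral_lyap_a_sq_le hK t
  rw [← hM] at h1 h2
  rw [← hm] at h1
  linarith

/-- Pathwise consequence of the drift: back pressure makes the accumulated difference of the
maximum weight and the offered load grow at most linearly, at a rate that only depends on the
network and the moment bound. -/
theorem ae_eventually_sum_maxWeight_sub_dot_le (hPc : ∀ s, Pc s ⊆ net.allocations s)
    (hK : R.MomentBound K) (hK0 : 0 ≤ K) {c₀ c δ : ℝ} (hδ : 0 < δ)
    (hgain : ∀ t ω, net.maxWeight Pc (R.q t ω) ≤ flowGain (R.q t ω) (R.rate t ω) + c₀)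
    (hdrift : ∀ t ω, dot (R.q t ω) (R.lam t ω) + δ * total (R.q t ω)
      ≤ net.maxWeight Pc (R.q t ω) + c) :
    ∀ᵐ ω ∂μ, ∀ᶠ T : ℕ in atTop,
      2 * ∑ t ∈ Finset.range T, (net.maxWeight Pc (R.q t ω) - dot (R.q t ω) (R.lam t ω))
        + lyap (R.q T ω)
      ≤ (2 * c₀ + net.driftConst + 2 * (Fintype.card N * Fintype.card F * (2 + K)) + 2) * T := by
  obtain ⟨B, hB⟩ := exists_sum_integral_lyap_le hPc hK hK0 hδ hgain hdrift
  -- The queue-weighted noise averages out: `B` bounds exactly the weighted second moments that the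
  -- strong law requires.
  have hnoise : ∀ᵐ ω ∂μ, ∀ n f, Tendsto (fun T : ℕ => (∑ t ∈ Finset.range T,
      R.q t ω n f * (R.a t ω n f - R.lam t ω n f)) / T) atTop (𝓝 0) := by
    rw [ae_all_iff]; intro n
    rw [ae_all_iff]; intro f
    refine R.ae_tendsto_average_mul_noise hK (Z := fun t ω => R.q t ω n f) (B := B) n f
      (fun t => R.measurable_q_entry t n f) (fun t => memLp_q hPc hK t n f) (fun T => ?_) hK0
    refine le_trans (Finset.sum_le_sum fun t _ => ?_) (hB T)
    refine div_le_div_of_nonneg_right ?_ (by positivity)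
    exact integral_mono (MemLp.sq_of_four (memLp_q hPc hK t n f) |>.integrable (by norm_num))
      ((memLp_lyap_q hPc hK t).integrable (by norm_num)) fun ω => sq_entry_le_lyap _ n f
  filter_upwards [hnoise, R.ae_eventually_sum_a_sq_le hK hK0] with ω h1 h2
  have hdot : Tendsto (fun T : ℕ =>
      (∑ t ∈ Finset.range T, dot (R.q t ω) (R.a t ω - R.lam t ω)) / T) atTop (𝓝 0) := by
    have := tendsto_finsetSum (Finset.univ : Finset N) (fun n _ =>
      tendsto_finsetSum (Finset.univ : Finset F) (fun f _ => h1 n f))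
    simp only [Finset.sum_const_zero] at this
    refine this.congr fun T => ?_
    simp only [← Finset.sum_div]
    congr 1
    simp only [dot, Pi.sub_apply]
    symm
    rw [Finset.sum_comm]
    exact Finset.sum_congr rfl fun n _ => Finset.sum_comm
  have ha : ∀ᶠ T : ℕ in atTop, ∑ t ∈ Finset.range T, lyap (R.a t ω)
      ≤ T * (Fintype.card N * Fintype.card F * (2 + K)) := by
    have : ∀ᶠ T : ℕ in atTop, ∀ n f, ∑ t ∈ Finset.range T, R.a t ω n f ^ 2 ≤ T * (1 + K + 1) := by
      rw [eventually_all]; intro n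
      rw [eventually_all]; intro f
      exact h2 n f 1 one_pos
    filter_upwards [this] with T hT
    calc ∑ t ∈ Finset.range T, lyap (R.a t ω)
        = ∑ n, ∑ f, ∑ t ∈ Finset.range T, R.a t ω n f ^ 2 := by
          simp only [lyap]
          rw [Finset.sum_comm]
          exact Finset.sum_congr rfl fun n _ => Finset.sum_comm
      _ ≤ ∑ _n : N, ∑ _f : F, (T : ℝ) * (1 + K + 1) :=
          Finset.sum_le_sum fun n _ => Finset.sum_le_sum fun f _ => hT n f
      _ = _ := by simp; ring
  have hsum : ∀ T : ℕ, 2 * ∑ t ∈ Finset.range T,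
        (net.maxWeight Pc (R.q t ω) - dot (R.q t ω) (R.lam t ω)) + lyap (R.q T ω)
      ≤ lyap R.q₀ + 2 * ∑ t ∈ Finset.range T, dot (R.q t ω) (R.a t ω - R.lam t ω)
        + T * (2 * c₀ + net.driftConst) + 2 * ∑ t ∈ Finset.range T, lyap (R.a t ω) := by
    intro T
    induction T with
    | zero => simp [R.q_zero]
    | succ T ih =>
      simp only [Finset.sum_range_succ]
      push_cast
      have := R.lyap_succ_le hPc (hgain T ω)
      linarith
  have hinit : ∀ᶠ T : ℕ in atTop, lyap R.q₀ ≤ T := by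
    obtain ⟨T₀, hT₀⟩ := exists_nat_ge (lyap R.q₀)
    filter_upwards [eventually_ge_atTop T₀] with T hT
    exact hT₀.trans (by exact_mod_cast hT)
  -- The initial state and twice the noise contribute at most `T` each, which is the final `+ 2` in
  -- the constant; `2 + K` is `1 + K + ε` at `ε = 1`. Neither `c` nor `δ` enters.
  filter_upwards [hdot.eventually (gt_mem_nhds (show (0 : ℝ) < 1 / 2 by norm_num)), ha, hinit,
    eventually_gt_atTop 0] with T hT1 hT2 hT3 hT0
  have hT0' : (0 : ℝ) < T := by exact_mod_cast hT0
  rw [div_lt_iff₀ hT0'] at hT1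
  linarith [hsum T]

end Network.Run

namespace Network

/-! ### A positive margin suffices for membership in the capacity region -/

section Achievability

variable {N F : Type*} [Fintype N] [DecidableEq N] [Fintype F]
  {net : Network N F} {Pc : (N → Bool) → Set (Alloc N)}

/-- `x` satisfies the maximum-weight inequalities with a margin `δ` per queue. -/
def HasMargin (net : Network N F) (Pc : (N → Bool) → Set (Alloc N)) (δ : ℝ) (x : QVec N F) :
    Prop :=
  ∀ w : QVec N F, 0 ≤ w → (∀ f, ∀ n ∈ net.dst f, w n f = 0) →
    dot w x + δ * total w ≤ net.maxWeight Pc w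

/-- The bits left in the queues after one frame with deterministic arrivals `x`. -/
def nextQueue (net : Network N F) (x q : QVec N F) (r : N → N → F → ℝ) : QVec N F :=
  fun n f => if n ∈ net.dst f then 0
    else q n f + ∑ m ∈ net.nbrs n, r m n f - ∑ m ∈ net.nbrs n, r n m f + x n f

theorem nextQueue_nonneg {p : Alloc N} {x q : QVec N F} {r : N → N → F → ℝ}
    (hx : 0 ≤ x) (h : net.Admissible p q r) : 0 ≤ net.nextQueue x q r := by
  intro n f
  simp only [nextQueue, Pi.zero_apply]
  split_ifs
  · exact le_rfl
  · have h1 : 0 ≤ ∑ m ∈ net.nbrs n, r m n f := Finset.sum_nonneg fun m _ => h.nonneg m n f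
    have h2 := h.le_queue n f
    have h3 := hx n f
    simp only [Pi.zero_apply] at h3
    linarith

/-- A nonnegative rate vector with a positive margin is supported by the network. -/
theorem HasMargin.mem_capacityRegion (hPc : ∀ s, Pc s ⊆ net.allocations s)
    (hne : ∃ s, (Pc s).Nonempty) {x : QVec N F} (hx : 0 ≤ x) {δ : ℝ} (hδ : 0 < δ)
    (h : net.HasMargin Pc δ x) : x ∈ net.capacityRegion Pc := by
  classical
  -- The selection is made for every `q` so that the queue recursion can be defined first; its
  -- guarantees matter only for `q ≥ 0`, which is proved afterwards.
  have hsel : ∀ q : QVec N F, ∃ s p r, p ∈ Pc s ∧ (0 ≤ q → net.Admissible p q r ∧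
      net.maxWeight Pc q ≤ flowGain q r + (net.mbpLoss + 1)) := by
    intro q
    by_cases hq : 0 ≤ q
    · obtain ⟨s, p, hp, r, h1, h2⟩ := exists_admissible_maxWeight_le hPc hne hq
      exact ⟨s, p, r, hp, fun _ => ⟨h1, h2⟩⟩
    · obtain ⟨s, p, hp⟩ := hne
      exact ⟨s, p, fun _ _ _ => 0, hp, fun h => absurd h hq⟩
  choose S P r hP hr using hsel
  let Q : ℕ → QVec N F := fun t => Nat.rec 0 (fun _ q => net.nextQueue x q (r q)) t
  have hQ : ∀ t, Q (t + 1) = net.nextQueue x (Q t) (r (Q t)) := fun t => rfl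
  have hQ0 : ∀ t, 0 ≤ Q t := by
    intro t
    induction t with
    | zero => exact le_rfl
    | succ t ih => rw [hQ]; exact nextQueue_nonneg hx (hr _ ih).1
  -- With constant arrivals `x` there is no randomness, so a one-point space carries the witness.
  let μ : Measure Unit := Measure.dirac ()
  let R : net.Run Pc μ :=
    { ℱ := ⟨fun _ => inferInstance, fun _ _ _ => le_rfl, fun _ => le_rfl⟩
      q₀ := 0
      q := fun t _ => Q t
      s := fun t _ => S (Q t)
      p := fun t _ => P (Q t)
      rate := fun t _ => r (Q t)
      a := fun _ _ => x
      lam := fun _ _ => x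
      q₀_nonneg := le_rfl
      q₀_dst := fun _ _ _ => rfl
      measurable_s := fun _ => measurable_const
      measurable_p := fun _ => measurable_const
      measurable_rate := fun _ => measurable_const
      measurable_lam := fun _ => measurable_const
      measurable_a := fun _ => measurable_const
      p_mem := fun t _ => hP (Q t)
      rate_nonneg := fun t _ => (hr _ (hQ0 t)).1.nonneg
      rate_le_link := fun t _ => (hr _ (hQ0 t)).1.le_link
      rate_le_queue := fun t _ => (hr _ (hQ0 t)).1.le_queue
      a_nonneg := fun _ _ => hx
      integrable_a := fun _ _ _ => integrable_const _
      condExp_a := fun _ n f => by rw [condExp_const le_rfl]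
      q_zero := fun _ => rfl
      q_succ := fun _ _ _ _ => rfl }
  refine ⟨Unit, inferInstance, μ, inferInstance, R, ∑ n, ∑ f, x n f ^ 4, ?_, ?_, ?_⟩
  · intro t n f
    refine ⟨integrable_const (x n f ^ 4), ?_⟩
    have e : μ[fun ω => R.a t ω n f ^ 4 | R.ℱ t] = fun _ => x n f ^ 4 :=
      condExp_const (R.ℱ.le t) (x n f ^ 4)
    rw [e]
    exact Eventually.of_forall fun _ => entry_le_total (w := fun n f => x n f ^ 4)
      (fun n f => (by positivity : (0 : ℝ) ≤ x n f ^ 4)) n f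
  · refine Eventually.of_forall fun ω => tendsto_const_nhds.congr' ?_
    filter_upwards [eventually_gt_atTop 0] with T hT
    have hT0 : (T : ℝ) ≠ 0 := by positivity
    rw [R.avgRate_eq]
    change x = (T : ℝ)⁻¹ • ∑ t ∈ Finset.range T, x
    rw [Finset.sum_const, Finset.card_range, ← Nat.cast_smul_eq_nsmul ℝ, smul_smul,
      inv_mul_cancel₀ hT0, one_smul]
  · set C := 2 * (net.mbpLoss + 1) + net.driftConst + 2 * lyap x with hC
    -- The margin at `w = Q t` turns the quadratic drift into a decrease by `2 * δ * total (Q t)` up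
    -- to the constant `C`.
    have step : ∀ t, lyap (Q (t + 1)) + 2 * δ * total (Q t) ≤ lyap (Q t) + C := by
      intro t
      have h1 := R.lyap_succ_le hPc (t := t) (ω := ()) (hr _ (hQ0 t)).2
      have h2 := h (Q t) (hQ0 t) (fun f n hn => R.q_dst t () f n hn)
      rw [show R.a t () - R.lam t () = 0 from sub_self x] at h1
      have h3 : dot (R.q t ()) 0 = 0 := by simp [dot]
      rw [h3] at h1
      change lyap (Q (t + 1)) ≤ lyap (Q t) - 2 * (net.maxWeight Pc (Q t) - dot (Q t) x) + 2 * 0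
        + (2 * (net.mbpLoss + 1) + net.driftConst) + 2 * lyap x at h1
      linarith
    have hsum : ∀ T : ℕ, lyap (Q T) + 2 * δ * ∑ t ∈ Finset.range T, total (Q t) ≤ C * T := by
      intro T
      induction T with
      | zero => simp [Q, lyap]
      | succ T ih =>
        rw [Finset.sum_range_succ]
        push_cast
        linarith [step T]
    refine Eventually.of_forall fun ω => ⟨C / (2 * δ), ?_⟩
    filter_upwards [eventually_gt_atTop 0] with T hT
    have hT0 : (0 : ℝ) < T := by exact_mod_cast hT
    rw [R.total_avgQueue, div_le_div_iff₀ hT0 (by positivity)]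
    have := hsum T
    have := lyap_nonneg (Q T)
    change (∑ t ∈ Finset.range T, total (Q t)) * (2 * δ) ≤ C * T
    linarith

theorem HasMargin.mono {x y : QVec N F} {δ δ' : ℝ} (h : net.HasMargin Pc δ x)
    (hle : ∀ n f, y n f + δ' ≤ x n f + δ) : net.HasMargin Pc δ' y := by
  intro w hw hd
  have h1 := h w hw hd
  rw [← dot_const, ← dot_add_right] at h1 ⊢
  exact (dot_mono_right hw fun n f => hle n f).trans h1

/-- Raising all coordinates by `ε / 2` stays in the orthant and in the region. The necessary
inequality at the raised point is the margin at `x`. -/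
theorem exists_hasMargin_of_mem_capacityInterior (hPc : ∀ s, Pc s ⊆ net.allocations s)
    {x : QVec N F} (hx : x ∈ net.capacityInterior Pc) : ∃ δ > 0, net.HasMargin Pc δ x := by
  obtain ⟨hx0, hx⟩ := hx
  obtain ⟨ε, hε, hball⟩ := Metric.mem_nhdsWithin_iff.1 hx
  have hmem : x + (fun _ _ => ε / 2) ∈ net.capacityRegion Pc := by
    refine hball ⟨?_, fun n f => add_nonneg (hx0 n f) (by positivity)⟩
    rw [Metric.mem_ball, dist_pi_lt_iff hε]
    intro n
    rw [dist_pi_lt_iff hε]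
    intro f
    rw [Real.dist_eq]
    simp only [Pi.add_apply, add_sub_cancel_left]
    rw [abs_of_pos (by positivity)]
    linarith
  refine ⟨ε / 2, by positivity, fun w hw hd => ?_⟩
  have := dot_le_maxWeight hPc hmem hw hd
  rwa [dot_add_right, dot_const] at this

theorem allowed_nonempty_of_mem_capacityRegion {x : QVec N F}
    (hx : x ∈ net.capacityRegion Pc) : ∃ s, (Pc s).Nonempty := by
  obtain ⟨Ω, _, μ, _, R, -⟩ := hx
  have : Nonempty Ω := μ.nonempty_of_neZero
  exact R.allowed_nonempty

theorem mem_capacityRegion_of_mem_interior {x : QVec N F}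
    (hx : x ∈ net.capacityInterior Pc) : x ∈ net.capacityRegion Pc :=
  mem_of_mem_nhdsWithin hx.1 hx.2

/-- Rates away from the destinations are at most the cap of the congestion controller. -/
theorem le_lamMax_of_mem_capacityRegion (hPc : ∀ s, Pc s ⊆ net.allocations s)
    {x : QVec N F} (hx : x ∈ net.capacityRegion Pc) {n : N} {f : F} (hn : n ∉ net.dst f) :
    x n f ≤ net.lamMax := by
  classical
  -- Tested against the indicator of a single queue, the maximum weight is at most the largest total
  -- rate out of its node.
  set w : QVec N F := fun n' f' => if n' = n ∧ f' = f then 1 else 0 with hw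
  have h1 : dot w x = x n f := by
    rw [dot, Finset.sum_eq_single n, Finset.sum_eq_single f]
    · simp [hw]
    · intro f' _ hf; simp [hw, hf]
    · simp
    · intro n' _ hn'; simp [hw, hn']
    · simp
  have hw0 : 0 ≤ w := fun n' f' => by simp only [hw, Pi.zero_apply]; split_ifs <;> norm_num
  have hd : ∀ f', ∀ n' ∈ net.dst f', w n' f' = 0 := by
    intro f' n' hn'
    refine if_neg ?_
    rintro ⟨rfl, rfl⟩
    exact hn hn'
  rw [← h1]
  refine (dot_le_maxWeight hPc hx hw0 hd).trans (maxWeight_le net.lamMax_nonneg fun s p hp => ?_)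
  have hpr : ∀ n' m, pressure w n' m ≤ if n' = n then 1 else 0 := by
    intro n' m
    refine pressure_le (by split_ifs <;> norm_num) fun f' => ?_
    have : 0 ≤ w m f' := hw0 m f'
    have h2 : w n' f' ≤ if n' = n then 1 else 0 := by
      simp only [hw]
      split_ifs <;> simp_all
    linarith
  calc net.weight w p ≤ ∑ n', ∑ m, net.linkRate p n' m * (if n' = n then 1 else 0) :=
        Finset.sum_le_sum fun n' _ => Finset.sum_le_sum fun m _ =>
          mul_le_mul_of_nonneg_left (hpr n' m) (net.linkRate_nonneg (hPc s hp) n' m)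
    _ = ∑ m, net.linkRate p n m := by
        rw [Finset.sum_eq_single n]
        · simp
        · intro n' _ hn'; simp [hn']
        · simp
    _ = ∑ m ∈ net.nbrs n, net.linkRate p n m :=
        (Finset.sum_subset (Finset.subset_univ _) fun m _ hm =>
          net.linkRate_of_not_mem (hPc s hp) hm).symm
    _ ≤ (net.nbrs n).card * net.rateMax := by
        simpa using Finset.sum_le_card_nsmul (net.nbrs n) (fun m => net.linkRate p n m)
          net.rateMax fun m _ => net.linkRate_le_rateMax (hPc s hp) n m
    _ ≤ net.lamMax := net.card_mul_rateMax_le_lamMax n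

end Achievability

/-! ### The scalar congestion controller and uniform strict concavity -/

section ScalarUtility

variable {D : Set ℝ} {U : ℝ → ℝ}

theorem IsUtility.subset_Ici (h : IsUtility D U) : D ⊆ Set.Ici 0 := by
  rcases h.domain with rfl | ⟨rfl, -⟩
  · exact le_rfl
  · exact Set.Ioi_subset_Ici_self

theorem IsUtility.Ioi_subset (h : IsUtility D U) : Set.Ioi 0 ⊆ D := by
  rcases h.domain with rfl | ⟨rfl, -⟩
  · exact Set.Ioi_subset_Ici_self
  · exact le_rfl

theorem IsUtility.interior_domain (h : IsUtility D U) : interior D = Set.Ioi 0 := by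
  rcases h.domain with rfl | ⟨rfl, -⟩ <;> simp

theorem IsUtility.mem_of_le (h : IsUtility D U) {x y : ℝ} (hx : x ∈ D) (hxy : x ≤ y) :
    y ∈ D := by
  rcases h.domain with rfl | ⟨rfl, -⟩
  · exact le_trans (Set.mem_Ici.1 hx) hxy
  · exact lt_of_lt_of_le (Set.mem_Ioi.1 hx) hxy

theorem IsUtility.differentiableAt (h : IsUtility D U) {x : ℝ} (hx : 0 < x) :
    DifferentiableAt ℝ U x :=
  (h.differentiableOn x hx).differentiableAt (Ioi_mem_nhds hx)

theorem IsUtility.antitoneOn_deriv (h : IsUtility D U) :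
    AntitoneOn (deriv U) (Set.Ioi 0) :=
  (h.strictConcaveOn.concaveOn.subset h.Ioi_subset (convex_Ioi 0)).antitoneOn_deriv
    fun _ hx => h.differentiableAt hx

theorem IsUtility.deriv_penalized (h : IsUtility D U) (y : ℝ) {x : ℝ} (hx : 0 < x) :
    deriv (fun x => U x - y * x) x = deriv U x - y := by
  have : HasDerivAt (fun x => U x - y * x) (deriv U x - y * 1) x :=
    (h.differentiableAt hx).hasDerivAt.sub ((hasDerivAt_id x).const_mul y)
  rw [this.deriv, mul_one]

section clipped

variable {b : ℝ} (y : ℝ)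

theorem bddAbove_clipped (hb : 0 ≤ b) :
    BddAbove (insert 0 {x | 0 < x ∧ x < b ∧ y ≤ deriv U x}) := by
  refine ⟨b, ?_⟩
  rintro x (rfl | ⟨-, h, -⟩)
  · exact hb
  · exact h.le

theorem clippedInvDeriv_nonneg (hb : 0 ≤ b) : 0 ≤ clippedInvDeriv U b y :=
  le_csSup (bddAbove_clipped y hb) (Set.mem_insert _ _)

theorem clippedInvDeriv_le (hb : 0 ≤ b) : clippedInvDeriv U b y ≤ b := by
  refine csSup_le (Set.insert_nonempty _ _) ?_
  rintro x (rfl | ⟨-, h, -⟩)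
  · exact hb
  · exact h.le

/-- The derivative is antitone, so every positive point below an element of the defining set
inherits its inequality. -/
theorem le_deriv_of_lt_clippedInvDeriv (h : IsUtility D U) {x : ℝ} (hx : 0 < x)
    (hlt : x < clippedInvDeriv U b y) : y ≤ deriv U x := by
  obtain ⟨s, hs, hxs⟩ := exists_lt_of_lt_csSup (Set.insert_nonempty _ _) hlt
  rcases hs with rfl | ⟨h0, -, h2⟩
  · exact absurd hxs hx.not_gt
  · exact h2.trans (h.antitoneOn_deriv hx h0 hxs.le)

theorem deriv_lt_of_clippedInvDeriv_lt (hb : 0 ≤ b) {x : ℝ} (hx : 0 < x) (hxb : x < b)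
    (hlt : clippedInvDeriv U b y < x) : deriv U x < y := by
  by_contra hy
  exact hlt.not_ge (le_csSup (bddAbove_clipped y hb) (Or.inr ⟨hx, hxb, not_lt.1 hy⟩))

theorem IsUtility.continuousOn_penalized (h : IsUtility D U) :
    ContinuousOn (fun x => U x - y * x) D :=
  h.continuousOn.sub (by fun_prop)

/-- The only danger is the value `0` on the open domain. It would make `U x - y * x` antitone on
`(0, b)`, although it tends to `-∞` at `0`. -/
theorem IsUtility.clippedInvDeriv_mem (h : IsUtility D U) (hb : 0 < b) :
    clippedInvDeriv U b y ∈ D := by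
  have h0 := clippedInvDeriv_nonneg (U := U) y hb.le
  rcases h.domain with hD | ⟨hD, hlim⟩
  · rw [hD]; exact h0
  · rcases h0.eq_or_lt with h1 | h1
    · exfalso
      have hanti : AntitoneOn (fun x => U x - y * x) (Set.Ioo 0 b) := by
        refine antitoneOn_of_deriv_nonpos (convex_Ioo 0 b)
          ((h.continuousOn_penalized y).mono fun x hx => h.Ioi_subset hx.1) ?_ ?_
        · rw [interior_Ioo]
          exact fun x hx => ((h.differentiableAt hx.1).sub
            (by fun_prop)).differentiableWithinAt
        · rw [interior_Ioo]
          intro x hx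
          rw [h.deriv_penalized y hx.1]
          linarith [deriv_lt_of_clippedInvDeriv_lt y hb.le hx.1 hx.2 (by rw [← h1]; exact hx.1)]
      have hev : ∀ᶠ x in 𝓝[>] (0 : ℝ), U x ≤ U (b / 2) - y * (b / 2) - |y| * b - 1 :=
        hlim.eventually (eventually_le_atBot _)
      have hmem : ∀ᶠ x in 𝓝[>] (0 : ℝ), x ∈ Set.Ioo 0 (b / 2) :=
        Ioo_mem_nhdsGT (by positivity)
      obtain ⟨x, hx1, hx2⟩ := (hev.and hmem).exists
      have h2 := hanti ⟨hx2.1, by linarith [hx2.2]⟩ ⟨by linarith, by linarith⟩ hx2.2.le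
      simp only at h2
      have h3 : |y * x| ≤ |y| * b := by
        rw [abs_mul, abs_of_pos hx2.1]
        exact mul_le_mul_of_nonneg_left (by linarith [hx2.2]) (abs_nonneg y)
      linarith [neg_abs_le (y * x)]
    · exact h.Ioi_subset h1

/-- The rate of the congestion controller maximizes utility minus price. -/
theorem IsUtility.penalized_le (h : IsUtility D U) (hb : 0 < b) {x : ℝ} (hx : x ∈ D)
    (hxb : x ≤ b) :
    U x - y * x ≤ U (clippedInvDeriv U b y) - y * clippedInvDeriv U b y := by
  set l := clippedInvDeriv U b y with hl
  have hlD : l ∈ D := h.clippedInvDeriv_mem y hb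
  have hdiff : ∀ z, 0 < z → DifferentiableAt ℝ (fun x => U x - y * x) z := fun z hz =>
    (h.differentiableAt hz).sub (by fun_prop)
  -- The penalized utility increases up to `l` and decreases from `l` to the cap `b`, by the sign of
  -- `U' - y` on either side.
  rcases le_total x l with hxl | hxl
  · have hi : interior (D ∩ Set.Iic l) = Set.Ioi 0 ∩ Set.Iio l := by
      rw [interior_inter, h.interior_domain, interior_Iic]
    refine monotoneOn_of_deriv_nonneg (D := D ∩ Set.Iic l)
      (h.strictConcaveOn.1.inter (convex_Iic l))
      ((h.continuousOn_penalized y).mono Set.inter_subset_left) ?_ ?_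
      ⟨hx, hxl⟩ ⟨hlD, Set.mem_Iic.2 le_rfl⟩ hxl
    · rw [hi]
      exact fun z hz => (hdiff z hz.1).differentiableWithinAt
    · rw [hi]
      intro z hz
      rw [h.deriv_penalized y hz.1]
      linarith [le_deriv_of_lt_clippedInvDeriv y h hz.1 hz.2]
  · have hi : interior (D ∩ Set.Icc l b) = Set.Ioi 0 ∩ Set.Ioo l b := by
      rw [interior_inter, h.interior_domain, interior_Icc]
    refine antitoneOn_of_deriv_nonpos (D := D ∩ Set.Icc l b)
      (h.strictConcaveOn.1.inter (convex_Icc l b))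
      ((h.continuousOn_penalized y).mono Set.inter_subset_left) ?_ ?_
      ⟨hlD, le_rfl, hxl.trans hxb⟩ ⟨hx, hxl, hxb⟩ hxl
    · rw [hi]
      exact fun z hz => (hdiff z hz.1).differentiableWithinAt
    · rw [hi]
      intro z hz
      rw [h.deriv_penalized y hz.1]
      linarith [deriv_lt_of_clippedInvDeriv_lt y hb.le hz.1 hz.2.2 hz.2.1]

end clipped

/-- The concavity gap at the midpoint grows along rays. -/
theorem midpoint_gap_mono (h : ConcaveOn ℝ D U) {u x s : ℝ} (hu : u ∈ D) (hx : x ∈ D)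
    (hs0 : 0 ≤ s) (hs1 : s ≤ 1) :
    U u + 2 * U ((x + s * (u - x) + x) / 2) ≤ U (x + s * (u - x)) + 2 * U ((u + x) / 2) := by
  have h2 : (0 : ℝ) < 2 - s := by linarith
  have hm : (x + s * (u - x) + x) / 2 ∈ D := by
    have := h.1 hu hx (by linarith : 0 ≤ s / 2) (by linarith : 0 ≤ 1 - s / 2) (by ring)
    convert this using 1
    simp only [smul_eq_mul]; ring
  -- With `v = x + s * (u - x)` and `m = (v + x) / 2`, both `v` and `(u + x) / 2` lie between `m`
  -- and `u`. Their concavity inequalities, the second one doubled, add up to the claim.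
  have e1 := h.2 hu hm (by positivity : 0 ≤ s / (2 - s))
    (div_nonneg (by linarith) h2.le : 0 ≤ (2 - 2 * s) / (2 - s)) (by field_simp; ring)
  have e2 := h.2 hu hm (div_nonneg (by linarith) h2.le : 0 ≤ (1 - s) / (2 - s))
    (by positivity : 0 ≤ 1 / (2 - s)) (by field_simp; ring)
  have p1 : s / (2 - s) * u + (2 - 2 * s) / (2 - s) * ((x + s * (u - x) + x) / 2)
      = x + s * (u - x) := by field_simp; ring
  have p2 : (1 - s) / (2 - s) * u + 1 / (2 - s) * ((x + s * (u - x) + x) / 2)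
      = (u + x) / 2 := by field_simp; ring
  simp only [smul_eq_mul] at e1 e2
  rw [p1] at e1
  rw [p2] at e2
  have e3 : U u + 2 * U ((x + s * (u - x) + x) / 2)
      = (s / (2 - s) * U u + (2 - 2 * s) / (2 - s) * U ((x + s * (u - x) + x) / 2))
      + 2 * ((1 - s) / (2 - s) * U u + 1 / (2 - s) * U ((x + s * (u - x) + x) / 2)) := by
    field_simp; ring
  linarith

theorem midpoint_lt (h : StrictConcaveOn ℝ D U) {u x : ℝ} (hu : u ∈ D) (hx : x ∈ D)
    (hne : u ≠ x) : (U u + U x) / 2 < U ((u + x) / 2) := by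
  have := h.2 hu hx hne (by norm_num : (0 : ℝ) < 1 / 2) (by norm_num : (0 : ℝ) < 1 / 2)
    (by norm_num)
  simp only [smul_eq_mul] at this
  rw [show (1 / 2 : ℝ) * u + 1 / 2 * x = (u + x) / 2 by ring] at this
  linarith

/-- Uniform strict concavity around a point. -/
theorem IsUtility.exists_midpoint_gap (h : IsUtility D U) {x ε : ℝ} (hx : x ∈ D) (hε : 0 < ε) :
    ∃ κ > 0, ∀ u ∈ D, ε ≤ |u - x| → (U u + U x) / 2 + κ ≤ U ((u + x) / 2) := by
  have hconc := h.strictConcaveOn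
  -- The midpoint gap at `v` serves every `u` beyond `v` on the ray from `x`, so the points `x ± ε`
  -- suffice for uniformity.
  have gap : ∀ v, v ∈ D → v ≠ x → ∃ κ > 0, ∀ u ∈ D, ∀ s, 0 ≤ s → s ≤ 1 → v = x + s * (u - x) →
      (U u + U x) / 2 + κ ≤ U ((u + x) / 2) := by
    intro v hv hvx
    refine ⟨U ((v + x) / 2) - (U v + U x) / 2, sub_pos.2 (midpoint_lt hconc hv hx hvx), ?_⟩
    rintro u hu s hs0 hs1 rfl
    have := midpoint_gap_mono hconc.concaveOn hu hx hs0 hs1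
    linarith
  obtain ⟨κ₁, hκ₁, h₁⟩ := gap (x + ε) (h.mem_of_le hx (by linarith)) (by linarith)
  have right : ∀ u ∈ D, ε ≤ u - x → (U u + U x) / 2 + κ₁ ≤ U ((u + x) / 2) := by
    intro u hu hux
    have h0 : 0 < u - x := by linarith
    refine h₁ u hu (ε / (u - x)) (by positivity) ((div_le_one h0).2 hux) ?_
    field_simp
  by_cases hl : x - ε ∈ D
  · obtain ⟨κ₂, hκ₂, h₂⟩ := gap (x - ε) hl (by linarith)
    refine ⟨min κ₁ κ₂, lt_min hκ₁ hκ₂, fun u hu hux => ?_⟩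
    rcases le_abs.1 hux with h3 | h3
    · linarith [right u hu h3, min_le_left κ₁ κ₂]
    · have h0 : 0 < x - u := by linarith
      have := h₂ u hu (ε / (x - u)) (by positivity) ((div_le_one h0).2 (by linarith))
        (by field_simp; ring)
      linarith [min_le_right κ₁ κ₂]
  · refine ⟨κ₁, hκ₁, fun u hu hux => ?_⟩
    rcases le_abs.1 hux with h3 | h3
    · exact right u hu h3
    -- The domain is closed upwards: if `x - ε` is outside, so is everything to its left.
    · exact absurd (h.mem_of_le hu (by linarith)) hl

end ScalarUtility

end Network
namespace Network

/-! ### Network utility and the controller as a penalized maximizer -/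

section VectorUtility

variable {N F : Type*} [Fintype N] [Fintype F] {net : Network N F} {D : F → Set ℝ}
  {U : F → ℝ → ℝ}

omit [Fintype F] in
theorem convex_sourceVectors (hU : ∀ f, IsUtility (D f) (U f)) :
    Convex ℝ (net.sourceVectors D) := by
  intro x hx y hy a b ha hb hab f n
  refine ⟨fun hn => (hU f).strictConcaveOn.1 ((hx f n).1 hn) ((hy f n).1 hn) ha hb hab,
    fun hn => ?_⟩
  simp [(hx f n).2 hn, (hy f n).2 hn]

theorem concaveOn_sourceUtility (hU : ∀ f, IsUtility (D f) (U f)) :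
    ConcaveOn ℝ (net.sourceVectors D) (net.sourceUtility U) := by
  refine ⟨convex_sourceVectors hU, fun x hx y hy a b ha hb hab => ?_⟩
  simp only [sourceUtility, smul_eq_mul, Finset.mul_sum, ← Finset.sum_add_distrib]
  exact Finset.sum_le_sum fun f _ => Finset.sum_le_sum fun n hn =>
    (hU f).strictConcaveOn.concaveOn.2 ((hx f n).1 hn) ((hy f n).1 hn) ha hb hab

omit [Fintype F] in
theorem sourceVectors_nonneg (hU : ∀ f, IsUtility (D f) (U f)) {x : QVec N F}
    (hx : x ∈ net.sourceVectors D) : 0 ≤ x := by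
  intro n f
  by_cases hn : n ∈ net.src f
  · exact (hU f).subset_Ici ((hx f n).1 hn)
  · exact ((hx f n).2 hn).ge

theorem flowUtility_eq_sourceUtility (h1 : ∀ f, (net.src f).card = 1) {x : QVec N F}
    (hx : x ∈ net.sourceVectors D) : flowUtility U x = net.sourceUtility U x := by
  refine Finset.sum_congr rfl fun f _ => ?_
  obtain ⟨n, hn⟩ := Finset.card_eq_one.1 (h1 f)
  rw [hn, Finset.sum_singleton, Finset.sum_eq_single n]
  · intro m _ hm
    exact (hx f m).2 (by simpa [hn] using hm)
  · simp

/-- The distance is a supremum, so some coordinate is off by `ε`, and it belongs to a source because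
the others vanish on both sides. That coordinate supplies `κ`; the remaining gaps are nonnegative by
concavity. -/
theorem exists_sourceUtility_gap (hU : ∀ f, IsUtility (D f) (U f)) {x : QVec N F}
    (hx : x ∈ net.sourceVectors D) {ε : ℝ} (hε : 0 < ε) :
    ∃ κ > 0, ∀ u ∈ net.sourceVectors D, ¬ dist u x < ε →
      (net.sourceUtility U u + net.sourceUtility U x) / 2 + κ
        ≤ net.sourceUtility U ((1 / 2 : ℝ) • u + (1 / 2 : ℝ) • x) := by
  have hgap : ∀ f n, ∃ κ > 0, n ∈ net.src f → ∀ u ∈ D f, ε ≤ |u - x n f| →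
      (U f u + U f (x n f)) / 2 + κ ≤ U f ((u + x n f) / 2) := by
    intro f n
    by_cases hn : n ∈ net.src f
    · obtain ⟨κ, hκ, h⟩ := (hU f).exists_midpoint_gap ((hx f n).1 hn) hε
      exact ⟨κ, hκ, fun _ => h⟩
    · exact ⟨1, one_pos, fun h => absurd h hn⟩
  choose k hk0 hk using hgap
  have hsmall : ∀ᶠ κ in 𝓝[>] (0 : ℝ), ∀ f n, κ < k f n := by
    rw [eventually_all]; intro f
    rw [eventually_all]; intro n
    exact mem_nhdsWithin_of_mem_nhds (gt_mem_nhds (hk0 f n))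
  obtain ⟨κ, hκ1, hκ0⟩ := (hsmall.and self_mem_nhdsWithin).exists
  refine ⟨κ, hκ0, fun u hu hd => ?_⟩
  have hfar : ∃ n f, ε ≤ |u n f - x n f| := by
    by_contra! hnot
    refine hd ?_
    rw [dist_pi_lt_iff hε]; intro n
    rw [dist_pi_lt_iff hε]; intro f
    exact hnot n f
  obtain ⟨n₀, f₀, hfar⟩ := hfar
  have hn₀ : n₀ ∈ net.src f₀ := by
    by_contra hn
    rw [(hu f₀ n₀).2 hn, (hx f₀ n₀).2 hn, sub_zero, abs_zero] at hfar
    linarith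
  have hmid : ∀ f n, ((1 / 2 : ℝ) • u + (1 / 2 : ℝ) • x) n f = (u n f + x n f) / 2 := by
    intro f n; simp only [Pi.add_apply, Pi.smul_apply, smul_eq_mul]; ring
  have hterm : ∀ f, ∀ n ∈ net.src f, 0 ≤
      U f ((u n f + x n f) / 2) - (U f (u n f) + U f (x n f)) / 2 := by
    intro f n hn
    by_cases he : u n f = x n f
    · rw [he]; simp
    · exact (sub_pos.2 (midpoint_lt (hU f).strictConcaveOn ((hu f n).1 hn)
        ((hx f n).1 hn) he)).le
  have hsum : net.sourceUtility U ((1 / 2 : ℝ) • u + (1 / 2 : ℝ) • x)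
      - (net.sourceUtility U u + net.sourceUtility U x) / 2
      = ∑ f, ∑ n ∈ net.src f,
        (U f ((u n f + x n f) / 2) - (U f (u n f) + U f (x n f)) / 2) := by
    simp only [sourceUtility, hmid, Finset.sum_sub_distrib, ← Finset.sum_div,
      Finset.sum_add_distrib]
  have h1 := Finset.single_le_sum
    (f := fun n => U f₀ ((u n f₀ + x n f₀) / 2) - (U f₀ (u n f₀) + U f₀ (x n f₀)) / 2)
    (fun n hn => hterm f₀ n hn) hn₀
  have h2 := Finset.single_le_sum
    (f := fun f => ∑ n ∈ net.src f,
      (U f ((u n f + x n f) / 2) - (U f (u n f) + U f (x n f)) / 2))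
    (fun f _ => Finset.sum_nonneg fun n hn => hterm f n hn) (Finset.mem_univ f₀)
  have h3 := hk f₀ n₀ hn₀ _ ((hu f₀ n₀).1 hn₀) hfar
  have h4 := hκ1 f₀ n₀
  linarith

/-- The source rates that the congestion controller may choose. -/
def rateBox (net : Network N F) (D : F → Set ℝ) : Set (QVec N F) :=
  net.sourceVectors D ∩ {y | ∀ n f, y n f ≤ net.lamMax}

omit [Fintype F] in
theorem convex_rateBox (hU : ∀ f, IsUtility (D f) (U f)) : Convex ℝ (net.rateBox D) := by
  refine (convex_sourceVectors hU).inter fun x hx y hy a b ha hb hab n f => ?_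
  simp only [Pi.add_apply, Pi.smul_apply, smul_eq_mul]
  calc a * x n f + b * y n f ≤ a * net.lamMax + b * net.lamMax :=
        add_le_add (mul_le_mul_of_nonneg_left (hx n f) ha) (mul_le_mul_of_nonneg_left (hy n f) hb)
    _ = net.lamMax := by rw [← add_mul, hab, one_mul]

theorem penalized_eq_sum [DecidableEq N] (V : ℝ) (q : QVec N F) {x : QVec N F}
    (hx : x ∈ net.sourceVectors D) :
    V * net.sourceUtility U x - dot q x
      = ∑ f, ∑ n ∈ net.src f, (V * U f (x n f) - q n f * x n f) := by
  have : dot q x = ∑ f, ∑ n ∈ net.src f, q n f * x n f := by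
    rw [dot, Finset.sum_comm]
    refine Finset.sum_congr rfl fun f _ => (Finset.sum_subset (Finset.subset_univ _) ?_).symm
    intro n _ hn
    rw [(hx f n).2 hn, mul_zero]
  rw [this]
  simp only [sourceUtility, Finset.mul_sum, Finset.sum_sub_distrib]

variable [DecidableEq N]

omit [DecidableEq N] in
theorem sourceUtility_le_of_mem_rateBox (hU : ∀ f, IsUtility (D f) (U f)) {x : QVec N F}
    (hx : x ∈ net.rateBox D) :
    net.sourceUtility U x ≤ ∑ f, ∑ _n ∈ net.src f, U f net.lamMax :=
  Finset.sum_le_sum fun f _ => Finset.sum_le_sum fun n hn =>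
    (hU f).monotoneOn ((hx.1 f n).1 hn) ((hU f).mem_of_le ((hx.1 f n).1 hn) (hx.2 n f)) (hx.2 n f)

variable {Pc : (N → Bool) → Set (Alloc N)} {Ω : Type*} [MeasurableSpace Ω] {μ : Measure Ω}
  {R : net.Run Pc μ} {V : ℝ}

theorem Run.IsANCC.lam_mem (h : R.IsANCC U V) (hU : ∀ f, IsUtility (D f) (U f))
    (hpos : ∀ f, ∀ n ∈ net.src f, 0 < net.lamMax) (t : ℕ) (ω : Ω) :
    R.lam t ω ∈ net.rateBox D := by
  refine ⟨fun f n => ⟨fun hn => ?_, fun hn => ?_⟩, fun n f => ?_⟩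
  · rw [h, if_pos hn]
    exact (hU f).clippedInvDeriv_mem _ (hpos f n hn)
  · rw [h, if_neg hn]
  · rw [h]
    split_ifs with hn
    · exact clippedInvDeriv_le _ net.lamMax_nonneg
    · exact net.lamMax_nonneg

/-- The congestion controller maximizes the penalized utility at the current queues. -/
theorem Run.IsANCC.penalized_le (h : R.IsANCC U V) (hV : 0 < V)
    (hU : ∀ f, IsUtility (D f) (U f))
    (hpos : ∀ f, ∀ n ∈ net.src f, 0 < net.lamMax) (t : ℕ) (ω : Ω) {x : QVec N F}
    (hx : x ∈ net.rateBox D) :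
    V * net.sourceUtility U x - dot (R.q t ω) x
      ≤ V * net.sourceUtility U (R.lam t ω) - dot (R.q t ω) (R.lam t ω) := by
  rw [penalized_eq_sum V _ hx.1, penalized_eq_sum V _ (h.lam_mem hU hpos t ω).1]
  refine Finset.sum_le_sum fun f _ => Finset.sum_le_sum fun n hn => ?_
  have h1 := (hU f).penalized_le (R.q t ω n f / V) (hpos f n hn) ((hx.1 f n).1 hn) (hx.2 n f)
  rw [h t ω n f, if_pos hn]
  have h2 := mul_le_mul_of_nonneg_left h1 hV.le
  have e : ∀ z, V * (U f z - R.q t ω n f / V * z) = V * U f z - R.q t ω n f * z := by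
    intro z; field_simp
  rwa [e, e] at h2

end VectorUtility

/-! ### Strictly feasible points and perturbation of the optimum -/

section InteriorPoint

variable {N F : Type*} [Fintype N] [DecidableEq N] [Fintype F] {net : Network N F}
  {Pc : (N → Bool) → Set (Alloc N)} {D : F → Set ℝ} {U : F → ℝ → ℝ}

/-- Sources are not destinations, so the cap `lamMax` cuts off no feasible point. -/
theorem numFeasible_subset_rateBox (hPc : ∀ s, Pc s ⊆ net.allocations s) :
    net.numFeasible Pc D ⊆ net.rateBox D := by
  refine fun x hx => ⟨hx.2, fun n f => ?_⟩
  by_cases hn : n ∈ net.src f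
  · exact le_lamMax_of_mem_capacityRegion hPc hx.1
      (Finset.disjoint_left.1 (net.src_disjoint_dst f) hn)
  · rw [(hx.2 f n).2 hn]
    exact net.lamMax_nonneg

/-- A strictly feasible point of the network utility maximization. -/
theorem exists_strictly_feasible (hPc : ∀ s, Pc s ⊆ net.allocations s)
    (hU : ∀ f, IsUtility (D f) (U f)) (hint : (net.capacityInterior Pc).Nonempty) :
    (∃ s, (Pc s).Nonempty) ∧ (∀ f, ∀ n ∈ net.src f, 0 < net.lamMax) ∧
      ∃ z ∈ net.rateBox D, ∃ δ > 0, net.HasMargin Pc δ z := by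
  classical
  obtain ⟨x, hx⟩ := hint
  have hx0 : 0 ≤ x := hx.1
  have hne := allowed_nonempty_of_mem_capacityRegion (mem_capacityRegion_of_mem_interior hx)
  obtain ⟨δ, hδ, hm⟩ := exists_hasMargin_of_mem_capacityInterior hPc hx
  -- Half of the margin is spent on positive source rates, which lie in every domain. Arrivals
  -- elsewhere are dropped, and half of the margin remains.
  set z : QVec N F := fun n f => if n ∈ net.src f then x n f + δ / 2 else 0 with hz
  have hpos : ∀ f, ∀ n ∈ net.src f, 0 < z n f := by
    intro f n hn
    have : 0 ≤ x n f := hx0 n f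
    simp only [hz, if_pos hn]
    positivity
  have hzs : z ∈ net.sourceVectors D := fun f n =>
    ⟨fun hn => (hU f).Ioi_subset (hpos f n hn), fun hn => by simp [hz, hn]⟩
  have hzm : net.HasMargin Pc (δ / 2) z := hm.mono fun n f => by
    have : 0 ≤ x n f := hx0 n f
    simp only [hz]
    split_ifs <;> linarith
  have hzc := hzm.mem_capacityRegion hPc hne (sourceVectors_nonneg hU hzs) (half_pos hδ)
  have hzb := numFeasible_subset_rateBox hPc (D := D) ⟨hzc, hzs⟩
  exact ⟨hne, fun f n hn => (hpos f n hn).trans_le (hzb.2 n f), z, hzb, δ / 2, half_pos hδ, hzm⟩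

/-- Nearly feasible source rates are nearly dominated by the optimum. -/
theorem exists_forall_sourceUtility_le (hPc : ∀ s, Pc s ⊆ net.allocations s)
    (hU : ∀ f, IsUtility (D f) (U f)) (hint : (net.capacityInterior Pc).Nonempty)
    {x : QVec N F} (hmax : IsMaxOn (net.sourceUtility U) (net.numFeasible Pc D) x)
    {κ : ℝ} (hκ : 0 < κ) :
    ∃ η > 0, ∀ y ∈ net.sourceVectors D, net.HasMargin Pc (-η) y →
      net.sourceUtility U y ≤ net.sourceUtility U x + κ := by
  obtain ⟨hne, -, z, hz, δ, hδ, hm⟩ := exists_strictly_feasible hPc hU hint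
  set Φ := net.sourceUtility U with hΦ
  set c := |Φ x - Φ z| + 1 with hc
  have hc0 : 0 < c := by positivity
  -- Weight of the strictly feasible `z` in a mixture with `y`. With `η = ρ * δ / 2` the mixture has
  -- margin at least `ρ * δ / 2`, hence is feasible. The choice `ρ * c ≤ κ / 2` limits the utility
  -- given up.
  set ρ := min (1 / 2) (κ / (2 * c)) with hρ
  have hρ0 : 0 < ρ := lt_min (by norm_num) (by positivity)
  have hρ1 : ρ ≤ 1 / 2 := min_le_left _ _
  have hρ2 : ρ * c ≤ κ / 2 := by
    have : ρ ≤ κ / (2 * c) := min_le_right _ _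
    rw [le_div_iff₀ (by positivity)] at this
    linarith
  refine ⟨ρ * δ / 2, by positivity, fun y hy hym => ?_⟩
  set u := (1 - ρ) • y + ρ • z with hu
  have hus : u ∈ net.sourceVectors D :=
    convex_sourceVectors hU hy hz.1 (by linarith) hρ0.le (by ring)
  have hum : net.HasMargin Pc (ρ * δ / 2) u := by
    intro w hw hd
    have h1 := mul_le_mul_of_nonneg_left (hym w hw hd) (show 0 ≤ 1 - ρ by linarith)
    have h2 := mul_le_mul_of_nonneg_left (hm w hw hd) hρ0.le
    rw [hu, dot_add_right, dot_smul_right, dot_smul_right]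
    have h3 : 0 ≤ ρ * (ρ * δ / 2 * total w) := by
      have := total_nonneg hw
      positivity
    linarith
  have huc := hum.mem_capacityRegion hPc hne (sourceVectors_nonneg hU hus) (by positivity)
  have h1 : Φ u ≤ Φ x := hmax ⟨huc, hus⟩
  have h2 : (1 - ρ) • Φ y + ρ • Φ z ≤ Φ u :=
    (concaveOn_sourceUtility hU).2 hy hz.1 (by linarith) hρ0.le (by ring)
  simp only [smul_eq_mul] at h2
  by_contra! hlt
  have h3 : ρ * (Φ x - Φ z) ≤ ρ * c :=
    mul_le_mul_of_nonneg_left ((le_abs_self _).trans (by linarith)) hρ0.le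
  have h4 : (1 - ρ) * (Φ x + κ) < (1 - ρ) * Φ y :=
    mul_lt_mul_of_pos_left hlt (by linarith)
  have h5 : κ / 2 ≤ (1 - ρ) * κ := by nlinarith
  linarith

end InteriorPoint

/-! ### Stability and almost feasibility under back pressure -/

section Scheduling

variable {N F : Type*} [Fintype N] [DecidableEq N] [Fintype F] {net : Network N F}
  {Pc : (N → Bool) → Set (Alloc N)} {Ω : Type*} [MeasurableSpace Ω] {μ : Measure Ω}
  {R : net.Run Pc μ} {K : ℝ}

theorem Run.IsMBP.maxWeight_le [DecidableEq F] (h : R.IsMBP)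
    (hPc : ∀ s, Pc s ⊆ net.allocations s) (t : ℕ) (ω : Ω) :
    net.maxWeight Pc (R.q t ω) ≤ flowGain (R.q t ω) (R.rate t ω) + net.mbpLoss := by
  obtain ⟨fs, hfs⟩ := h
  rw [(hfs t ω).2]
  exact (hfs t ω).1.maxWeight_le hPc (R.q_nonneg t ω)

/-- The constant of the drift bound under back pressure. -/
def mbpDriftConst (net : Network N F) (K : ℝ) : ℝ :=
  2 * net.mbpLoss + net.driftConst + 2 * (Fintype.card N * Fintype.card F * (2 + K)) + 2

omit [DecidableEq N] in
theorem mbpDriftConst_nonneg (net : Network N F) (hK : 0 ≤ K) : 0 ≤ net.mbpDriftConst K := by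
  have := net.rateMax_nonneg
  have := net.driftConst_nonneg
  unfold mbpDriftConst mbpLoss
  positivity

variable [DecidableEq F] [IsProbabilityMeasure μ]

theorem Run.IsMBP.ae_eventually_drift (h : R.IsMBP) (hPc : ∀ s, Pc s ⊆ net.allocations s)
    (hK : R.MomentBound K) (hK0 : 0 ≤ K) {c δ : ℝ} (hδ : 0 < δ)
    (hdrift : ∀ t ω, dot (R.q t ω) (R.lam t ω) + δ * total (R.q t ω)
      ≤ net.maxWeight Pc (R.q t ω) + c) :
    ∀ᵐ ω ∂μ, ∀ᶠ T : ℕ in atTop,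
      2 * ∑ t ∈ Finset.range T, (net.maxWeight Pc (R.q t ω) - dot (R.q t ω) (R.lam t ω))
        + lyap (R.q T ω) ≤ net.mbpDriftConst K * T :=
  Run.ae_eventually_sum_maxWeight_sub_dot_le hPc hK hK0 hδ (h.maxWeight_le hPc) hdrift

omit [DecidableEq F] [IsProbabilityMeasure μ] in
theorem Run.le_sum_maxWeight_sub_dot {c δ : ℝ}
    (hdrift : ∀ t ω, dot (R.q t ω) (R.lam t ω) + δ * total (R.q t ω)
      ≤ net.maxWeight Pc (R.q t ω) + c) (T : ℕ) (ω : Ω) :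
    δ * ∑ t ∈ Finset.range T, total (R.q t ω) - c * T ≤
      ∑ t ∈ Finset.range T, (net.maxWeight Pc (R.q t ω) - dot (R.q t ω) (R.lam t ω)) := by
  have : δ * ∑ t ∈ Finset.range T, total (R.q t ω) - c * T
      = ∑ t ∈ Finset.range T, (δ * total (R.q t ω) - c) := by
    rw [Finset.sum_sub_distrib, ← Finset.mul_sum]
    simp [mul_comm]
  rw [this]
  exact Finset.sum_le_sum fun t _ => by linarith [hdrift t ω]

theorem Run.IsMBP.stable (h : R.IsMBP) (hPc : ∀ s, Pc s ⊆ net.allocations s)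
    (hK : R.MomentBound K) {c δ : ℝ} (hδ : 0 < δ)
    (hdrift : ∀ t ω, dot (R.q t ω) (R.lam t ω) + δ * total (R.q t ω)
      ≤ net.maxWeight Pc (R.q t ω) + c) : R.Stable := by
  filter_upwards [h.ae_eventually_drift hPc (hK.mono (le_max_left K 0)) (le_max_right K 0) hδ
    hdrift] with ω hω
  refine ⟨(net.mbpDriftConst (max K 0) + 2 * c) / (2 * δ), ?_⟩
  filter_upwards [hω, eventually_gt_atTop 0] with T hT hT0
  have hT0' : (0 : ℝ) < T := by exact_mod_cast hT0
  rw [R.total_avgQueue, div_le_div_iff₀ hT0' (by positivity)]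
  have := R.le_sum_maxWeight_sub_dot hdrift T ω
  have := lyap_nonneg (R.q T ω)
  nlinarith

/-- Under a negative drift the average rates are almost feasible. -/
theorem Run.IsMBP.ae_eventually_hasMargin (h : R.IsMBP)
    (hPc : ∀ s, Pc s ⊆ net.allocations s) (hK : R.MomentBound K) {c δ : ℝ} (hδ : 0 < δ)
    (hdrift : ∀ t ω, dot (R.q t ω) (R.lam t ω) + δ * total (R.q t ω)
      ≤ net.maxWeight Pc (R.q t ω) + c) :
    ∀ᵐ ω ∂μ, ∀ η > 0, ∀ᶠ T : ℕ in atTop, net.HasMargin Pc (-η) (R.avgRate T ω) := by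
  filter_upwards [h.ae_eventually_drift hPc (hK.mono (le_max_left K 0)) (le_max_right K 0) hδ
    hdrift, Run.ae_eventually_abs_sum_noise_le hK] with ω h1 h2 η hη
  set B := net.mbpDriftConst (max K 0) + 2 * c with hB
  obtain ⟨T₀, hT₀⟩ := exists_nat_ge (B / (η / 2) ^ 2)
  filter_upwards [h1, h2 (η / 2) (by positivity), eventually_ge_atTop T₀, eventually_gt_atTop 0]
    with T hT1 hT2 hT3 hT0 w hw hd
  have hT0' : (0 : ℝ) < T := by exact_mod_cast hT0
  -- The drift bound gives `lyap (q T) = O(T)`, so single queues grow at most like `√T`. Half of `η`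
  -- covers them, the other half the noise.
  have hl : lyap (R.q T ω) ≤ (η / 2 * T) ^ 2 := by
    have h3 := R.le_sum_maxWeight_sub_dot hdrift T ω
    have h4 : 0 ≤ δ * ∑ t ∈ Finset.range T, total (R.q t ω) :=
      mul_nonneg hδ.le (Finset.sum_nonneg fun t _ => total_nonneg (R.q_nonneg t ω))
    have h5 : lyap (R.q T ω) ≤ B * T := by rw [hB]; linarith
    have h6 : B / (η / 2) ^ 2 ≤ T := hT₀.trans (by exact_mod_cast hT3)
    rw [div_le_iff₀ (by positivity)] at h6
    refine h5.trans ?_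
    calc B * T ≤ (T * (η / 2) ^ 2) * T := mul_le_mul_of_nonneg_right h6 hT0'.le
      _ = _ := by ring
  have hq : dot w (R.q T ω) ≤ η / 2 * T * total w := dot_le_mul_total hw fun n f =>
    (le_abs_self _).trans (abs_le_of_sq_le_sq ((sq_entry_le_lyap _ n f).trans hl) (by positivity))
  have h3 := R.dot_sum_lam_le hPc hw hd T ω
  have h4 := Run.dot_sum_noise_le hw hT2
  have h5 : dot w (∑ t ∈ Finset.range T, R.lam t ω)
      ≤ T * (net.maxWeight Pc w + η * total w) := by linarith
  rw [R.avgRate_eq, dot_smul_right]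
  have h6 := (inv_mul_le_iff₀ hT0').2 h5
  linarith

end Scheduling

end Network
namespace Network

/-! ### Throughput optimality -/

section Throughput

variable {N F : Type*} [Fintype N] [DecidableEq N] [Fintype F] {net : Network N F}
  {Pc : (N → Bool) → Set (Alloc N)}

theorem capacityRegion_mono {Pc' : (N → Bool) → Set (Alloc N)} (h : ∀ s, Pc s ⊆ Pc' s) :
    net.capacityRegion Pc ⊆ net.capacityRegion Pc' := by
  rintro x ⟨Ω, _, μ, hμ, R, K, hK, hlim, hst⟩
  let R' : net.Run Pc' μ :=
    { ℱ := R.ℱ, q₀ := R.q₀, q := R.q, s := R.s, p := R.p, rate := R.rate, a := R.a, lam := R.lam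
      q₀_nonneg := R.q₀_nonneg, q₀_dst := R.q₀_dst, measurable_s := R.measurable_s
      measurable_p := R.measurable_p, measurable_rate := R.measurable_rate
      measurable_lam := R.measurable_lam, measurable_a := R.measurable_a
      p_mem := fun t ω => h _ (R.p_mem t ω), rate_nonneg := R.rate_nonneg
      rate_le_link := R.rate_le_link, rate_le_queue := R.rate_le_queue, a_nonneg := R.a_nonneg
      integrable_a := R.integrable_a, condExp_a := R.condExp_a, q_zero := R.q_zero
      q_succ := R.q_succ }
  exact ⟨Ω, _, μ, hμ, R', K, hK, hlim, hst⟩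

theorem Run.IsMBP.stable_of_mem_capacityInterior [DecidableEq F] {Ω : Type*} [MeasurableSpace Ω]
    {μ : Measure Ω} [IsProbabilityMeasure μ] {R : net.Run Pc μ} {K : ℝ} (h : R.IsMBP)
    (hPc : ∀ s, Pc s ⊆ net.allocations s) (hK : R.MomentBound K) {x : QVec N F}
    (hx : x ∈ net.capacityInterior Pc) (hlam : ∀ t ω, R.lam t ω = x) : R.Stable := by
  obtain ⟨δ, hδ, hm⟩ := exists_hasMargin_of_mem_capacityInterior hPc hx
  refine h.stable hPc hK (c := 0) hδ fun t ω => ?_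
  rw [hlam, add_zero]
  exact hm _ (R.q_nonneg t ω) fun f n hn => R.q_dst t ω f n hn

end Throughput

/-! ### Drift plus penalty under congestion control -/

section CongestionControl

variable {N F : Type*} [Fintype N] [DecidableEq N] [Fintype F] {net : Network N F}
  {Pc : (N → Bool) → Set (Alloc N)} {D : F → Set ℝ} {U : F → ℝ → ℝ} {Ω : Type*}
  [MeasurableSpace Ω] {μ : Measure Ω} {R : net.Run Pc μ} {K V : ℝ}

/-- The controller does at least as well as the strictly feasible `z` in each frame. Since the
utility on the box is bounded above, the offered load `q·λ` exceeds `q·z` by at most a multiple of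
`V`, and `z` has margin `δ`. The constant `c` depends on `V`, but it does not enter the optimality
bound. -/
theorem Run.IsANCC.exists_drift (h : R.IsANCC U V) (hV : 0 < V)
    (hPc : ∀ s, Pc s ⊆ net.allocations s) (hU : ∀ f, IsUtility (D f) (U f))
    (hint : (net.capacityInterior Pc).Nonempty) :
    ∃ c, ∃ δ > 0, ∀ t ω, dot (R.q t ω) (R.lam t ω) + δ * total (R.q t ω)
      ≤ net.maxWeight Pc (R.q t ω) + c := by
  obtain ⟨-, hpos, z, hz, δ, hδ, hm⟩ := exists_strictly_feasible hPc hU hint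
  refine ⟨V * (∑ f, ∑ _n ∈ net.src f, U f net.lamMax - net.sourceUtility U z), δ, hδ,
    fun t ω => ?_⟩
  have h1 := h.penalized_le hV hU hpos t ω hz
  have h2 := mul_le_mul_of_nonneg_left
    (sourceUtility_le_of_mem_rateBox hU (h.lam_mem hU hpos t ω)) hV.le
  have h3 := hm _ (R.q_nonneg t ω) fun f n hn => R.q_dst t ω f n hn
  linarith

theorem Run.IsANCC.avgRate_mem (h : R.IsANCC U V) (hU : ∀ f, IsUtility (D f) (U f))
    (hpos : ∀ f, ∀ n ∈ net.src f, 0 < net.lamMax) {T : ℕ} (hT : 0 < T) (ω : Ω) :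
    R.avgRate T ω ∈ net.rateBox D := by
  have hT0 : (T : ℝ) ≠ 0 := by positivity
  rw [R.avgRate_eq, Finset.smul_sum]
  exact (convex_rateBox hU).sum_mem (fun _ _ => by positivity)
    (by simp [hT0]) fun t _ => h.lam_mem hU hpos t ω

theorem Run.IsANCC.sum_sourceUtility_le (h : R.IsANCC U V) (hU : ∀ f, IsUtility (D f) (U f))
    (hpos : ∀ f, ∀ n ∈ net.src f, 0 < net.lamMax) {T : ℕ} (hT : 0 < T) (ω : Ω) :
    ∑ t ∈ Finset.range T, net.sourceUtility U (R.lam t ω)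
      ≤ T * net.sourceUtility U (R.avgRate T ω) := by
  have hT0 : (0 : ℝ) < T := by exact_mod_cast hT
  have := (concaveOn_sourceUtility (net := net) hU).le_map_sum (t := Finset.range T)
    (w := fun _ => (T : ℝ)⁻¹) (p := fun t => R.lam t ω) (fun _ _ => by positivity)
    (by simp [hT0.ne']) fun t _ => (h.lam_mem hU hpos t ω).1
  rw [R.avgRate_eq, Finset.smul_sum]
  simp only [smul_eq_mul, ← Finset.mul_sum] at this
  exact (inv_mul_le_iff₀ hT0).1 this

/-- Drift plus penalty: the accumulated loss of penalized utility is at most linear. -/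
theorem Run.IsANCC.sub_mul_le (h : R.IsANCC U V) (hV : 0 < V)
    (hPc : ∀ s, Pc s ⊆ net.allocations s) (hU : ∀ f, IsUtility (D f) (U f))
    (hpos : ∀ f, ∀ n ∈ net.src f, 0 < net.lamMax) {x : QVec N F}
    (hx : x ∈ net.numFeasible Pc D) {T : ℕ} (hT : 0 < T) {ω : Ω} {B : ℝ}
    (hB : 2 * ∑ t ∈ Finset.range T, (net.maxWeight Pc (R.q t ω) - dot (R.q t ω) (R.lam t ω))
        + lyap (R.q T ω) ≤ B * T) :
    net.sourceUtility U x - B / 2 / V ≤ net.sourceUtility U (R.avgRate T ω) := by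
  have hT0 : (0 : ℝ) < T := by exact_mod_cast hT
  -- In each frame `V (Φ x - Φ λ) ≤ q·x - q·λ ≤ maxWeight q - q·λ`, by optimality of the controller
  -- and feasibility of `x`.
  have h1 : ∑ t ∈ Finset.range T, V * (net.sourceUtility U x - net.sourceUtility U (R.lam t ω))
      ≤ ∑ t ∈ Finset.range T, (net.maxWeight Pc (R.q t ω) - dot (R.q t ω) (R.lam t ω)) := by
    refine Finset.sum_le_sum fun t _ => ?_
    have h2 := h.penalized_le hV hU hpos t ω (numFeasible_subset_rateBox hPc hx)
    have h3 := dot_le_maxWeight hPc hx.1 (R.q_nonneg t ω) fun f n hn => R.q_dst t ω f n hn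
    linarith
  rw [← Finset.mul_sum, Finset.sum_sub_distrib, Finset.sum_const, Finset.card_range,
    nsmul_eq_mul] at h1
  have h2 := mul_le_mul_of_nonneg_left (h.sum_sourceUtility_le hU hpos hT ω) hV.le
  have h3 := lyap_nonneg (R.q T ω)
  have h4 : T * (V * (net.sourceUtility U x - net.sourceUtility U (R.avgRate T ω)))
      ≤ T * (B / 2) := by linarith
  have h5 := le_of_mul_le_mul_left h4 hT0
  rw [mul_comm, ← le_div_iff₀ hV] at h5
  linarith

variable [DecidableEq F] [IsProbabilityMeasure μ]

/-- Utility optimality of back pressure with congestion control. -/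
theorem Run.IsMBP.stable_and_near_optimal (h : R.IsMBP) (hA : R.IsANCC U V) (hV : 0 < V)
    (hPc : ∀ s, Pc s ⊆ net.allocations s) (hU : ∀ f, IsUtility (D f) (U f))
    (hint : (net.capacityInterior Pc).Nonempty) (hK : R.MomentBound K) :
    R.Stable ∧ ∀ x ∈ net.numFeasible Pc D, ∀ᵐ ω ∂μ, ∀ᶠ T : ℕ in atTop,
      R.avgRate T ω ∈ net.sourceVectors D ∧
      net.sourceUtility U x - net.mbpDriftConst (max K 0) / 2 / V
        ≤ net.sourceUtility U (R.avgRate T ω) := by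
  obtain ⟨-, hpos, -⟩ := exists_strictly_feasible hPc hU hint
  obtain ⟨c, δ, hδ, hdrift⟩ := hA.exists_drift hV hPc hU hint
  refine ⟨h.stable hPc hK hδ hdrift, fun x hx => ?_⟩
  filter_upwards [h.ae_eventually_drift hPc (hK.mono (le_max_left K 0)) (le_max_right K 0) hδ
    hdrift] with ω hω
  filter_upwards [hω, eventually_gt_atTop 0] with T hT hT0
  exact ⟨(hA.avgRate_mem hU hpos hT0 ω).1, hA.sub_mul_le hV hPc hU hpos hx hT0 hT⟩

omit [DecidableEq F] [IsProbabilityMeasure μ] in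
/-- If a penalized optimum at the average queues had a midpoint gap `κ` to the optimum `x`, the
average utility would exceed the optimal one. -/
theorem Run.IsANCC.gap_le (hA : R.IsANCC U V) (hV : 0 < V)
    (hPc : ∀ s, Pc s ⊆ net.allocations s) (hU : ∀ f, IsUtility (D f) (U f))
    (hpos : ∀ f, ∀ n ∈ net.src f, 0 < net.lamMax) {x y : QVec N F}
    (hx : x ∈ net.numFeasible Pc D) {T : ℕ} (hT0 : 0 < T) {ω : Ω} {B κ : ℝ}
    (hB : 2 * ∑ t ∈ Finset.range T, (net.maxWeight Pc (R.q t ω) - dot (R.q t ω) (R.lam t ω))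
        + lyap (R.q T ω) ≤ B * T)
    (hy : net.IsPenalizedOptimum D U V (R.avgQueue T ω) y)
    (hgap : (net.sourceUtility U y + net.sourceUtility U x) / 2 + κ
        ≤ net.sourceUtility U ((1 / 2 : ℝ) • y + (1 / 2 : ℝ) • x)) :
    V * (net.sourceUtility U x + 2 * κ)
      ≤ V * net.sourceUtility U (R.avgRate T ω) + B / 2 := by
  have hT0' : (0 : ℝ) < T := by exact_mod_cast hT0
  set q := R.avgQueue T ω with hq
  have hyb : y ∈ net.rateBox D := hy.1
  have hq0 : 0 ≤ q := by
    rw [hq, R.avgQueue_eq]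
    exact smul_nonneg (by positivity) (Finset.sum_nonneg fun t _ => R.q_nonneg t ω)
  have hqd : ∀ f, ∀ n ∈ net.dst f, q n f = 0 := by
    intro f n hn
    rw [hq, R.avgQueue_eq, Pi.smul_apply, Pi.smul_apply, Finset.sum_apply, Finset.sum_apply,
      Finset.sum_eq_zero fun t _ => R.q_dst t ω f n hn, smul_zero]
  -- The midpoint of `y` and `x` competes with `y` in the penalized problem. With the gap this
  -- yields `V Φ x + 2 V κ - q·x ≤ V Φ y - q·y`.
  have h1 : V * net.sourceUtility U ((1 / 2 : ℝ) • y + (1 / 2 : ℝ) • x)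
      - dot q ((1 / 2 : ℝ) • y + (1 / 2 : ℝ) • x) ≤ V * net.sourceUtility U y - dot q y :=
    hy.2 (convex_rateBox hU hyb (numFeasible_subset_rateBox hPc hx) (by norm_num) (by norm_num)
      (by norm_num))
  rw [dot_add_right, dot_smul_right, dot_smul_right] at h1
  have h2 := mul_le_mul_of_nonneg_left hgap hV.le
  have h3 := dot_le_maxWeight hPc hx.1 hq0 hqd
  -- Jensen's inequality for the sublinear `maxWeight`, in the form needed at the average queue.
  have h4 : T * net.maxWeight Pc q ≤ ∑ t ∈ Finset.range T, net.maxWeight Pc (R.q t ω) := by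
    rw [hq, R.avgQueue_eq]
    have := (maxWeight_smul_le hPc (c := (T : ℝ)⁻¹) (by positivity)
      (∑ t ∈ Finset.range T, R.q t ω)).trans
      (mul_le_mul_of_nonneg_left (maxWeight_sum_le hPc _ _) (by positivity))
    exact (le_inv_mul_iff₀ hT0').1 this
  have h5 : T * (V * net.sourceUtility U y - dot q y) ≤
      ∑ t ∈ Finset.range T,
        (V * net.sourceUtility U (R.lam t ω) - dot (R.q t ω) (R.lam t ω)) := by
    calc T * (V * net.sourceUtility U y - dot q y)
        = ∑ t ∈ Finset.range T, (V * net.sourceUtility U y - dot (R.q t ω) y) := by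
          rw [Finset.sum_sub_distrib, ← dot_sum_left, Finset.sum_const, Finset.card_range,
            nsmul_eq_mul, hq, R.avgQueue_eq, dot_smul_left]
          field_simp
      _ ≤ _ := Finset.sum_le_sum fun t _ => hA.penalized_le hV hU hpos t ω hyb
  rw [Finset.sum_sub_distrib, ← Finset.mul_sum] at h5
  rw [Finset.sum_sub_distrib] at hB
  have h6 := mul_le_mul_of_nonneg_left (hA.sum_sourceUtility_le hU hpos hT0 ω) hV.le
  have h7 := lyap_nonneg (R.q T ω)
  have h8 : T * (V * net.sourceUtility U y - dot q y + net.maxWeight Pc q)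
      ≤ T * (V * net.sourceUtility U (R.avgRate T ω) + B / 2) := by linarith
  have h9 := le_of_mul_le_mul_left h8 hT0'
  linarith

/-- For a large parameter `V`, the average rates and the penalized optima at the average queues are
close to the optimum. -/
theorem Run.IsMBP.near_optimum (hPc : ∀ s, Pc s ⊆ net.allocations s)
    (hU : ∀ f, IsUtility (D f) (U f)) (hint : (net.capacityInterior Pc).Nonempty)
    {x : QVec N F} (hx : x ∈ net.numFeasible Pc D) {κ η ε : ℝ} (hη : 0 < η) (hκ : 0 < κ)
    (hgap : ∀ u ∈ net.sourceVectors D, ¬ dist u x < ε →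
      (net.sourceUtility U u + net.sourceUtility U x) / 2 + κ
        ≤ net.sourceUtility U ((1 / 2 : ℝ) • u + (1 / 2 : ℝ) • x))
    (hnear : ∀ y ∈ net.sourceVectors D, net.HasMargin Pc (-η) y →
      net.sourceUtility U y ≤ net.sourceUtility U x + κ / 2)
    (hV : net.mbpDriftConst (max K 0) / κ + 1 ≤ V) (hK : R.MomentBound K) (h : R.IsMBP)
    (hA : R.IsANCC U V) :
    ∀ᵐ ω ∂μ, ∀ᶠ T : ℕ in atTop, dist (R.avgRate T ω) x < ε ∧
      ∀ y, net.IsPenalizedOptimum D U V (R.avgQueue T ω) y → dist y x < ε := by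
  set B := net.mbpDriftConst (max K 0) with hBdef
  have hB0 : 0 ≤ B := net.mbpDriftConst_nonneg (le_max_right K 0)
  have hV0 : 0 < V := by
    have : 0 ≤ B / κ := by positivity
    linarith
  -- This is what the threshold on `V` buys: the optimality loss `B / (2V)` falls below `κ / 2`.
  have hBV : B < κ * V := by
    have : B / κ < V := by linarith
    rw [div_lt_iff₀ hκ] at this
    linarith
  obtain ⟨-, hpos, -⟩ := exists_strictly_feasible hPc hU hint
  obtain ⟨c, δ, hδ, hdrift⟩ := hA.exists_drift hV0 hPc hU hint
  filter_upwards [h.ae_eventually_drift hPc (hK.mono (le_max_left K 0)) (le_max_right K 0) hδ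
    hdrift, h.ae_eventually_hasMargin hPc hK hδ hdrift] with ω h1 h2
  filter_upwards [h1, h2 η hη, eventually_gt_atTop 0] with T hT hTm hT0
  have hmem := (hA.avgRate_mem hU hpos hT0 ω).1
  have hlow := hA.sub_mul_le hV0 hPc hU hpos hx hT0 hT
  refine ⟨?_, fun y hy => ?_⟩
  · by_contra hd
    have h3 := hgap _ hmem hd
    -- The midpoint of an almost feasible and a feasible point is almost feasible. Its utility would
    -- exceed `Φ x + κ - κ / 4`, while `hnear` allows only `Φ x + κ / 2`.
    have hm : net.HasMargin Pc (-η) ((1 / 2 : ℝ) • R.avgRate T ω + (1 / 2 : ℝ) • x) := by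
      intro w hw hwd
      have h4 := hTm w hw hwd
      have h5 := dot_le_maxWeight hPc hx.1 hw hwd
      have h6 := mul_nonneg hη.le (total_nonneg hw)
      rw [dot_add_right, dot_smul_right, dot_smul_right]
      linarith
    have h4 := hnear _ (convex_sourceVectors hU hmem hx.2 (by norm_num) (by norm_num)
      (by norm_num)) hm
    have h5 : B / 2 / V < κ / 2 := by
      rw [div_lt_iff₀ hV0]
      linarith
    linarith
  · by_contra hd
    have h3 := hA.gap_le hV0 hPc hU hpos hx hT0 hT hy (hgap y hy.1.1 hd)
    have h4 := mul_le_mul_of_nonneg_left (hnear _ hmem hTm) hV0.le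
    rw [← hBdef] at h3
    -- Together `h3` and `h4` give `2 V κ ≤ V κ / 2 + B / 2`, which contradicts `B < κ * V`.
    nlinarith [mul_pos hV0 hκ]

end CongestionControl

/-! ### Fixed equal power and directed bipartite subgraphs -/

section EqualPower

variable {N F : Type*} [Fintype N] [DecidableEq N] {net : Network N F}

theorem mem_dbsgLinks {s : N → Bool} {n m : N} :
    (n, m) ∈ net.dbsgLinks s ↔ m ∈ net.nbrs n ∧ s n = true ∧ s m = false := by
  simp [dbsgLinks]

theorem equalPower_mem_allocations (net : Network N F) (s : N → Bool) :
    net.equalPower s ∈ net.allocations s := by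
  have h0 : ∀ n m, 0 ≤ net.equalPower s n m := fun n m => by
    unfold equalPower; split_ifs <;> positivity
  have hle : ∀ n m, net.equalPower s n m ≤ 1 / ((net.nbrs n).card : ℝ) := fun n m => by
    unfold equalPower; split_ifs
    · exact le_rfl
    · positivity
  refine ⟨fun n m => ⟨h0 n m, ?_⟩, fun n => ?_, fun n m h => ?_⟩
  · exact (hle n m).trans (by simpa using Nat.cast_inv_le_one (α := ℝ) _)
  · calc ∑ m ∈ net.nbrs n, net.equalPower s n m
        ≤ (net.nbrs n).card * (1 / ((net.nbrs n).card : ℝ)) := by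
          simpa using Finset.sum_le_card_nsmul (net.nbrs n) (fun m => net.equalPower s n m) _
            fun m _ => hle n m
      _ ≤ 1 := by
          rw [mul_one_div]
          exact div_self_le_one _
  · by_contra hn
    exact h (if_neg fun h' => hn (mem_dbsgLinks.1 h'))

theorem linkRate_equalPower (h0 : ∀ n m i j, net.crossGain n m i j = 0) (s : N → Bool)
    (n m : N) : net.linkRate (net.equalPower s) n m
      = if (n, m) ∈ net.dbsgLinks s then net.fixedRate n m else 0 := by
  split_ifs with h
  · have hI : net.interference (net.equalPower s) n m = 0 :=
      Finset.sum_eq_zero fun i _ => Finset.sum_eq_zero fun j _ => by simp [h0]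
    simp [linkRate, fixedRate, soloRate, hI, equalPower, h]
  · exact net.linkRate_of_power_eq_zero (if_neg h)

variable [Fintype F] [DecidableEq F]

/-- On each link only the top flow has a nonzero rate, so it realizes both the supremum in the
metric and the pressure in the weight. Links outside the subgraph have rate zero and drop out of the
objective. -/
theorem mbpObjective_equalPower (h0 : ∀ n m i j, net.crossGain n m i j = 0) {q : QVec N F}
    (hq : 0 ≤ q) {fs : N → N → F} (hfs : IsTopFlow q fs) (s : N → Bool) :
    net.mbpObjective q fs (net.equalPower s)
      = ∑ l ∈ net.dbsgLinks s, net.dbsgWeight q fs s l.1 l.2 := by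
  have hp := net.equalPower_mem_allocations s
  have hterm : ∀ n m, ⨆ f, net.mbpRate q fs (net.equalPower s) n m f * (q n f - q m f)
      = if (n, m) ∈ net.dbsgLinks s then net.dbsgWeight q fs s n m else 0 := by
    intro n m
    have : Nonempty F := ⟨fs n m⟩
    have hsup : ⨆ f, net.mbpRate q fs (net.equalPower s) n m f * (q n f - q m f)
        = net.mbpRate q fs (net.equalPower s) n m (fs n m)
          * (q n (fs n m) - q m (fs n m)) := by
      refine le_antisymm (ciSup_le fun f => ?_) (le_ciSup
        (f := fun f => net.mbpRate q fs (net.equalPower s) n m f * (q n f - q m f))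
        (Set.finite_range _).bddAbove (fs n m))
      by_cases hf : f = fs n m
      · rw [hf]
      · rw [mbpRate_of_ne hf, zero_mul]
        exact mbpRate_mul_nonneg hp hq n m _
    have hpress : ⨆ f, (q n f - q m f) = q n (fs n m) - q m (fs n m) :=
      le_antisymm (ciSup_le fun f => hfs n m f)
        (le_ciSup (f := fun f => q n f - q m f) (Set.finite_range _).bddAbove (fs n m))
    rw [hsup]
    by_cases hl : (n, m) ∈ net.dbsgLinks s
    · rw [if_pos hl, dbsgWeight, hpress]
      by_cases hpos : 0 < q n (fs n m) - q m (fs n m)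
      · rw [max_eq_right hpos.le, mbpRate, if_pos ⟨rfl, hpos⟩, share]
        -- The zero rates outside the subgraph also leave the denominators of the two shares equal.
        have hden : ∑ m' ∈ Finset.univ.filter (fun m' => fs n m' = fs n m),
              net.linkRate (net.equalPower s) n m'
            = ∑ m' ∈ Finset.univ.filter (fun m' => (n, m') ∈ net.dbsgLinks s ∧
                fs n m' = fs n m), net.fixedRate n m' := by
          simp only [linkRate_equalPower h0]
          rw [← Finset.sum_filter, Finset.filter_filter]
          simp only [and_comm]
        rw [hden, linkRate_equalPower h0, if_pos hl]
      · rw [max_eq_left (not_lt.1 hpos), mul_zero, mbpRate, if_neg fun h => hpos h.2, zero_mul]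
    · rw [if_neg hl]
      have hr : net.linkRate (net.equalPower s) n m = 0 := by
        rw [linkRate_equalPower h0, if_neg hl]
      have : net.mbpRate q fs (net.equalPower s) n m (fs n m) = 0 := by
        rw [mbpRate, share, hr]
        simp
      rw [this, zero_mul]
  simp only [mbpObjective, hterm]
  rw [← Fintype.sum_prod_type' (f := fun n m => if (n, m) ∈ net.dbsgLinks s
    then net.dbsgWeight q fs s n m else 0), ← Finset.sum_filter]
  simp

/-- With fixed equal power and no interference, back pressure selects a maximum weighted directed
bipartite subgraph. -/
theorem isMBPChoice_equalPower_iff (h0 : ∀ n m i j, net.crossGain n m i j = 0) {q : QVec N F}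
    (hq : 0 ≤ q) {fs : N → N → F} (hfs : IsTopFlow q fs) (s : N → Bool) (p : Alloc N) :
    net.IsMBPChoice (fun s => {net.equalPower s}) q fs s p ↔
      p = net.equalPower s ∧ net.IsMaxWeightDBSG q fs s := by
  simp only [IsMBPChoice, IsMaxWeightDBSG, Set.mem_singleton_iff, forall_eq,
    mbpObjective_equalPower h0 hq hfs]
  constructor
  · rintro ⟨-, rfl, h⟩
    simp only [mbpObjective_equalPower h0 hq hfs] at h
    exact ⟨rfl, h⟩
  · rintro ⟨rfl, h⟩
    simp only [mbpObjective_equalPower h0 hq hfs]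
    exact ⟨hfs, trivial, h⟩

end EqualPower

end Network
end MUMIMO

end

/-! ### Assembly of the main theorem -/

theorem mainTheorem3 {N F : Type*} [Fintype N] [DecidableEq N] [Fintype F] [DecidableEq F]
    (net : MUMIMO.Network N F) (Pc : (N → Bool) → Set (MUMIMO.Alloc N))
    (hPc : ∀ s, Pc s ⊆ net.allocations s) :
    -- the constrained capacity region is part of the unconstrained one
    net.capacityRegion Pc ⊆ net.capacityRegion net.allocations ∧
    -- constrained back pressure is throughput optimal for the constrained region
    (∀ x ∈ net.capacityInterior Pc,
      ∀ (Ω : Type*) [MeasurableSpace Ω] (μ : Measure Ω) [IsProbabilityMeasure μ]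
        (R : net.Run Pc μ) (K : ℝ), R.MomentBound K → R.IsMBP → (∀ t ω, R.lam t ω = x) →
        R.Stable) ∧
    -- with congestion control it is stable and optimal for the constrained NUM problem
    (∀ (D : F → Set ℝ) (U : F → ℝ → ℝ), (∀ f, MUMIMO.Network.IsUtility (D f) (U f)) →
      (net.capacityInterior Pc).Nonempty →
      ∀ obj : MUMIMO.QVec N F → ℝ,
        (obj = net.sourceUtility U ∨
          ((∀ f, (net.src f).card = 1) ∧ obj = MUMIMO.Network.flowUtility U)) →
        (∀ K : ℝ, ∃ C : ℝ, ∀ V : ℝ, 0 < V →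
          ∀ (Ω : Type*) [MeasurableSpace Ω] (μ : Measure Ω) [IsProbabilityMeasure μ]
            (R : net.Run Pc μ), R.MomentBound K → R.IsMBP → R.IsANCC U V →
            R.Stable ∧
            ∀ x ∈ net.numFeasible Pc D, ∀ᵐ ω ∂μ, ∀ᶠ T : ℕ in atTop,
              obj x - C / V ≤ obj (R.avgRate T ω)) ∧
        (∀ x ∈ net.numFeasible Pc D, IsMaxOn obj (net.numFeasible Pc D) x →
          ∀ (K ε : ℝ), 0 < ε → ∃ V₀ : ℝ, 0 < V₀ ∧ ∀ V : ℝ, V₀ ≤ V →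
          ∀ (Ω : Type*) [MeasurableSpace Ω] (μ : Measure Ω) [IsProbabilityMeasure μ]
            (R : net.Run Pc μ), R.MomentBound K → R.IsMBP → R.IsANCC U V →
            ∀ᵐ ω ∂μ, ∀ᶠ T : ℕ in atTop,
              dist (R.avgRate T ω) x < ε ∧
              ∀ y, net.IsPenalizedOptimum D U V (R.avgQueue T ω) y → dist y x < ε)) ∧
    -- fixed equal power is an admissible constraint, and without interference it turns the
    -- scheduler into a maximum weighted directed bipartite subgraph problem
    (∀ s, net.equalPower s ∈ net.allocations s) ∧
    ((∀ n m i j, net.crossGain n m i j = 0) →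
      ∀ (q : MUMIMO.QVec N F) (fs : N → N → F) (s : N → Bool) (p : MUMIMO.Alloc N), 0 ≤ q →
        MUMIMO.Network.IsTopFlow q fs →
        (net.IsMBPChoice (fun s => {net.equalPower s}) q fs s p ↔
          p = net.equalPower s ∧ net.IsMaxWeightDBSG q fs s)) := by
  classical
  refine ⟨MUMIMO.Network.capacityRegion_mono hPc, ?_, ?_, net.equalPower_mem_allocations, ?_⟩
  · intro x hx Ω _ μ _ R K hK hR hlam
    exact hR.stable_of_mem_capacityInterior hPc hK hx hlam
  · intro D U hU hint obj hobj
    -- With one source per flow the two objectives agree on source vectors, so everything reduces to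
    -- `sourceUtility`.
    have hobj' : ∀ x ∈ net.sourceVectors D, obj x = net.sourceUtility U x := by
      intro x hx
      rcases hobj with rfl | ⟨h1, rfl⟩
      · rfl
      · exact MUMIMO.Network.flowUtility_eq_sourceUtility h1 hx
    refine ⟨fun K => ⟨net.mbpDriftConst (max K 0) / 2, ?_⟩, ?_⟩
    · intro V hV Ω _ μ _ R hK hR hA
      obtain ⟨hst, hopt⟩ := hR.stable_and_near_optimal hA hV hPc hU hint hK
      refine ⟨hst, fun x hx => ?_⟩
      filter_upwards [hopt x hx] with ω hω
      filter_upwards [hω] with T hT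
      rw [hobj' x hx.2, hobj' _ hT.1]
      exact hT.2
    · intro x hx hmax K ε hε
      have hmax' : IsMaxOn (net.sourceUtility U) (net.numFeasible Pc D) x := by
        intro y hy
        have h1 : obj y ≤ obj x := hmax hy
        rwa [hobj' y hy.2, hobj' x hx.2] at h1
      obtain ⟨κ, hκ, hgap⟩ := MUMIMO.Network.exists_sourceUtility_gap hU hx.2 hε
      obtain ⟨η, hη, hnear⟩ :=
        MUMIMO.Network.exists_forall_sourceUtility_le hPc hU hint hmax' (half_pos hκ)
      have hB := net.mbpDriftConst_nonneg (le_max_right K 0)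
      -- The threshold depends on `κ` and the drift constant only, hence not on the probability
      -- space or the run.
      refine ⟨net.mbpDriftConst (max K 0) / κ + 1, by positivity, ?_⟩
      intro V hV Ω _ μ _ R hK hR hA
      exact MUMIMO.Network.Run.IsMBP.near_optimum hPc hU hint hx hη hκ hgap hnear hV hK hR hA
  · intro h0 q fs s p hq hfs
    exact MUMIMO.Network.isMBPChoice_equalPower_iff h0 hq hfs s p
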